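/- **Setting.** Let $K$ be an algebraically closed field, $P=K[[x,y]]$, and let $f=f_1\cdots f_r$ ($r\ge 1$) be a product of irreducible power series $f_i\in P$ such that $R=P/\langle f\rangle$ is reduced. Let $\overline R$ be the integral closure of $R$ in its total ring of fractions, $\nu:R\to\overline R$ the normalization map and $\varphi:P\to R\xrightarrow{\nu}\overline R$ the parametrization. Let $\mathcal A_K$ be the category of Noetherian complete local $K$-algebras $A$ with $A/\mathfrak m_A=K$, with local $K$-algebra homomorphisms. A *deformation with sections of the parametrization* $P\to\overline R$ over $A\in\mathcal A_K$ consists of $P_A\in\mathcal A_K$ and $\overline R_A=\bigoplus_{i=1}^r\overline R_{A,i}$ with $\overline R_{A,i}\in\mathcal A_K$, homomorphisms $A\to P_A\xrightarrow{\varphi_A}\overline R_A$ such that $P_A$ and all $\overline R_{A,i}$ are flat over $A$, identifications $P_A\otimes_AK\cong P$ and $\overline R_A\otimes_AK\cong\overline R$ which are compatible with $\varphi_A$ and $\varphi$ and for which the summand $\overline R_{A,i}$ lies over the branch $f_i$, and sections $\sigma:P_A\to A$, $\overline\sigma_i:\overline R_{A,i}\to A$ of the structure maps with $\overline\sigma_i\circ\varphi_{A,i}=\sigma$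 for all $i$. A morphism from a deformation over $A$ to one over $B$ consists of homomorphisms $A\to B$, $P_A\to P_B$, $\overline R_{A,i}\to\overline R_{B,i}$ commuting with all these data (in particular inducing the identity on $P\to\overline R$). Deformations with sections of $\nu:R\to\overline R$ (with $R_A$ in place of $P_A$) and of the sequence $P\to R\to\overline R$ (given by $A\to P_A\to R_A\to\overline R_A$, with compatible sections of $P_A$, $R_A$ and the $\overline R_{A,i}$) are defined analogously. The resulting categories over $\mathcal A_K$ are denoted $\mathrm{Def}^{sec}_{\overline R\leftarrow P}$, $\mathrm{Def}^{sec}_{\overline R\leftarrow R}$, $\mathrm{Def}^{sec}_{\overline R\leftarrow R\leftarrow P}$; their fibre categories over $A$ (morphisms being the identity on $A$) are denoted by adding $(A)$, and $\underline{\mathrm{Def}}^{sec}(A)$ is the set of isomorphism classes of $\mathrm{Def}^{sec}(A)$. A morphism $\xi\to\eta$ over $\psi:A\to B$ exhibits $\eta$ as the deformation induced from $\xi$ by $\psi$. For each of the three categories induced deformations exist and are unique up to isomorphism, so that $\underline{\mathrm{Def}}^{sec}$ is a functor $\mathcal A_K\to(\mathrm{Sets})$. **Proposition 1.3.** 1.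 For every $A\in\mathcal A_K$ the forgetful functor $\mathrm{Def}^{sec}_{\overline R\leftarrow R\leftarrow P}(A)\to\mathrm{Def}^{sec}_{\overline R\leftarrow P}(A)$ is an isomorphism of categories (up to the choice of $R_A$ within its isomorphism class): it is an equivalence, and every object of the target is the image of an object of the source, which is therefore unique up to a unique isomorphism over the identity. 2. The forgetful functor $\mathrm{Def}^{sec}_{\overline R\leftarrow R\leftarrow P}\to\mathrm{Def}^{sec}_{\overline R\leftarrow R}$ is smooth: if $B\to A$ is a surjection in $\mathcal A_K$, $\eta$ is a deformation with sections of $R\to\overline R$ over $B$, $\zeta$ one of $P\to R\to\overline R$ over $A$, and $g$ is a morphism over $B\to A$ from $\eta$ to the image of $\zeta$, then there are a deformation $\zeta'$ of $P\to R\to\overline R$ over $B$, a morphism $\zeta'\to\zeta$ over $B\to A$, and an isomorphism over the identity of $B$ from the image of $\zeta'$ to $\eta$, compatible with $g$. 3. Both forgetful functors induce isomorphisms of functors $\underline{\mathrm{Def}}^{sec}_{\overline R\leftarrow R\leftarrow P}\cong\underline{\mathrm{Def}}^{sec}_{\overline R\leftarrow P}$ and $\underline{\mathrm{Def}}^{sec}_{\overline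 R\leftarrow R\leftarrow P}\cong\underline{\mathrm{Def}}^{sec}_{\overline R\leftarrow R}$. In particular, $\underline{\mathrm{Def}}^{sec}_{\overline R\leftarrow P}\cong\underline{\mathrm{Def}}^{sec}_{\overline R\leftarrow R}$. 4. If $(P_A\xrightarrow{\varphi_A}\overline R_A,\overline\sigma,\sigma)$ is an object of $\mathrm{Def}^{sec}_{\overline R\leftarrow P}(A)$, then $\ker(\varphi_A)$ is a principal ideal, and its lifting to $\mathrm{Def}^{sec}_{\overline R\leftarrow R\leftarrow P}(A)$ is given by $R_A=P_A/\ker(\varphi_A)$: for every lifting $P_A\to R_A\to\overline R_A$ there is an isomorphism $P_A/\ker(\varphi_A)\cong R_A$ compatible with the maps from $P_A$ and to $\overline R_A$. -/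

import Mathlib

open CategoryTheory

universe u

namespace CurveDef

/-! ### The base category -/

/-- The category of Noetherian complete local `K`-algebras `A` with `A / m_A = K`. -/
structure CLAlg (K : Type u) [Field K] : Type (u + 1) where
  carrier : Type u
  [commRing : CommRing carrier]
  [algebra : Algebra K carrier]
  [isLocalRing : IsLocalRing carrier]
  [isNoetherianRing : IsNoetherianRing carrier]
  [isAdicComplete : IsAdicComplete (IsLocalRing.maximalIdeal carrier) carrier]
  residue_bijective :
    Function.Bijective (algebraMap K (IsLocalRing.ResidueField carrier))

namespace CLAlg

variable {K : Type u} [Field K]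

instance : CoeSort (CLAlg K) (Type u) := ⟨CLAlg.carrier⟩

attribute [instance] commRing algebra isLocalRing isNoetherianRing isAdicComplete

/-- Morphisms are `K`-algebra homomorphisms; they are automatically local,
see `isLocalHom_algHom` below. -/
instance : Category (CLAlg K) where
  Hom A B := A →ₐ[K] B
  id A := AlgHom.id K A
  comp g h := AlgHom.comp h g

theorem isLocalHom_algHom (A B : CLAlg K) (g : A →ₐ[K] B) : IsLocalHom g := by
  constructor
  intro a ha
  by_contra hna
  obtain ⟨c, hc⟩ := A.residue_bijective.2 (IsLocalRing.residue A a)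
  have hc0 : c = 0 := by
    have h0 : IsLocalRing.residue A a = 0 := by
      rw [IsLocalRing.residue_eq_zero_iff]
      exact (IsLocalRing.mem_maximalIdeal a).2 hna
    rw [h0] at hc
    exact A.residue_bijective.1 (by rw [hc, map_zero])
  obtain ⟨d, hd⟩ := B.residue_bijective.2 (IsLocalRing.residue B (g a))
  have hd0 : d ≠ 0 := by
    rintro rfl
    rw [map_zero, eq_comm, IsLocalRing.residue_eq_zero_iff] at hd
    exact (IsLocalRing.mem_maximalIdeal _).1 hd ha
  have h1 : IsUnit (a - algebraMap K A d) := by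
    have h2 : IsUnit (algebraMap K A d) := (IsUnit.mk0 d hd0).map _
    by_contra h3
    have h4 := Ideal.sub_mem _ ((IsLocalRing.mem_maximalIdeal a).2 hna)
      ((IsLocalRing.mem_maximalIdeal _).2 h3)
    rw [sub_sub_cancel] at h4
    exact (IsLocalRing.mem_maximalIdeal _).1 h4 h2
  have h5 := h1.map g
  rw [map_sub, AlgHom.commutes] at h5
  have h6 : IsLocalRing.residue B (g a - algebraMap K B d) = 0 := by
    rw [map_sub, ← hd]
    exact sub_self _
  rw [IsLocalRing.residue_eq_zero_iff] at h6
  exact (IsLocalRing.mem_maximalIdeal _).1 h6 h5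

end CLAlg

/-- Let `ι : A → S'` be a `K`-algebra homomorphism and `π : S' → S` a second one. The square
formed by `ι`, `π`, `A → A / m_A = K` and `K → S` is cocartesian (its spectrum is a cartesian
square), i.e. `π` identifies `S' ⊗_A K = S' / m_A S'` with `S`. -/
def IsClosedFibre {K : Type u} [Field K] {A : CLAlg K} {S' S : Type u} [CommRing S']
    [Algebra K S'] [CommRing S] [Algebra K S] (ι : A →ₐ[K] S') (π : S' →ₐ[K] S) : Prop :=
  Function.Surjective π ∧
    RingHom.ker π = Ideal.map ι (IsLocalRing.maximalIdeal A)

/-! ### The plane curve singularity and its normalization -/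

section Curve

variable {K : Type u} [Field K] {r : ℕ}

/-- `P = K[[x, y]]`. -/
abbrev PS (K : Type u) [Field K] : Type u := MvPowerSeries (Fin 2) K

/-- `R = P / ⟨f₁ ⋯ f_r⟩`. -/
abbrev CurveRing (f : Fin r → PS K) : Type u := PS K ⧸ Ideal.span {∏ i, f i}

/-- The integral closure `R̄` of `R` in its total ring of fractions. -/
abbrev Normalization (f : Fin r → PS K) : Type u :=
  integralClosure (CurveRing f) (FractionRing (CurveRing f))

/-- The projection `P → R`. -/
noncomputable def projMap (f : Fin r → PS K) : PS K →ₐ[K] CurveRing f :=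
  Ideal.Quotient.mkₐ K (Ideal.span {∏ i, f i})

/-- The normalization map `ν : R → R̄`. -/
noncomputable def normMap (f : Fin r → PS K) : CurveRing f →ₐ[K] Normalization f :=
  IsScalarTower.toAlgHom K (CurveRing f) (Normalization f)

/-- The parametrization `φ : P → R̄`. -/
noncomputable def parMap (f : Fin r → PS K) : PS K →ₐ[K] Normalization f :=
  (normMap f).comp (projMap f)

end Curve

/-! ### Deformations with section of a map `S → R̄` -/

section Def

variable {K : Type u} [Field K] {r : ℕ} (f : Fin r → PS K)

/-- A deformation with sections of `κ : S → R̄`, over some base `A`. It is used for the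
parametrization `P → R̄` and for the normalization `R → R̄`. -/
structure SecDef {S : Type u} [CommRing S] [Algebra K S] (κ : S →ₐ[K] Normalization f) :
    Type (u + 1) where
  /-- the base `A` -/
  A : CLAlg K
  /-- the deformation `S_A` of `S` -/
  SA : CLAlg K
  /-- the summands of `R̄_A = ⨁ i, R̄_{A,i}` -/
  RbarA : Fin r → CLAlg K
  /-- `A → S_A` -/
  ι : A →ₐ[K] SA
  /-- `φ_A : S_A → R̄_A` -/
  φ : SA →ₐ[K] (∀ i, RbarA i)
  /-- `S_A → S` -/
  resS : SA →ₐ[K] S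
  /-- `R̄_A → R̄` -/
  resRbar : (∀ i, RbarA i) →ₐ[K] Normalization f
  flat_SA : ι.toRingHom.Flat
  flat_RbarA : ∀ i, (((Pi.evalAlgHom K (fun j => (RbarA j : Type u)) i).comp φ).comp
    ι).toRingHom.Flat
  /-- The lower square is cartesian. -/
  closedFibre_SA : IsClosedFibre ι resS
  /-- The composed square is cartesian, hence so is the upper one. -/
  closedFibre_RbarA : IsClosedFibre (φ.comp ι) resRbar
  comm : resRbar.comp φ = κ.comp resS
  /-- The summand `R̄_{A,i}` lies over the branch `f i`: the image of its unit element in `R̄` is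
  annihilated by `f i`. -/
  branch : ∀ i, parMap f (f i) * resRbar (Pi.single i 1) = 0
  /-- the section `σ` of `A → S_A` -/
  σ : SA →ₐ[K] A
  σ_ι : σ.comp ι = AlgHom.id K A
  /-- the sections `σ̄_i` of `A → R̄_{A,i}` (that they are sections follows from `σbar_φ`) -/
  σbar : ∀ i, RbarA i →ₐ[K] A
  σbar_φ : ∀ i, ((σbar i).comp (Pi.evalAlgHom K (fun j => (RbarA j : Type u)) i)).comp φ = σ

namespace SecDef

variable {f} {S : Type u} [CommRing S] [Algebra K S] {κ : S →ₐ[K] Normalization f}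

/-- Morphisms of deformations with sections, possibly over different bases: they commute with all
the maps of the diagrams and induce the identity on `S → R̄`. -/
@[ext]
structure Hom (ξ η : SecDef f κ) : Type u where
  base : ξ.A →ₐ[K] η.A
  onS : ξ.SA →ₐ[K] η.SA
  onRbar : ∀ i, ξ.RbarA i →ₐ[K] η.RbarA i
  comm_ι : ∀ a, onS (ξ.ι a) = η.ι (base a)
  comm_φ : ∀ s i, onRbar i (ξ.φ s i) = η.φ (onS s) i
  comm_resS : ∀ s, η.resS (onS s) = ξ.resS s
  comm_resRbar : ∀ t : (∀ i, ξ.RbarA i), η.resRbar (fun i => onRbar i (t i)) = ξ.resRbar t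
  comm_σ : ∀ s, η.σ (onS s) = base (ξ.σ s)
  comm_σbar : ∀ i t, η.σbar i (onRbar i t) = base (ξ.σbar i t)

/-- The category of deformations with sections of `κ : S → R̄`. -/
instance : Category (SecDef f κ) where
  Hom := Hom
  id ξ :=
    { base := AlgHom.id K _
      onS := AlgHom.id K _
      onRbar := fun _ => AlgHom.id K _
      comm_ι := fun _ => rfl
      comm_φ := fun _ _ => rfl
      comm_resS := fun _ => rfl
      comm_resRbar := fun _ => rfl
      comm_σ := fun _ => rfl
      comm_σbar := fun _ _ => rfl }
  comp g h :=
    { base := h.base.comp g.base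
      onS := h.onS.comp g.onS
      onRbar := fun i => (h.onRbar i).comp (g.onRbar i)
      comm_ι := fun a => by simp [g.comm_ι, h.comm_ι]
      comm_φ := fun s i => by simp [g.comm_φ, h.comm_φ]
      comm_resS := fun s => by simp [g.comm_resS, h.comm_resS]
      comm_resRbar := fun t =>
        (h.comm_resRbar (fun i => g.onRbar i (t i))).trans (g.comm_resRbar t)
      comm_σ := fun s => by simp [g.comm_σ, h.comm_σ]
      comm_σbar := fun i t => by simp [g.comm_σbar, h.comm_σbar] }

/-- The projection to the base category. -/
def baseFunctor (κ : S →ₐ[K] Normalization f) : SecDef f κ ⥤ CLAlg K where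
  obj ξ := ξ.A
  map g := g.base

end SecDef

/-- Deformations with section of the parametrization `P → R̄`. -/
abbrev ParDef := SecDef f (parMap f)

/-- Deformations with section of the normalization `R → R̄`. -/
abbrev NormDef := SecDef f (normMap f)

/-- Deformations with section of the sequence `P → R → R̄`: the part `R_A → R̄_A`, with its
sections, is a deformation with section of `R → R̄` (whose structure map is `A → P_A → R_A`), and
in addition one has `A → P_A → R_A`, flat over `A` with closed fibre `P → R`, and a section of
`A → P_A` which is compatible with the one of `A → R_A`. -/
structure EmbDef : Type (u + 1) where
  /-- the deformation `R_A → R̄_A` of the normalization -/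
  toNorm : NormDef f
  /-- the deformation `P_A` of `P` -/
  PA : CLAlg K
  /-- `A → P_A` -/
  ιP : toNorm.A →ₐ[K] PA
  /-- `P_A → R_A` -/
  q : PA →ₐ[K] toNorm.SA
  /-- `P_A → P` -/
  resP : PA →ₐ[K] PS K
  q_ιP : q.comp ιP = toNorm.ι
  flat_PA : ιP.toRingHom.Flat
  closedFibre_PA : IsClosedFibre ιP resP
  comm_q : toNorm.resS.comp q = (projMap f).comp resP
  /-- the section of `A → P_A` -/
  σP : PA →ₐ[K] toNorm.A
  σ_q : toNorm.σ.comp q = σP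

namespace EmbDef

variable {f}

/-- Morphisms of deformations of `P → R → R̄`: they commute with all the maps of the diagrams and
induce the identity on `P → R → R̄`. -/
@[ext]
structure Hom (ξ η : EmbDef f) : Type u where
  toNorm : SecDef.Hom ξ.toNorm η.toNorm
  onP : ξ.PA →ₐ[K] η.PA
  comm_ιP : ∀ a, onP (ξ.ιP a) = η.ιP (toNorm.base a)
  comm_q : ∀ s, toNorm.onS (ξ.q s) = η.q (onP s)
  comm_resP : ∀ s, η.resP (onP s) = ξ.resP s
  comm_σP : ∀ s, η.σP (onP s) = toNorm.base (ξ.σP s)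

/-- The category of deformations with section of `P → R → R̄`. -/
noncomputable instance : Category (EmbDef f) where
  Hom := Hom
  id ξ :=
    { toNorm := 𝟙 ξ.toNorm
      onP := AlgHom.id K _
      comm_ιP := fun _ => rfl
      comm_q := fun _ => rfl
      comm_resP := fun _ => rfl
      comm_σP := fun _ => rfl }
  comp {ξ η ζ} g h :=
    { toNorm := CategoryStruct.comp (obj := NormDef f) g.toNorm h.toNorm
      onP := h.onP.comp g.onP
      comm_ιP := fun a => (congrArg h.onP (g.comm_ιP a)).trans (h.comm_ιP _)
      comm_q := fun s => (congrArg h.toNorm.onS (g.comm_q s)).trans (h.comm_q _)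
      comm_resP := fun s => (h.comm_resP _).trans (g.comm_resP s)
      comm_σP := fun s => (h.comm_σP _).trans (congrArg h.toNorm.base (g.comm_σP s)) }

/-- The composite `P_A → R_A → R̄_A`, with its sections, as a deformation of `P → R̄`. -/
noncomputable def toPar (ζ : EmbDef f) : ParDef f where
  A := ζ.toNorm.A
  SA := ζ.PA
  RbarA := ζ.toNorm.RbarA
  ι := ζ.ιP
  φ := ζ.toNorm.φ.comp ζ.q
  resS := ζ.resP
  resRbar := ζ.toNorm.resRbar
  flat_SA := ζ.flat_PA
  flat_RbarA := fun i => by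
    have h := ζ.toNorm.flat_RbarA i
    rw [← ζ.q_ιP] at h
    exact h
  closedFibre_SA := ζ.closedFibre_PA
  closedFibre_RbarA := by
    have h := ζ.toNorm.closedFibre_RbarA
    rw [← ζ.q_ιP] at h
    exact h
  comm := by
    rw [← AlgHom.comp_assoc, ζ.toNorm.comm, AlgHom.comp_assoc, ζ.comm_q]
    rfl
  branch := ζ.toNorm.branch
  σ := ζ.σP
  σ_ι := by
    rw [← ζ.σ_q, AlgHom.comp_assoc, ζ.q_ιP, ζ.toNorm.σ_ι]
  σbar := ζ.toNorm.σbar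
  σbar_φ := fun i => by
    rw [← AlgHom.comp_assoc, ζ.toNorm.σbar_φ i, ζ.σ_q]

variable (f)

/-- The projection to the base category. -/
noncomputable def baseFunctor : EmbDef f ⥤ CLAlg K where
  obj ζ := ζ.toNorm.A
  map g := g.toNorm.base

/-- The forgetful functor from deformations of `P → R → R̄` to deformations of `P → R̄`. -/
noncomputable def forgetPar : EmbDef f ⥤ ParDef f where
  obj := toPar
  map {ξ η} g := SecDef.Hom.mk (ξ := ξ.toPar) (η := η.toPar) g.toNorm.base g.onP g.toNorm.onRbar
    g.comm_ιP
    (fun s i => (g.toNorm.comm_φ (ξ.q s) i).trans (congrArg (η.toNorm.φ · i) (g.comm_q s)))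
    g.comm_resP g.toNorm.comm_resRbar g.comm_σP g.toNorm.comm_σbar

/-- The forgetful functor from deformations of `P → R → R̄` to deformations of `R → R̄`. -/
noncomputable def forgetNorm : EmbDef f ⥤ NormDef f where
  obj := toNorm
  map g := g.toNorm

theorem forgetPar_base : forgetPar f ⋙ SecDef.baseFunctor (parMap f) = baseFunctor f := rfl

theorem forgetNorm_base : forgetNorm f ⋙ SecDef.baseFunctor (normMap f) = baseFunctor f := rfl

end EmbDef

end Def

/-! ### Fibred groupoids over the base category and their functors of isomorphism classes -/

section Fibred

universe v₁ v₂ v₃ u₁ u₂ u₃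

variable {𝒮 : Type u₁} [Category.{v₁} 𝒮] {𝒳 : Type u₂} [Category.{v₂} 𝒳]
  {𝒴 : Type u₃} [Category.{v₃} 𝒴]

/-- The functor `𝒳(A) ⥤ 𝒴(A)` between the fibre categories over `A` (objects over `A`, morphisms
over the identity of `A`) induced by a functor `F : 𝒳 ⥤ 𝒴` over `𝒮`. -/
def fibreFunctor {p : 𝒳 ⥤ 𝒮} {q : 𝒴 ⥤ 𝒮} (F : 𝒳 ⥤ 𝒴) (hF : F ⋙ q = p) (A : 𝒮) :
    p.Fiber A ⥤ q.Fiber A :=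
  Functor.Fiber.inducedFunctor (F := Functor.Fiber.fiberInclusion ⋙ F)
    (by rw [Functor.assoc, hF, Functor.Fiber.fiberInclusion_comp_eq_const])

/-- The set of isomorphism classes of objects of the fibre category over `A`. -/
def IsoClasses (p : 𝒳 ⥤ 𝒮) (A : 𝒮) : Type u₂ :=
  Quotient (isIsomorphicSetoid (p.Fiber A))

/-- The isomorphism class of an object. -/
def isoClass (p : 𝒳 ⥤ 𝒮) (ξ : 𝒳) : IsoClasses p (p.obj ξ) :=
  Quotient.mk (isIsomorphicSetoid (p.Fiber (p.obj ξ))) ⟨ξ, rfl⟩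

/-- The class `y` over `B` is induced from the class `x` over `A` by base change along
`ψ : A ⟶ B`: there is a morphism over `ψ` from a representative of `x` to one of `y`. (In a category
fibred in groupoids such a morphism identifies its target with the object induced by `ψ`; for
deformations, this is the one obtained by the complete tensor product with `B` over `A`, since a
morphism of flat algebras which is the identity on the closed fibre is an isomorphism.) -/
def IsInducedClass (p : 𝒳 ⥤ 𝒮) {A B : 𝒮} (ψ : A ⟶ B) (x : IsoClasses p A)
    (y : IsoClasses p B) : Prop :=
  ∃ (ξ : p.Fiber A) (η : p.Fiber B) (g : ξ.1 ⟶ η.1), p.IsHomLift ψ g ∧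
    Quotient.mk (isIsomorphicSetoid (p.Fiber A)) ξ = x ∧
    Quotient.mk (isIsomorphicSetoid (p.Fiber B)) η = y

/-- Induced objects exist and are unique up to isomorphism. -/
def HasInduced (p : 𝒳 ⥤ 𝒮) : Prop :=
  ∀ ⦃A B : 𝒮⦄ (ψ : A ⟶ B) (x : IsoClasses p A), ∃! y : IsoClasses p B, IsInducedClass p ψ x y

theorem isInducedClass_id (p : 𝒳 ⥤ 𝒮) {A : 𝒮} (x : IsoClasses p A) :
    IsInducedClass p (𝟙 A) x x := by
  obtain ⟨ξ, rfl⟩ := Quotient.exists_rep x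
  exact ⟨ξ, ξ, 𝟙 ξ.1, IsHomLift.id ξ.2, rfl, rfl⟩

theorem IsInducedClass.comp (p : 𝒳 ⥤ 𝒮) {A B C : 𝒮} {ψ : A ⟶ B} {χ : B ⟶ C}
    {x : IsoClasses p A} {y : IsoClasses p B} {z : IsoClasses p C}
    (h₁ : IsInducedClass p ψ x y) (h₂ : IsInducedClass p χ y z) :
    IsInducedClass p (ψ ≫ χ) x z := by
  obtain ⟨ξ, η, g, hg, rfl, rfl⟩ := h₁
  obtain ⟨η', ζ, h, hh, he, rfl⟩ := h₂
  obtain ⟨e⟩ := Quotient.exact he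
  have he' := e.inv.2
  refine ⟨ξ, ζ, g ≫ e.inv.1 ≫ h, ?_, rfl, rfl⟩
  have h3 : p.IsHomLift (ψ ≫ 𝟙 B ≫ χ) (g ≫ e.inv.1 ≫ h) := inferInstance
  rwa [Category.id_comp] at h3

/-- The functor of isomorphism classes: it sends `A` to the set of isomorphism classes of objects
over `A`, and `ψ : A ⟶ B` to the map which assigns to a class the class induced by `ψ`. -/
noncomputable def isoClassFunctor (p : 𝒳 ⥤ 𝒮) (hp : HasInduced p) : 𝒮 ⥤ Type u₂ where
  obj A := IsoClasses p A
  map {_ _} ψ := ↾(fun x => (hp ψ x).choose)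
  map_id A := by
    ext x
    exact ((hp (𝟙 A) x).choose_spec.2 x (isInducedClass_id p x)).symm
  map_comp {A B C} ψ χ := by
    ext x
    exact ((hp (ψ ≫ χ) x).choose_spec.2 _
      ((hp ψ x).choose_spec.1.comp p (hp χ _).choose_spec.1)).symm

/-- Smoothness of a functor `F : 𝒳 ⥤ 𝒴` of categories over the category of complete local
algebras: whenever `B → A` is surjective, `η` is an object of `𝒴` over `B`, `ζ` is an object of `𝒳`
over `A` and `g : η ⟶ F ζ` is a morphism over `B → A` (which identifies `F ζ` with the object induced
from `η`), there are an object `ζ'` of `𝒳` over `B`, a morphism `ζ' ⟶ ζ` over `B → A`, and an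
isomorphism `F ζ' ≅ η` over the identity of `B` which is compatible with the morphisms to `F ζ`. -/
def IsSmoothOver {K : Type u} [Field K] (q : 𝒴 ⥤ CLAlg K) (F : 𝒳 ⥤ 𝒴) : Prop :=
  ∀ (η : 𝒴) (ζ : 𝒳) (g : η ⟶ F.obj ζ),
    Function.Surjective (show q.obj η →ₐ[K] q.obj (F.obj ζ) from q.map g) →
    ∃ (ζ' : 𝒳) (h : ζ' ⟶ ζ) (e : F.obj ζ' ≅ η),
      q.IsHomLift (𝟙 (q.obj η)) e.hom ∧ F.map h = e.hom ≫ g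

end Fibred

end CurveDef

/-! Everything rests on two structural facts and an explicit base change.

The kernel of φ_A. Choose coordinates z, w of the plane such that z is regular on the curve f =
f₁⋯f_r and a power of w lies in (z, f), and put L = A[[z]]. The normalization R̄ is free of some
rank n over K[[z]], so by Nakayama n lifts of a basis generate R̄_A over L, and Cayley–Hamilton for
multiplication by w yields a monic F of degree n over L with v = F(w) in ker φ_A. Weierstrass
division by v leaves remainders in the span of 1, w, …, w^(n-1) over L. In R̄ these powers are
independent over K[[z]]: they span R, and a common denominator multiplies R̄ into R, so R has rank n
too. As R̄_A is flat over A, independence on the closed fibre implies independence over L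
(`injective_of_flat`). Hence ker φ_A = (v), and P_A / ker φ_A ≅ L^n is A-flat with closed fibre R
(`ker_φ`). Conversely, in every lifting R_A → R̄_A is injective by flatness and P_A → R_A is
surjective by Nakayama, so R_A must be P_A / ker φ_A. Thus `forgetPar` is full, faithful and
surjective on objects.

Rigidity of the plane. In any lifts of the two coordinates P_A is A[[x, y]] (`isCoord_plane`). A
morphism of deformations of R → R̄ therefore extends to the planes once the images of two
coordinates are chosen, and suitable images exist because P_A → R_A ×_R P is surjective. So
`forgetNorm` is full and surjective on objects, which already contains smoothness.

Base change. The closed fibre of each R̄_{A,i} is a discrete valuation ring with residue field K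
(`exists_parameter`), so R̄_{A,i} ≅ A[[t]]. Induced deformations of P → R̄ can then be written down
with B[[x, y]] and B[[t]], and they are unique because morphisms are determined on coordinates. This
passes through `forgetPar` to the sequence and on through `forgetNorm` to the normalization. A full
functor which is surjective on objects is then bijective on isomorphism classes. -/

namespace CurveDef

open IsLocalRing

/-! ### Power series over complete local rings -/

section PowerSeriesRing

variable {σ : Type*} {A : Type*} [CommRing A]

/-- The power series with given coefficients. -/
def seriesOfCoeff (a : (σ →₀ ℕ) → A) : MvPowerSeries σ A := a

theorem coeff_seriesOfCoeff (a : (σ →₀ ℕ) → A) (d : σ →₀ ℕ) :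
    MvPowerSeries.coeff d (seriesOfCoeff a) = a d := rfl

/-- A factor from J contributes either its constant term, which lies in I, or a term of positive
degree, which uses up at least one degree; so n factors leave at least n - |d| factors from I. -/
theorem coeff_mem_pow_of_mem_pow {I : Ideal A} {J : Ideal (MvPowerSeries σ A)}
    (hJ : ∀ p ∈ J, MvPowerSeries.constantCoeff p ∈ I) (n : ℕ) :
    ∀ p ∈ J ^ n, ∀ d, MvPowerSeries.coeff d p ∈ I ^ (n - d.degree) := by
  classical
  induction n with
  | zero => intro p _ d; simp
  | succ n ih =>
    intro p hp
    rw [pow_succ'] at hp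
    induction hp using Submodule.mul_induction_on' with
    | mem_mul_mem x hx y hy =>
      intro d
      rw [MvPowerSeries.coeff_mul]
      refine Ideal.sum_mem _ fun ab hab => ?_
      rw [Finset.HasAntidiagonal.mem_antidiagonal] at hab
      have hd : d.degree = ab.1.degree + ab.2.degree := by rw [← hab, map_add]
      -- If x contributes its constant term, one more power of I is gained; otherwise the degree
      -- left for y drops by at least one.
      by_cases h0 : ab.1 = 0
      · have h1 : MvPowerSeries.coeff ab.1 x ∈ I := by
          rw [h0]; simpa using hJ x hx
        have h3 := Ideal.mul_mem_mul h1 (ih y hy ab.2)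
        rw [← pow_succ'] at h3
        refine Ideal.pow_le_pow_right ?_ h3
        have : ab.1.degree = 0 := by rw [h0]; simp
        omega
      · refine Ideal.mul_mem_left _ _ (Ideal.pow_le_pow_right ?_ (ih y hy ab.2))
        have : ab.1.degree ≠ 0 := by rwa [Ne, Finsupp.degree_eq_zero_iff]
        omega
    | add x hx y hy h1 h2 =>
      intro d
      rw [map_add]
      exact Ideal.add_mem _ (h1 d) (h2 d)

/-- The truncations form a Cauchy sequence for the ideal of the variables, in which the ring is
complete; comparing coefficients identifies the limit with p. -/
theorem sub_truncTotal_mem [Finite σ] (p : MvPowerSeries σ A) (n : ℕ) :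
    p - (MvPowerSeries.truncTotal n p : MvPolynomial σ A) ∈
      Ideal.span (Set.range (MvPowerSeries.X : σ → MvPowerSeries σ A)) ^ n := by
  set J := Ideal.span (Set.range (MvPowerSeries.X : σ → MvPowerSeries σ A)) with hJ
  have hmap : ∀ k, ∀ q ∈ MvPolynomial.idealOfVars σ A ^ k, (q : MvPowerSeries σ A) ∈ J ^ k := by
    intro k q hq
    have h1 : (MvPolynomial.idealOfVars σ A).map
        (MvPolynomial.coeToMvPowerSeries.ringHom (σ := σ) (R := A)) ≤ J := by
      rw [Ideal.map_span, Ideal.span_le]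
      rintro _ ⟨_, ⟨i, rfl⟩, rfl⟩
      exact Ideal.subset_span ⟨i, by simp⟩
    have h2 := Ideal.mem_map_of_mem (MvPolynomial.coeToMvPowerSeries.ringHom (σ := σ) (R := A)) hq
    rw [Ideal.map_pow] at h2
    exact Ideal.pow_right_mono h1 k h2
  obtain ⟨L, hL⟩ := IsPrecomplete.prec (I := J) (M := MvPowerSeries σ A) inferInstance
    (f := fun n => ((MvPowerSeries.truncTotal n p : MvPolynomial σ A) : MvPowerSeries σ A)) (by
      intro m n hmn
      rw [SModEq.sub_mem, smul_eq_mul, Ideal.mul_top]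
      have := hmap m _ (MvPowerSeries.truncTotal_sub_truncTotal_mem_pow_idealOfVars
        (le_refl m) hmn p)
      rwa [← MvPolynomial.coeToMvPowerSeries.ringHom_apply, map_sub] at this)
  have hL' : ∀ n, ((MvPowerSeries.truncTotal n p : MvPolynomial σ A) : MvPowerSeries σ A) - L
      ∈ J ^ n := by
    intro n
    have := hL n
    rwa [SModEq.sub_mem, smul_eq_mul, Ideal.mul_top] at this
  have hJ0 : ∀ q ∈ J, MvPowerSeries.constantCoeff q ∈ (⊥ : Ideal A) := by
    intro q hq
    have : J ≤ RingHom.ker (MvPowerSeries.constantCoeff (σ := σ) (R := A)) := by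
      rw [hJ, Ideal.span_le]
      rintro _ ⟨i, rfl⟩
      simp [RingHom.mem_ker]
    exact this hq
  have hpL : p = L := by
    ext d
    -- Taken with I = ⊥ and exponent |d| + 1, the estimate leaves I ^ 1 = ⊥, so the coefficients at
    -- d agree.
    have h := coeff_mem_pow_of_mem_pow hJ0 (d.degree + 1) _ (hL' (d.degree + 1)) d
    rw [Nat.add_sub_cancel_left, pow_one, Ideal.mem_bot, map_sub, sub_eq_zero,
      MvPolynomial.coeff_coe, MvPowerSeries.coeff_truncTotal _ (Nat.lt_succ_self _)] at h
    exact h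
  have := hL' n
  rw [← hpL] at this
  rw [← neg_sub]
  exact neg_mem this

/-- Only finitely many generators of I occur, so the coefficients of p in terms of each generator
can be collected into one power series. -/
theorem mem_map_C_of_coeff_mem {I : Ideal A} (hI : I.FG) {p : MvPowerSeries σ A}
    (hp : ∀ d, MvPowerSeries.coeff d p ∈ I) : p ∈ I.map (MvPowerSeries.C (σ := σ)) := by
  obtain ⟨s, rfl⟩ := hI
  have h : ∀ d, ∃ c : s → A, ∑ i, c i • (i : A) = MvPowerSeries.coeff d p := fun d =>
    (Submodule.mem_span_finset' (R := A)).1 (hp d)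
  choose c hc using h
  have : p = ∑ i : s, seriesOfCoeff (fun d => c d i) * MvPowerSeries.C (i : A) := by
    ext d
    rw [map_sum, ← hc d]
    refine Finset.sum_congr rfl fun i _ => ?_
    rw [MvPowerSeries.coeff_mul_C, coeff_seriesOfCoeff, smul_eq_mul]
  rw [this]
  exact Ideal.sum_mem _ fun i _ => Ideal.mul_mem_left _ _
    (Ideal.mem_map_of_mem _ (Ideal.subset_span i.2))

/-- Equational criterion: a relation among series holds coefficientwise, and the syzygy module of
the scalars is finitely generated, so all coefficient vectors expand in the same finite set of
syzygies. -/
instance flat_mvPowerSeries [IsNoetherianRing A] : Module.Flat A (MvPowerSeries σ A) := by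
  rw [Module.Flat.iff_forall_isTrivialRelation]
  intro l f x hx
  let L : (Fin l → A) →ₗ[A] A := Fintype.linearCombination A f
  obtain ⟨s, hs⟩ : (LinearMap.ker L).FG := IsNoetherian.noetherian _
  obtain ⟨k, ⟨e⟩⟩ := Finite.exists_equiv_fin s
  have h : ∀ d, ∃ c : s → A, ∑ i, c i • (i : Fin l → A) = fun j => MvPowerSeries.coeff d (x j) := by
    intro d
    refine (Submodule.mem_span_finset' (R := A)).1 ?_
    rw [hs, LinearMap.mem_ker, Fintype.linearCombination_apply]
    have := congrArg (MvPowerSeries.coeff d) hx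
    rw [map_sum, map_zero] at this
    rw [← this]
    refine Finset.sum_congr rfl fun i _ => ?_
    rw [MvPowerSeries.coeff_smul, smul_eq_mul, mul_comm]
  choose c hc using h
  refine ⟨k, fun i j => (e.symm j : Fin l → A) i,
    fun j => seriesOfCoeff fun d => c d (e.symm j), ?_, ?_⟩
  · intro i
    ext d
    rw [map_sum, ← congrFun (hc d) i, Finset.sum_apply, ← e.symm.sum_comp]
    refine Finset.sum_congr rfl fun j _ => ?_
    rw [MvPowerSeries.coeff_smul, coeff_seriesOfCoeff, Pi.smul_apply, smul_eq_mul, mul_comm]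
  · intro j
    have h1 : (e.symm j : Fin l → A) ∈ LinearMap.ker L := by
      rw [← hs]; exact Submodule.subset_span (e.symm j).2
    rw [LinearMap.mem_ker, Fintype.linearCombination_apply] at h1
    rw [← h1]
    exact Finset.sum_congr rfl fun i _ => by rw [smul_eq_mul, mul_comm]

variable [IsLocalRing A]

theorem mem_maximalIdeal_mvPowerSeries {p : MvPowerSeries σ A} :
    p ∈ maximalIdeal (MvPowerSeries σ A) ↔ MvPowerSeries.constantCoeff p ∈ maximalIdeal A := by
  rw [mem_maximalIdeal, mem_nonunits_iff, MvPowerSeries.isUnit_iff_constantCoeff,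
    mem_maximalIdeal, mem_nonunits_iff]

/-- The tail from degree n on lies in the n-th power of the ideal of the variables, and each of the
finitely many remaining monomials X^d supplies the |d| factors missing from its coefficient. -/
theorem mem_maximalIdeal_pow_of_coeff_mem [Finite σ] {p : MvPowerSeries σ A} {n : ℕ}
    (hp : ∀ d, MvPowerSeries.coeff d p ∈ maximalIdeal A ^ (n - d.degree)) :
    p ∈ maximalIdeal (MvPowerSeries σ A) ^ n := by
  classical
  set m := maximalIdeal (MvPowerSeries σ A)
  have hX : Ideal.span (Set.range (MvPowerSeries.X : σ → MvPowerSeries σ A)) ≤ m := by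
    rw [Ideal.span_le]
    rintro _ ⟨i, rfl⟩
    rw [SetLike.mem_coe, mem_maximalIdeal_mvPowerSeries, MvPowerSeries.constantCoeff_X]
    exact zero_mem _
  have hC : (maximalIdeal A).map (MvPowerSeries.C (σ := σ)) ≤ m := by
    rw [Ideal.map_le_iff_le_comap]
    intro a ha
    rw [Ideal.mem_comap, mem_maximalIdeal_mvPowerSeries, MvPowerSeries.constantCoeff_C]
    exact ha
  have h1 := Ideal.pow_right_mono hX n (sub_truncTotal_mem p n)
  have h2 : ((MvPowerSeries.truncTotal n p : MvPolynomial σ A) : MvPowerSeries σ A) ∈ m ^ n := by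
    rw [(MvPowerSeries.truncTotal n p).as_sum, ← MvPolynomial.coeToMvPowerSeries.ringHom_apply,
      map_sum]
    refine Ideal.sum_mem _ fun d hd => ?_
    have hlt : d.degree < n := by
      by_contra h
      rw [MvPolynomial.mem_support_iff, MvPowerSeries.coeff_truncTotal_eq_zero] at hd
      · exact hd rfl
      · omega
    rw [MvPowerSeries.coeff_truncTotal _ hlt, MvPolynomial.monomial_eq, map_mul]
    have e : n = (n - d.degree) + d.degree := by omega
    rw [e, pow_add]
    refine Ideal.mul_mem_mul ?_ ?_
    · rw [MvPolynomial.coeToMvPowerSeries.ringHom_apply, MvPolynomial.coe_C]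
      have h3 := Ideal.mem_map_of_mem (MvPowerSeries.C (σ := σ)) (hp d)
      rw [Ideal.map_pow] at h3
      refine Ideal.pow_right_mono hC _ ?_
      convert h3 using 2
    · rw [Finsupp.prod, map_prod, Finsupp.degree_apply]
      have : ∀ t : Finset σ, (∏ i ∈ t, MvPolynomial.coeToMvPowerSeries.ringHom
          ((MvPolynomial.X i : MvPolynomial σ A) ^ d i)) ∈ m ^ (∑ i ∈ t, d i) := by
        intro t
        induction t using Finset.induction_on with
        | empty => simp
        | insert i t hi ih =>
          rw [Finset.prod_insert hi, Finset.sum_insert hi, pow_add]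
          refine Ideal.mul_mem_mul ?_ ih
          rw [map_pow]
          refine Ideal.pow_mem_pow (hX (Ideal.subset_span ⟨i, ?_⟩)) _
          simp
      exact this _
  have := Ideal.add_mem _ h1 h2
  rwa [sub_add_cancel] at this

/-- The limit is formed coefficientwise. The coefficient at d of f n is controlled only modulo the
power n - |d|, hence the shift of the index by |d|. -/
theorem isPrecomplete_mvPowerSeries [Finite σ] [IsPrecomplete (maximalIdeal A) A] :
    IsPrecomplete (maximalIdeal (MvPowerSeries σ A)) (MvPowerSeries σ A) := by
  constructor
  intro f hf
  have hf' : ∀ {m n}, m ≤ n → f m - f n ∈ maximalIdeal (MvPowerSeries σ A) ^ m := by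
    intro m n hmn
    have := hf hmn
    rwa [SModEq.sub_mem, smul_eq_mul, Ideal.mul_top] at this
  have hco := coeff_mem_pow_of_mem_pow (J := maximalIdeal (MvPowerSeries σ A))
    (fun p hp => mem_maximalIdeal_mvPowerSeries.1 hp)
  have h : ∀ d : σ →₀ ℕ, ∃ a : A, ∀ n, MvPowerSeries.coeff d (f (n + d.degree)) - a ∈
      maximalIdeal A ^ n := by
    intro d
    obtain ⟨a, ha⟩ := IsPrecomplete.prec (I := maximalIdeal A) (M := A) inferInstance
      (f := fun n => MvPowerSeries.coeff d (f (n + d.degree))) (by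
        intro m n hmn
        rw [SModEq.sub_mem, smul_eq_mul, Ideal.mul_top]
        have := hco _ _ (hf' (Nat.add_le_add_right hmn d.degree)) d
        rwa [Nat.add_sub_cancel, map_sub] at this)
    refine ⟨a, fun n => ?_⟩
    have := ha n
    rwa [SModEq.sub_mem, smul_eq_mul, Ideal.mul_top] at this
  choose a ha using h
  refine ⟨seriesOfCoeff a, fun n => ?_⟩
  rw [SModEq.sub_mem, smul_eq_mul, Ideal.mul_top]
  refine mem_maximalIdeal_pow_of_coeff_mem fun d => ?_
  rw [map_sub, coeff_seriesOfCoeff]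
  by_cases hd : d.degree ≤ n
  · have := ha d (n - d.degree)
    rwa [Nat.sub_add_cancel hd] at this
  · rw [Nat.sub_eq_zero_of_le (by omega)]
    simp

end PowerSeriesRing

end CurveDef

namespace CurveDef

open IsLocalRing

/-! ### Injectivity and surjectivity modulo the maximal ideal -/

section Modules

theorem exists_sum_of_mem_span_range_smul_top {A M : Type*} [CommRing A] [AddCommGroup M]
    [Module A M] {n : Type*} [Fintype n] {g : n → A} {x : M}
    (hx : x ∈ (Ideal.span (Set.range g) • ⊤ : Submodule A M)) : ∃ y : n → M, x = ∑ i, g i • y i := by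
  refine Submodule.smul_induction_on hx (fun a ha y _ => ?_) fun y z h1 h2 => ?_
  · obtain ⟨c, hc⟩ := Ideal.mem_span_range_iff_exists_fun.1 ha
    refine ⟨fun i => c i • y, ?_⟩
    rw [← hc, Finset.sum_smul]
    exact Finset.sum_congr rfl fun i _ => by rw [smul_smul, mul_comm]
  · obtain ⟨y', rfl⟩ := h1
    obtain ⟨z', rfl⟩ := h2
    exact ⟨y' + z', by simp [Finset.sum_add_distrib]⟩

/-- Take the least possible number of generators: a relation with a unit coefficient would make one
of them superfluous. -/
theorem exists_minimal_generators {A : Type*} [CommRing A] [IsLocalRing A] {I : Ideal A}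
    (hfg : I.FG) : ∃ (n : ℕ) (g : Fin n → A), Ideal.span (Set.range g) = I ∧
      ∀ c : Fin n → A, ∑ i, g i * c i = 0 → ∀ i, c i ∈ maximalIdeal A := by
  classical
  have hex : ∃ n, ∃ g : Fin n → A, Ideal.span (Set.range g) = I := by
    obtain ⟨n, g, hg⟩ := Submodule.fg_iff_exists_fin_generating_family.1 hfg
    exact ⟨n, g, hg⟩
  obtain ⟨g, hg⟩ := Nat.find_spec hex
  refine ⟨_, g, hg, fun c hc i => ?_⟩
  by_contra hi
  have hu : IsUnit (c i) := by
    rwa [mem_maximalIdeal, mem_nonunits_iff, not_not] at hi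
  obtain ⟨m, hm⟩ : ∃ m, Nat.find hex = m + 1 := by
    have : 0 < Nat.find hex := i.pos
    exact ⟨_, (Nat.succ_pred_eq_of_pos this).symm⟩
  refine Nat.find_min hex (m := m) (by omega) ?_
  let e : {j : Fin (Nat.find hex) // j ≠ i} ≃ Fin m :=
    Fintype.equivFinOfCardEq (by simp [Fintype.card_subtype_compl, hm])
  refine ⟨fun j => g (e.symm j), le_antisymm ?_ (hg.ge.trans ?_)⟩
  · rw [Ideal.span_le]
    rintro _ ⟨j, rfl⟩
    exact hg.le (Ideal.subset_span ⟨_, rfl⟩)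
  · have hsub : ∀ j, j ≠ i → g j ∈ Ideal.span (Set.range fun j => g (e.symm j)) := fun j hj =>
      Ideal.subset_span ⟨e ⟨j, hj⟩, by simp⟩
    rw [Ideal.span_le]
    rintro _ ⟨j, rfl⟩
    by_cases hj : j = i
    · subst hj
      rw [← Finset.add_sum_erase _ _ (Finset.mem_univ j)] at hc
      have h2 : g j * c j ∈ Ideal.span (Set.range fun j => g (e.symm j)) := by
        rw [eq_neg_of_add_eq_zero_left hc]
        refine neg_mem (Ideal.sum_mem _ fun l hl => Ideal.mul_mem_right _ _ (hsub l ?_))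
        exact Finset.ne_of_mem_erase hl
      exact (Ideal.mul_unit_mem_iff_mem _ hu).1 h2
    · exact hsub j hj

/-- A linear map into a flat module is injective if it is so modulo the maximal ideal. -/
theorem injective_of_flat {A : Type*} [CommRing A] [IsLocalRing A] [IsNoetherianRing A]
    {M N : Type*} [AddCommGroup M] [Module A M] [AddCommGroup N] [Module A N] [Module.Flat A N]
    [IsHausdorff (maximalIdeal A) M] (v : M →ₗ[A] N)
    (h : ∀ x, v x ∈ (maximalIdeal A • ⊤ : Submodule A N) →
      x ∈ (maximalIdeal A • ⊤ : Submodule A M)) : Function.Injective v := by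
  rw [← LinearMap.ker_eq_bot, LinearMap.ker_eq_bot']
  intro x hx
  have key : ∀ k : ℕ, x ∈ (maximalIdeal A ^ k • ⊤ : Submodule A M) := by
    intro k
    induction k with
    | zero => simp
    | succ k ih =>
      -- Write x = ∑ gᵢ yᵢ with minimal generators of m^k. By flatness the relation ∑ gᵢ v(yᵢ) = 0
      -- is trivial, and minimality puts its coefficients into m; so v(yᵢ) ∈ mN, whence yᵢ ∈ mM.
      obtain ⟨n, g, hg, hmin⟩ := exists_minimal_generators (A := A) (I := maximalIdeal A ^ k)
        (IsNoetherian.noetherian _)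
      rw [← hg] at ih
      obtain ⟨y, hy⟩ := exists_sum_of_mem_span_range_smul_top ih
      have h0 : ∑ i, g i • v (y i) = 0 := by
        rw [← hx, hy, map_sum]
        exact Finset.sum_congr rfl fun i _ => by rw [map_smul]
      obtain ⟨l, a, w, hw, ha⟩ := Module.Flat.isTrivialRelation_of_sum_smul_eq_zero h0
      rw [hy, pow_succ, mul_smul]
      refine Submodule.sum_mem _ fun i _ => Submodule.smul_mem_smul ?_ (h _ ?_)
      · rw [← hg]; exact Ideal.subset_span ⟨i, rfl⟩
      · have hwi : v (y i) = ∑ j, a i j • w j := hw i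
        rw [hwi]
        exact Submodule.sum_mem _ fun j _ => Submodule.smul_mem_smul (hmin _ (ha j) i)
          Submodule.mem_top
  exact IsHausdorff.haus (I := maximalIdeal A) inferInstance x fun k => by
    rw [SModEq.zero]; exact key k

theorem isPrecomplete_of_surjective {A M N : Type*} [CommRing A] (I : Ideal A) [AddCommGroup M]
    [Module A M] [AddCommGroup N] [Module A N] [IsPrecomplete I M] (v : M →ₗ[A] N)
    (hv : Function.Surjective v) : IsPrecomplete I N := by
  rw [← AdicCompletion.of_surjective_iff]
  intro y
  obtain ⟨x, rfl⟩ := AdicCompletion.map_surjective I hv y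
  obtain ⟨x, rfl⟩ := AdicCompletion.of_surjective I M x
  exact ⟨v x, (AdicCompletion.map_of I v x).symm⟩

theorem isPrecomplete_pi {A : Type*} [CommRing A] (I : Ideal A) (n : ℕ) [IsPrecomplete I A] :
    IsPrecomplete I (Fin n → A) := by
  classical
  have mem : ∀ (J : Ideal A) (x : Fin n → A), x ∈ (J • ⊤ : Submodule A (Fin n → A)) ↔
      ∀ i, x i ∈ J := by
    intro J x
    constructor
    · intro hx i
      have := Submodule.mem_map_of_mem (f := LinearMap.proj (R := A) (φ := fun _ : Fin n => A) i) hx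
      rw [Submodule.map_smul''] at this
      exact Ideal.mul_le_left this
    · intro hx
      rw [pi_eq_sum_univ' x]
      exact Submodule.sum_mem _ fun i _ => Submodule.smul_mem_smul (hx i) Submodule.mem_top
  constructor
  intro f hf
  have h : ∀ i, ∃ a : A, ∀ k, f k i ≡ a [SMOD (I ^ k • ⊤ : Ideal A)] := fun i =>
    IsPrecomplete.prec (I := I) (M := A) inferInstance (f := fun k => f k i) (by
      intro k l hkl
      have := hf hkl
      rw [SModEq.sub_mem, mem] at this
      rw [SModEq.sub_mem, smul_eq_mul, Ideal.mul_top]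
      exact this i)
  choose a ha using h
  refine ⟨a, fun k => ?_⟩
  rw [SModEq.sub_mem, mem]
  intro i
  have := ha i k
  rwa [SModEq.sub_mem, smul_eq_mul, Ideal.mul_top] at this

/-- A finite family which generates modulo `I` generates. -/
theorem span_eq_top_of_isPrecomplete {A N : Type*} [CommRing A] (I : Ideal A) [IsPrecomplete I A]
    [AddCommGroup N] [Module A N] [IsHausdorff I N] {n : ℕ} (e : Fin n → N)
    (h : ∀ x : N, ∃ c : Fin n → A, x - ∑ i, c i • e i ∈ (I • ⊤ : Submodule A N)) (x : N) :
    ∃ c : Fin n → A, x = ∑ i, c i • e i := by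
  have := isPrecomplete_pi I n
  obtain ⟨c, hc⟩ := surjective_of_mkQ_comp_surjective (I := I)
    (f := Fintype.linearCombination A e) (fun y => by
      obtain ⟨y, rfl⟩ := Submodule.mkQ_surjective _ y
      obtain ⟨c, hc⟩ := h y
      refine ⟨c, ?_⟩
      rw [LinearMap.comp_apply, eq_comm, ← sub_eq_zero, ← map_sub, Submodule.mkQ_apply,
        Submodule.Quotient.mk_eq_zero, Fintype.linearCombination_apply]
      exact hc) x
  exact ⟨c, by rw [← hc, Fintype.linearCombination_apply]⟩

end Modules

/-! ### Constructions of complete local algebras -/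

namespace CLAlg

variable {K : Type u} [Field K]

/-- The residue map `A → A / m_A = K`. -/
noncomputable def res (A : CLAlg K) : A →ₐ[K] K :=
  (AlgEquiv.ofBijective (Algebra.ofId K (ResidueField A)) A.residue_bijective).symm.toAlgHom.comp
    (IsScalarTower.toAlgHom K A (ResidueField A))

theorem res_eq_zero {A : CLAlg K} {a : A} : A.res a = 0 ↔ a ∈ maximalIdeal A := by
  have : A.res a = (AlgEquiv.ofBijective (Algebra.ofId K (ResidueField A))
    A.residue_bijective).symm (residue A a) := rfl
  rw [this, EmbeddingLike.map_eq_zero_iff, residue_eq_zero_iff]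

theorem sub_res_mem (A : CLAlg K) (a : A) : a - algebraMap K A (A.res a) ∈ maximalIdeal A := by
  rw [← res_eq_zero, map_sub, AlgHom.commutes]
  exact sub_self _

theorem map_mem {A B : CLAlg K} (g : A →ₐ[K] B) {a : A} (ha : a ∈ maximalIdeal A) :
    g a ∈ maximalIdeal B := by
  have := isLocalHom_algHom A B g
  rw [mem_maximalIdeal, mem_nonunits_iff] at ha ⊢
  exact fun h => ha (isUnit_of_map_unit g a h)

theorem mem_of_map_mem {A B : CLAlg K} (g : A →ₐ[K] B) {a : A} (ha : g a ∈ maximalIdeal B) :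
    a ∈ maximalIdeal A := by
  rw [mem_maximalIdeal, mem_nonunits_iff] at ha ⊢
  exact fun h => ha (h.map g)

theorem map_maximalIdeal_le {A B : CLAlg K} (g : A →ₐ[K] B) :
    (maximalIdeal A).map g ≤ maximalIdeal B :=
  Ideal.map_le_iff_le_comap.2 fun _ ha => map_mem g ha

theorem eq_zero_of_forall_mem_pow {A : CLAlg K} {a : A}
    (h : ∀ n, a ∈ maximalIdeal A ^ n) : a = 0 :=
  IsHausdorff.haus (I := maximalIdeal A) inferInstance a fun n => by
    rw [SModEq.zero, smul_eq_mul, Ideal.mul_top]; exact h n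

theorem residue_bijective_of {S : Type u} [CommRing S] [Algebra K S] [IsLocalRing S]
    (h : ∀ s : S, ∃ c : K, s - algebraMap K S c ∈ maximalIdeal S) :
    Function.Bijective (algebraMap K (ResidueField S)) := by
  refine ⟨(algebraMap K (ResidueField S)).injective, fun y => ?_⟩
  obtain ⟨s, rfl⟩ := residue_surjective y
  obtain ⟨c, hc⟩ := h s
  refine ⟨c, ?_⟩
  rw [← residue_eq_zero_iff, map_sub, sub_eq_zero] at hc
  exact hc.symm

variable (K) in
/-- The base field. -/
noncomputable abbrev base : CLAlg K where
  carrier := K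
  isAdicComplete := by
    rw [maximalIdeal_eq_bot]
    infer_instance
  residue_bijective := residue_bijective_of fun s => ⟨s, by simp⟩

/-- Power series in finitely many variables. -/
noncomputable abbrev pow (σ : Type) [Finite σ] (A : CLAlg K) : CLAlg K where
  carrier := MvPowerSeries σ A
  isAdicComplete :=
    { toIsHausdorff := inferInstance
      toIsPrecomplete := isPrecomplete_mvPowerSeries }
  residue_bijective := residue_bijective_of fun p => by
    refine ⟨A.res (MvPowerSeries.constantCoeff p), ?_⟩
    rw [mem_maximalIdeal_mvPowerSeries, map_sub, MvPowerSeries.algebraMap_apply,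
      MvPowerSeries.constantCoeff_C]
    exact A.sub_res_mem _

/-- Quotients by proper ideals. -/
noncomputable def quot (A : CLAlg K) (J : Ideal A) (hJ : J ≠ ⊤) : CLAlg K :=
  have : Nontrivial (A ⧸ J) := Ideal.Quotient.nontrivial_iff.2 hJ
  have : IsLocalRing (A ⧸ J) := of_surjective' (Ideal.Quotient.mk J) Ideal.Quotient.mk_surjective
  have hm : (maximalIdeal A).map (algebraMap A (A ⧸ J)) = maximalIdeal (A ⧸ J) :=
    map_maximalIdeal_of_surjective (Ideal.Quotient.mk J) Ideal.Quotient.mk_surjective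
  { carrier := A ⧸ J
    isAdicComplete :=
      { toIsHausdorff := inferInstance
        toIsPrecomplete := by
          rw [← hm, IsPrecomplete.map_algebraMap_iff]
          exact isPrecomplete_of_surjective _ (Submodule.mkQ J) (Submodule.mkQ_surjective J) }
    residue_bijective := residue_bijective_of fun s => by
      obtain ⟨s, rfl⟩ := Ideal.Quotient.mk_surjective s
      refine ⟨A.res s, ?_⟩
      rw [← hm]
      exact Ideal.mem_map_of_mem (Ideal.Quotient.mk J) (A.sub_res_mem s) }

end CLAlg

end CurveDef

namespace CurveDef

open IsLocalRing

/-! ### Substitution into power series -/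

namespace CLAlg

variable {K : Type u} [Field K] {σ : Type} [Finite σ]

/-- The inclusion of the constants. -/
noncomputable def constHom (σ : Type) [Finite σ] (A : CLAlg K) : A →ₐ[K] pow σ A :=
  IsScalarTower.toAlgHom K A (MvPowerSeries σ A)

/-- The variables. -/
noncomputable def var (A : CLAlg K) (i : σ) : pow σ A := MvPowerSeries.X i

theorem var_mem (A : CLAlg K) (i : σ) : A.var i ∈ maximalIdeal (pow σ A) := by
  rw [mem_maximalIdeal_mvPowerSeries, var, MvPowerSeries.constantCoeff_X]
  exact zero_mem _

theorem mem_map_maximalIdeal_pow {A : CLAlg K} {p : pow σ A}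
    (hp : ∀ d, MvPowerSeries.coeff d p ∈ maximalIdeal A) :
    p ∈ (maximalIdeal A).map (constHom σ A) :=
  mem_map_C_of_coeff_mem (IsNoetherian.noetherian _) hp

theorem coeff_mem_of_mem_map {A : CLAlg K} {p : pow σ A}
    (hp : p ∈ (maximalIdeal A).map (constHom σ A)) (d : σ →₀ ℕ) :
    MvPowerSeries.coeff d p ∈ maximalIdeal A := by
  have h : (maximalIdeal A).map (constHom σ A) ≤
      RingHom.ker (MvPowerSeries.map (σ := σ) (residue A)) := by
    rw [Ideal.map_le_iff_le_comap]
    intro a ha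
    rw [Ideal.mem_comap, RingHom.mem_ker]
    exact (MvPowerSeries.map_C (residue A) a).trans
      (by rw [(residue_eq_zero_iff a).2 ha, map_zero])
  have h2 := congrArg (MvPowerSeries.coeff d) (RingHom.mem_ker.1 (h hp))
  rw [map_zero] at h2
  exact (residue_eq_zero_iff _).1 ((MvPowerSeries.coeff_map (residue A) d p).symm.trans h2)

/-- Morphisms are local, hence continuous: two that agree on polynomials differ on p by the images
of a tail, which lie in every power of the maximal ideal of C. -/
theorem hom_ext_pow {A C : CLAlg K} {g h : pow σ A →ₐ[K] C}
    (hc : ∀ a, g (constHom σ A a) = h (constHom σ A a)) (hX : ∀ i, g (A.var i) = h (A.var i)) :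
    g = h := by
  ext p
  rw [← sub_eq_zero]
  refine eq_zero_of_forall_mem_pow fun n => ?_
  have hJ : ∀ f : pow σ A →ₐ[K] C,
      ∀ q ∈ Ideal.span (Set.range (MvPowerSeries.X : σ → MvPowerSeries σ A)) ^ n,
      f q ∈ maximalIdeal C ^ n := by
    intro f q hq
    have h1 : Ideal.span (Set.range (MvPowerSeries.X : σ → MvPowerSeries σ A)) ≤
        (maximalIdeal C).comap f := by
      rw [Ideal.span_le]
      rintro _ ⟨i, rfl⟩
      exact map_mem f (A.var_mem i)
    exact Ideal.le_comap_pow f n (Ideal.pow_right_mono h1 n hq)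
  have hpoly : ∀ q : MvPolynomial σ A, g (q : MvPowerSeries σ A) = h (q : MvPowerSeries σ A) := by
    intro q
    have : (g.toRingHom.comp (MvPolynomial.coeToMvPowerSeries.ringHom (σ := σ) (R := A))) =
        h.toRingHom.comp (MvPolynomial.coeToMvPowerSeries.ringHom (σ := σ) (R := A)) := by
      refine MvPolynomial.ringHom_ext (fun a => ?_) fun i => ?_
      · simp only [RingHom.comp_apply, MvPolynomial.coeToMvPowerSeries.ringHom_apply,
          MvPolynomial.coe_C]
        exact hc a
      · simp only [RingHom.comp_apply, MvPolynomial.coeToMvPowerSeries.ringHom_apply,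
          MvPolynomial.coe_X]
        exact hX i
    exact RingHom.congr_fun this q
  have hsub := sub_truncTotal_mem (σ := σ) (A := A) p n
  have h1 := Ideal.sub_mem _ (hJ g _ hsub) (hJ h _ hsub)
  rw [map_sub, map_sub, hpoly, sub_sub_sub_cancel_right] at h1
  exact h1

theorem exists_hom_pow {A C : CLAlg K} (α : A →ₐ[K] C) (c : σ → C)
    (hc : ∀ i, c i ∈ maximalIdeal C) :
    ∃ g : pow σ A →ₐ[K] C, (∀ a, g (constHom σ A a) = α a) ∧ ∀ i, g (A.var i) = c i := by
  -- With A discrete and C carrying its adic topology, α is continuous for free and elements of the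
  -- maximal ideal are topologically nilpotent, so the topological evaluation of power series
  -- applies.
  let _ : UniformSpace A := ⊥
  have : DiscreteTopology A := ⟨rfl⟩
  let _ : WithIdeal C := ⟨maximalIdeal C⟩
  have hcomp := (IsAdic.isAdicComplete_iff (R := C) (I := maximalIdeal C) rfl).1 inferInstance
  have := hcomp.1
  have := hcomp.2
  have hcont : Continuous (α : A →+* C) := continuous_of_discreteTopology
  have hev : MvPowerSeries.HasEval c := by
    refine ⟨fun i => ?_, ?_⟩
    · rw [IsTopologicallyNilpotent, ((maximalIdeal C).hasBasis_nhds_zero_adic).tendsto_right_iff]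
      intro n _
      filter_upwards [Filter.eventually_ge_atTop n] with k hk
      exact Ideal.pow_le_pow_right hk (Ideal.pow_mem_pow (hc i) k)
    · rw [Filter.cofinite_eq_bot]
      exact Filter.tendsto_bot
  let g := MvPowerSeries.eval₂Hom hcont hev
  have gC : ∀ a : A, g (MvPowerSeries.C a) = α a := fun a => by
    change (MvPowerSeries.eval₂Hom hcont hev) _ = _
    rw [MvPowerSeries.coe_eval₂Hom, MvPowerSeries.eval₂_C]
    rfl
  refine ⟨{ toRingHom := g, commutes' := fun k => ?_ }, gC, fun i => ?_⟩
  · refine (congrArg g (MvPowerSeries.algebraMap_apply (σ := σ) (R := K) (A := A))).trans ((gC (algebraMap K A k)).trans (α.commutes k))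
  · change (MvPowerSeries.eval₂Hom hcont hev) (MvPowerSeries.X i) = _
    rw [MvPowerSeries.coe_eval₂Hom, MvPowerSeries.eval₂_X]

/-- Substitution of elements of the maximal ideal into power series. -/
noncomputable def ev {A C : CLAlg K} (α : A →ₐ[K] C) (c : σ → C)
    (hc : ∀ i, c i ∈ maximalIdeal C) : pow σ A →ₐ[K] C :=
  (exists_hom_pow α c hc).choose

theorem ev_constHom {A C : CLAlg K} (α : A →ₐ[K] C) (c : σ → C)
    (hc : ∀ i, c i ∈ maximalIdeal C) (a : A) : ev α c hc (constHom σ A a) = α a :=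
  (exists_hom_pow α c hc).choose_spec.1 a

theorem ev_var {A C : CLAlg K} (α : A →ₐ[K] C) (c : σ → C)
    (hc : ∀ i, c i ∈ maximalIdeal C) (i : σ) : ev α c hc (A.var i) = c i :=
  (exists_hom_pow α c hc).choose_spec.2 i

theorem flat_constHom (A : CLAlg K) : (constHom σ A).toRingHom.Flat :=
  (RingHom.flat_algebraMap_iff (R := A) (S := MvPowerSeries σ A)).2 flat_mvPowerSeries

/-- Morphisms are determined on the quotient by powers of the maximal ideal, so that a morphism
which is surjective modulo the extended maximal ideal is surjective. -/
theorem surjective_of_mod {A B : CLAlg K} (g : A →ₐ[K] B)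
    (h : ∀ b, ∃ a, b - g a ∈ (maximalIdeal A).map g) : Function.Surjective g := by
  have : IsHausdorff ((maximalIdeal A).map (g : A →+* B)) B :=
    IsHausdorff.of_le_jacobson _ _ (by
      rw [jacobson_eq_maximalIdeal _ bot_ne_top]
      exact map_maximalIdeal_le g)
  refine surjective_of_mk_map_comp_surjective (I := maximalIdeal A) (g : A →+* B) fun y => ?_
  obtain ⟨b, rfl⟩ := Ideal.Quotient.mk_surjective y
  obtain ⟨a, ha⟩ := h b
  refine ⟨a, ?_⟩
  rw [RingHom.comp_apply, eq_comm, ← sub_eq_zero, ← map_sub, Ideal.Quotient.eq_zero_iff_mem]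
  exact ha

theorem isHausdorff_of_hom {A B : CLAlg K} (g : A →ₐ[K] B) :
    letI := g.toRingHom.toAlgebra
    IsHausdorff (maximalIdeal A) B := by
  let _ := g.toRingHom.toAlgebra
  rw [← IsHausdorff.map_algebraMap_iff (S := B)]
  exact IsHausdorff.of_le_jacobson _ _ (by
    rw [jacobson_eq_maximalIdeal _ bot_ne_top]
    exact map_maximalIdeal_le g)

/-- A morphism over `A` into a flat `A`-algebra which is injective modulo the maximal ideal of `A`
is injective. -/
theorem injective_of_mod {A B : CLAlg K} {C : Type u} [CommRing C] [Algebra K C]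
    (ι : A →ₐ[K] B) (g : B →ₐ[K] C) (hflat : (g.comp ι).toRingHom.Flat)
    (h : ∀ b, g b ∈ (maximalIdeal A).map (g.comp ι) → b ∈ (maximalIdeal A).map ι) :
    Function.Injective g := by
  let _ : Algebra A B := ι.toRingHom.toAlgebra
  let _ : Algebra A C := (g.comp ι).toRingHom.toAlgebra
  have : Module.Flat A C := hflat
  have := isHausdorff_of_hom ι
  let g' : B →ₐ[A] C := { toRingHom := g.toRingHom, commutes' := fun a => rfl }
  refine injective_of_flat g'.toLinearMap fun b hb => ?_
  rw [Ideal.smul_top_eq_map] at hb ⊢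
  exact h b hb

end CLAlg

/-! ### Coordinates -/

section Coord

open CLAlg

variable {K : Type u} [Field K] {σ : Type} [Finite σ]

/-- `S` is the power series ring over `A` in the coordinates `s`. -/
structure IsCoord {A S : CLAlg K} (ι : A →ₐ[K] S) (s : σ → S) : Prop where
  mem : ∀ i, s i ∈ maximalIdeal S
  bij : Function.Bijective (ev ι s mem)

/-- Surjectivity of A[[σ]] → S is Nakayama's lemma. Injectivity follows from flatness of S over A,
once it is known modulo the maximal ideal of A, where it is a statement about K[[σ]]. -/
theorem isCoord_of {A S : CLAlg K} (ι : A →ₐ[K] S) (s : σ → S) (hflat : ι.toRingHom.Flat)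
    (hs : ∀ i, s i ∈ maximalIdeal S)
    (hgen : maximalIdeal S ≤ (maximalIdeal A).map ι ⊔ Ideal.span (Set.range s))
    (hind : ∀ p : pow σ (base K), ev (A := base K) (Algebra.ofId K S) s hs p ∈
      (maximalIdeal A).map ι → p = 0) : IsCoord ι s := by
  have hev : (ev ι s hs).comp (constHom σ A) = ι := AlgHom.ext fun a => ev_constHom ι s hs a
  refine ⟨hs, ?_, ?_⟩
  · refine injective_of_mod (constHom σ A) _ (by rw [hev]; exact hflat) fun p hp => ?_
    rw [hev] at hp
    let lift : pow σ (base K) →ₐ[K] pow σ A := MvPowerSeries.mapAlgHom (Algebra.ofId K A)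
    let red : pow σ A →ₐ[K] pow σ (base K) := MvPowerSeries.mapAlgHom A.res
    have hlift : (ev ι s hs).comp lift = ev (A := base K) (Algebra.ofId K S) s hs := by
      refine hom_ext_pow (fun a => ?_) fun i => ?_
      · have h1 : lift (constHom σ (base K) a) = constHom σ A (algebraMap K A a) :=
          MvPowerSeries.map_C _ _
        rw [AlgHom.comp_apply, h1, ev_constHom, ev_constHom]
        exact AlgHom.commutes _ _
      · have h1 : lift ((base K).var i) = A.var i := MvPowerSeries.map_X _ _
        rw [AlgHom.comp_apply, h1, ev_var, ev_var]
    -- Replacing each coefficient by its residue in K changes p only by a series with coefficients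
    -- in the maximal ideal of A.
    have key : p - lift (red p) ∈ (maximalIdeal A).map (constHom σ A) := by
      refine mem_map_maximalIdeal_pow fun d => ?_
      rw [map_sub]
      exact A.sub_res_mem (MvPowerSeries.coeff d p)
    have h0 : red p = 0 := by
      apply hind
      rw [← hlift, AlgHom.comp_apply]
      have h1 := Ideal.mem_map_of_mem (ev ι s hs) key
      rw [Ideal.map_mapₐ, hev, map_sub] at h1
      have h2 := Ideal.sub_mem _ hp h1
      rwa [sub_sub_cancel] at h2
    rwa [h0, map_zero, sub_zero] at key
  · refine surjective_of_mod _ fun x => ⟨constHom σ A (algebraMap K A (S.res x)), ?_⟩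
    rw [ev_constHom, AlgHom.commutes]
    refine (hgen.trans (sup_le ?_ ?_)) (S.sub_res_mem x)
    · rw [Ideal.map_le_iff_le_comap]
      intro a ha
      rw [Ideal.mem_comap, ← ev_constHom ι s hs]
      exact Ideal.mem_map_of_mem _ (map_mem _ ha)
    · rw [Ideal.span_le]
      rintro _ ⟨i, rfl⟩
      rw [← ev_var ι s hs i]
      exact Ideal.mem_map_of_mem _ (A.var_mem i)

theorem IsCoord.hom_ext {A S C : CLAlg K} {ι : A →ₐ[K] S} {s : σ → S} (h : IsCoord ι s)
    {g₁ g₂ : S →ₐ[K] C} (hι : ∀ a, g₁ (ι a) = g₂ (ι a)) (hs : ∀ i, g₁ (s i) = g₂ (s i)) :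
    g₁ = g₂ := by
  have : g₁.comp (ev ι s h.mem) = g₂.comp (ev ι s h.mem) := by
    refine hom_ext_pow (fun a => ?_) fun i => ?_
    · rw [AlgHom.comp_apply, AlgHom.comp_apply, ev_constHom, hι]
    · rw [AlgHom.comp_apply, AlgHom.comp_apply, ev_var, hs]
  ext x
  obtain ⟨p, rfl⟩ := h.bij.2 x
  exact AlgHom.congr_fun this p

theorem IsCoord.exists_hom {A S C : CLAlg K} {ι : A →ₐ[K] S} {s : σ → S} (h : IsCoord ι s)
    (α : A →ₐ[K] C) (c : σ → C) (hc : ∀ i, c i ∈ maximalIdeal C) :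
    ∃ g : S →ₐ[K] C, (∀ a, g (ι a) = α a) ∧ ∀ i, g (s i) = c i := by
  let e := AlgEquiv.ofBijective (ev ι s h.mem) h.bij
  refine ⟨(ev α c hc).comp e.symm.toAlgHom, fun a => ?_, fun i => ?_⟩
  · have : e.symm (ι a) = constHom σ A a := by
      rw [AlgEquiv.symm_apply_eq]; exact (ev_constHom ι s h.mem a).symm
    change ev α c hc (e.symm (ι a)) = α a
    rw [this, ev_constHom]
  · have : e.symm (s i) = A.var i := by
      rw [AlgEquiv.symm_apply_eq]; exact (ev_var ι s h.mem i).symm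
    change ev α c hc (e.symm (s i)) = c i
    rw [this, ev_var]

end Coord

end CurveDef

namespace CurveDef

open IsLocalRing CLAlg

/-! ### Adapted coordinates of the plane -/

section Plane

variable {K : Type u} [Field K]

variable (K) in
/-- `K[[x, y]]` as a complete local algebra. -/
noncomputable abbrev plane : CLAlg K := pow (Fin 2) (base K)

variable (K) in
/-- `K[[t]]` as a complete local algebra. -/
noncomputable abbrev line : CLAlg K := pow Unit (base K)

/-- The variable of `K[[t]]`. -/
noncomputable abbrev lvar : line K := (base K).var ()

/-- A morphism from `K[[σ]]` is determined by the images of the variables. -/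
theorem hom_ext_base {σ : Type} [Finite σ] {C : CLAlg K} {g h : pow σ (base K) →ₐ[K] C}
    (hX : ∀ i, g ((base K).var i) = h ((base K).var i)) : g = h := by
  refine hom_ext_pow (fun a => ?_) hX
  have : constHom σ (base K) a = algebraMap K _ a := (AlgHom.commutes (constHom σ (base K)) a)
  rw [this, AlgHom.commutes, AlgHom.commutes]

theorem ev_ofId_var {σ : Type} [Finite σ] {C : CLAlg K} (c : σ → C)
    (hc : ∀ i, c i ∈ maximalIdeal C) (i : σ) :
    ev (A := base K) (Algebra.ofId K C) c hc ((base K).var i) = c i := ev_var _ _ _ i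

theorem exists_hom_base {σ : Type} [Finite σ] {C : CLAlg K} (c : σ → C)
    (hc : ∀ i, c i ∈ maximalIdeal C) :
    ∃ g : pow σ (base K) →ₐ[K] C, ∀ i, g ((base K).var i) = c i :=
  ⟨_, ev_ofId_var c hc⟩

/-- The quotient C / J is again a complete local algebra, so both composites to it are determined by
the images of the variables. -/
theorem mk_eq_of_hom {C : CLAlg K} {σ : Type} [Finite σ] (g h : pow σ (base K) →ₐ[K] C)
    (J : Ideal C) (hJ : J ≠ ⊤) (hX : ∀ i, g ((base K).var i) - h ((base K).var i) ∈ J)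
    (p : pow σ (base K)) : g p - h p ∈ J := by
  let π : C →ₐ[K] quot C J hJ := Ideal.Quotient.mkₐ K J
  have : π.comp g = π.comp h := hom_ext_base fun i => by
    have := hX i
    rw [← Ideal.Quotient.eq_zero_iff_mem, map_sub, sub_eq_zero] at this
    exact this
  rw [← Ideal.Quotient.eq_zero_iff_mem, map_sub, sub_eq_zero]
  exact AlgHom.congr_fun this p

instance {σ : Type} [Finite σ] : IsDomain (pow σ (base K)) :=
  (NoZeroDivisors.to_isDomain (MvPowerSeries σ K) :)

instance : IsPrincipalIdealRing (line K) :=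
  inferInstanceAs (IsPrincipalIdealRing (PowerSeries K))

theorem maximalIdeal_line : maximalIdeal (line K) = Ideal.span {lvar} :=
  PowerSeries.maximalIdeal_eq_span_X (k := K)

theorem lvar_ne_zero : (lvar : line K) ≠ 0 := PowerSeries.X_ne_zero (R := K)

theorem span_singleton_ne_top {C : CLAlg K} {z : C} (hz : z ∈ maximalIdeal C) :
    Ideal.span {z} ≠ ⊤ := by
  intro h
  rw [Ideal.span_singleton_eq_top] at h
  exact (mem_maximalIdeal z).1 hz h

theorem exists_eq_pow_mul_unit {a : line K} (ha : a ≠ 0) :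
    ∃ (n : ℕ) (v : line K), IsUnit v ∧ a = lvar ^ n * v := by
  exact ⟨_, _, PowerSeries.isUnit_divided_by_X_pow_order (k := K) ha,
    (PowerSeries.X_pow_order_mul_divXPowOrder (R := K)).symm⟩

/-- Look for a smooth curve z = x + y^N which is not a component of g = 0. Its parametrization ε by
y ↦ t has kernel (z), and ε g ≠ 0 gives both that z is regular modulo g and that a power of y lies
in (z, g). A large N makes ε a small perturbation of the axis x = 0, and this works over every
field. -/
theorem exists_adapted_coordinates {g : plane K} (hg : g ≠ 0) :
    ∃ z w : plane K, z ∈ maximalIdeal (plane K) ∧ w ∈ maximalIdeal (plane K) ∧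
      maximalIdeal (plane K) ≤ Ideal.span {z, w} ∧ (∀ a b, z * a = g * b → g ∣ a) ∧
      ∃ n, w ^ n ∈ Ideal.span {z, g} := by
  let x : plane K := (base K).var 0
  let y : plane K := (base K).var 1
  have hx : x ∈ maximalIdeal (plane K) := var_mem _ _
  have hy : y ∈ maximalIdeal (plane K) := var_mem _ _
  have ht : (lvar : line K) ∈ maximalIdeal (line K) := var_mem _ _
  obtain ⟨s, hs⟩ := exists_hom_base (C := plane K) (fun _ : Unit => y) fun _ => hy
  have hs : s lvar = y := hs ()
  have hε : ∀ c ∈ maximalIdeal (line K), ∃ ε : plane K →ₐ[K] line K, ε x = c ∧ ε y = lvar :=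
    fun c hc => by
      obtain ⟨ε, h⟩ := exists_hom_base (C := line K) ![c, lvar] (by
        intro i; fin_cases i <;> assumption)
      exact ⟨ε, h 0, h 1⟩
  have hsec : ∀ ε : plane K →ₐ[K] line K, ε y = lvar → ∀ a, ε (s a) = a := fun ε h a => by
    have : ε.comp s = AlgHom.id K (line K) := hom_ext_base fun i => by
      rw [AlgHom.comp_apply]
      exact (congrArg ε hs).trans h
    exact AlgHom.congr_fun this a
  -- The kernel of such an ε is generated by x - s(ε x): modulo this element the identity and s ∘ ε
  -- agree on x and on y.
  have hker : ∀ ε : plane K →ₐ[K] line K, ε x ∈ maximalIdeal (line K) → ε y = lvar → ∀ p,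
      p - s (ε p) ∈ Ideal.span {x - s (ε x)} := fun ε h0 h1 p => by
    refine mk_eq_of_hom (AlgHom.id K (plane K)) (s.comp ε) _ (span_singleton_ne_top ?_)
      (fun i => ?_) p
    · exact Ideal.sub_mem _ hx (map_mem s h0)
    · fin_cases i
      · exact Ideal.subset_span rfl
      · change y - s (ε y) ∈ _
        rw [h1, hs, sub_self]
        exact zero_mem _
  obtain ⟨ε₀, h₀x, h₀y⟩ := hε 0 (zero_mem _)
  obtain ⟨h, hhx, hhy⟩ : ∃ h : plane K →ₐ[K] line K, h x = lvar ∧ h y = 0 := by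
    obtain ⟨ε, h⟩ := exists_hom_base (C := line K) ![lvar, 0] (by
      intro i; fin_cases i
      · exact ht
      · exact zero_mem _)
    exact ⟨ε, h 0, h 1⟩
  have ht0 := lvar_ne_zero (K := K)
  have hfin : FiniteMultiplicity x g :=
    FiniteMultiplicity.of_not_isUnit ((mem_maximalIdeal x).1 hx) hg
  obtain ⟨g', hg', hdvd⟩ := hfin.exists_eq_pow_mul_and_not_dvd
  have hε₀g : ε₀ g' ≠ 0 := fun h0 => by
    have := hker ε₀ (by rw [h₀x]; exact zero_mem _) h₀y g'
    rw [h0, h₀x, map_zero, sub_zero, sub_zero, Ideal.mem_span_singleton] at this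
    exact hdvd this
  -- N exceeds the order of the restriction of g' to the axis x = 0, where g' is g with all factors
  -- x removed.
  obtain ⟨N, hN⟩ : ∃ N, ¬ (lvar : line K) ^ N ∣ ε₀ g' :=
    let ⟨n, hn⟩ := FiniteMultiplicity.of_not_isUnit ((mem_maximalIdeal _).1 ht) hε₀g
    ⟨n + 1, hn⟩
  have hN0 : N ≠ 0 := by rintro rfl; simp at hN
  have htN : (lvar : line K) ^ N ∈ maximalIdeal (line K) := Ideal.pow_mem_of_mem _ ht N
    (Nat.pos_of_ne_zero hN0)
  -- The sign makes ε kill z = x + y^N. As ε and ε₀ agree modulo t^N, ε g' = 0 would force t^N to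
  -- divide ε₀ g'.
  obtain ⟨ε, hεx, hεy⟩ := hε (-lvar ^ N) (neg_mem htN)
  have hsεx : s (ε x) = -y ^ N := by rw [hεx, map_neg, map_pow, hs]
  let z := x + y ^ N
  have hz : x - s (ε x) = z := by rw [hsεx, sub_neg_eq_add]
  have hker := hker ε (by rw [hεx]; exact neg_mem htN) hεy
  rw [hz] at hker
  have hzm : z ∈ maximalIdeal (plane K) :=
    Ideal.add_mem _ hx (Ideal.pow_mem_of_mem _ hy N (Nat.pos_of_ne_zero hN0))
  have hz0 : z ≠ 0 := fun h0 => ht0 (by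
    have := congrArg h h0
    rwa [map_add, map_pow, hhx, hhy, zero_pow hN0, add_zero, map_zero] at this)
  have hεg : ε g ≠ 0 := by
    rw [hg', map_mul, map_pow, hεx]
    refine mul_ne_zero (pow_ne_zero _ (neg_ne_zero.2 (pow_ne_zero _ ht0))) fun h0 => hN ?_
    have := mk_eq_of_hom ε₀ ε (Ideal.span {lvar ^ N}) (span_singleton_ne_top htN) (fun i => by
      fin_cases i
      · change ε₀ x - ε x ∈ _
        rw [h₀x, hεx, zero_sub, neg_neg]
        exact Ideal.subset_span rfl
      · change ε₀ y - ε y ∈ _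
        rw [h₀y, hεy, sub_self]
        exact zero_mem _) g'
    rwa [h0, sub_zero, Ideal.mem_span_singleton] at this
  refine ⟨z, y, hzm, hy, fun p hp => ?_, fun a b hab => ?_, ?_⟩
  · have h1 : ε p ∈ Ideal.span {(lvar : line K)} := by
      rw [← maximalIdeal_line]
      exact map_mem ε hp
    have h2 := Ideal.mem_map_of_mem s h1
    rw [Ideal.map_span, Set.image_singleton, hs] at h2
    rw [← sub_add_cancel p (s (ε p))]
    exact Ideal.add_mem _ (Ideal.span_mono (by simp) (hker p)) (Ideal.span_mono (by simp) h2)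
  · have hεz : ε z = 0 := by rw [map_add, map_pow, hεx, hεy, neg_add_cancel]
    have h1 := congrArg ε hab
    rw [map_mul, hεz, zero_mul, map_mul, eq_comm, mul_eq_zero] at h1
    have h2 := hker b
    rw [h1.resolve_left hεg, map_zero, sub_zero, Ideal.mem_span_singleton] at h2
    obtain ⟨c, rfl⟩ := h2
    refine ⟨c, mul_left_cancel₀ hz0 ?_⟩
    rw [hab]; ring
  · obtain ⟨n, v, hv, hn⟩ := exists_eq_pow_mul_unit hεg
    obtain ⟨v', hv'⟩ := hv.exists_right_inv
    refine ⟨n, ?_⟩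
    have h1 := hker (y ^ n - g * s v')
    have h2 : ε (y ^ n - g * s v') = 0 := by
      rw [map_sub, map_pow, hεy, map_mul, hsec ε hεy, hn, mul_assoc, hv', mul_one, sub_self]
    rw [h2, map_zero, sub_zero] at h1
    rw [← sub_add_cancel (y ^ n) (g * s v')]
    exact Ideal.add_mem _ (Ideal.span_mono (by simp) h1)
      (Ideal.mul_mem_right _ _ (Ideal.subset_span (by simp)))

end Plane

end CurveDef

namespace CurveDef

open IsLocalRing CLAlg

/-! ### Regularity of integrally closed local rings of dimension one -/

/-- A Noetherian local ring with a regular parameter `z` for which `z ∣ b` as soon as `b / z` is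
integral has a maximal ideal generated by a regular element. -/
theorem exists_regular_generator {O : Type*} [CommRing O] [IsLocalRing O] [IsNoetherianRing O]
    {z : O} (hz : z ∈ maximalIdeal O) (hreg : ∀ x, z * x = 0 → x = 0)
    (hpow : ∃ n, maximalIdeal O ^ n ≤ Ideal.span {z})
    (hic : ∀ (b : O) (c : ℕ → O) (n : ℕ), n ≠ 0 →
      b ^ n + ∑ k ∈ Finset.range n, c k * z ^ (n - k) * b ^ k = 0 → z ∣ b) :
    ∃ t ∈ maximalIdeal O, maximalIdeal O = Ideal.span {t} ∧ ∀ x, t * x = 0 → x = 0 := by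
  classical
  set m := maximalIdeal O with hm
  -- The last power of m not contained in (z) provides an element b outside (z) with b m ⊆ (z); the
  -- fraction b/z then maps m into O.
  obtain ⟨n, hn, hmin⟩ : ∃ n, m ^ (n + 1) ≤ Ideal.span {z} ∧ ¬ m ^ n ≤ Ideal.span {z} := by
    have h0 : Nat.find hpow ≠ 0 := fun h0 => by
      have := Nat.find_spec hpow
      rw [h0, pow_zero, Ideal.one_eq_top, top_le_iff, Ideal.span_singleton_eq_top] at this
      exact (mem_maximalIdeal z).1 hz this
    obtain ⟨k, hk⟩ := Nat.exists_eq_succ_of_ne_zero h0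
    refine ⟨k, ?_, Nat.find_min hpow (by omega)⟩
    have := Nat.find_spec hpow
    rwa [hk] at this
  obtain ⟨b, hb, hbz⟩ := Set.not_subset.1 hmin
  have hbm : ∀ a ∈ m, ∃ c, b * a = z * c := fun a ha => by
    have h1 : b * a ∈ m ^ (n + 1) := by rw [pow_succ]; exact Ideal.mul_mem_mul hb ha
    exact Ideal.mem_span_singleton.1 (hn h1)
  -- Either (b/z) m ⊆ m, and then b/z is integral, which contradicts z ∤ b; or (b/z) t is a unit for
  -- some t ∈ m, and then t generates m.
  by_cases hcase : ∀ a ∈ m, ∀ c, b * a = z * c → c ∈ m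
  · exfalso
    let F : Module.End O m := b • LinearMap.id
    have hF : LinearMap.range F ≤ Ideal.span {z} • (⊤ : Submodule O m) := by
      rintro _ ⟨⟨a, ha⟩, rfl⟩
      obtain ⟨c, hc⟩ := hbm a ha
      have : F ⟨a, ha⟩ = z • (⟨c, hcase a ha c hc⟩ : m) := Subtype.ext hc
      rw [this]
      exact Submodule.smul_mem_smul (Ideal.subset_span rfl) Submodule.mem_top
    -- Cayley–Hamilton for multiplication by b on m, whose image lies in z m, puts the coefficients
    -- into powers of (z): this is an equation of integrality for b/z with denominators cleared.
    obtain ⟨p, hp, hpn, hpc, hp0⟩ :=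
      LinearMap.exists_monic_and_natDegree_eq_and_coeff_mem_pow_and_aeval_eq_zero O F
        (Ideal.span {z}) hF
    have hroot : p.eval b = 0 := by
      have h1 : Polynomial.aeval F p = p.eval b • (1 : Module.End O m) := by
        have hFa : F = algebraMap O (Module.End O m) b := by
          rw [Algebra.algebraMap_eq_smul_one]; rfl
        rw [hFa, Polynomial.aeval_algebraMap_apply, Algebra.algebraMap_eq_smul_one]
        simp
      have h2 := LinearMap.congr_fun (h1.symm.trans hp0) ⟨z, hz⟩
      have h3 : p.eval b * z = 0 := congrArg Subtype.val h2
      exact hreg _ (by rw [mul_comm]; exact h3)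
    have hc : ∀ k, ∃ c, p.coeff k = c * z ^ (p.natDegree - k) := fun k => by
      have := hpc k
      rw [Ideal.span_singleton_pow, Ideal.mem_span_singleton'] at this
      exact this.imp fun _ h => h.symm
    choose c hc using hc
    refine hbz (Ideal.mem_span_singleton.2 (hic b c p.natDegree (fun h0 => ?_) ?_))
    · rw [hp.natDegree_eq_zero.1 h0, Polynomial.eval_one] at hroot
      exact one_ne_zero hroot
    · rw [Polynomial.eval_eq_sum_range, Finset.sum_range_succ, hp.coeff_natDegree, one_mul,
        add_comm] at hroot
      simpa only [hc] using hroot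
  · push Not at hcase
    obtain ⟨t, ht, v, hv, hvm⟩ := hcase
    have hvu : IsUnit v := by rwa [mem_maximalIdeal, mem_nonunits_iff, not_not] at hvm
    have hcancel : ∀ x y, z * x = z * y → x = y := fun x y hxy => by
      rw [← sub_eq_zero]
      exact hreg _ (by rw [mul_sub, hxy, sub_self])
    refine ⟨t, ht, le_antisymm (fun a ha => ?_) ?_, fun x hx => ?_⟩
    · obtain ⟨c, hc⟩ := hbm a ha
      rw [Ideal.mem_span_singleton]
      have : a * v = t * c := hcancel _ _ (by
        calc z * (a * v) = a * (z * v) := by ring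
          _ = (b * a) * t := by rw [← hv]; ring
          _ = z * (t * c) := by rw [hc]; ring)
      exact (hvu.dvd_mul_right).1 ⟨c, this⟩
    · rw [Ideal.span_le, Set.singleton_subset_iff]
      exact ht
    · have : v * x = 0 := hreg _ (by
        calc z * (v * x) = (z * v) * x := by ring
          _ = b * (t * x) := by rw [← hv]; ring
          _ = 0 := by rw [hx, mul_zero])
      exact (hvu.mul_right_eq_zero).1 this

end CurveDef

namespace CurveDef

open IsLocalRing CLAlg

/-! ### The normalization -/

/-- Dividing the equation by zⁿ shows that b/z is integral over the integral closure, hence over R,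
so it lies in the integral closure. -/
theorem dvd_of_isIntegral_div {R Q : Type*} [CommRing R] [CommRing Q] [Algebra R Q]
    {z : integralClosure R Q} (hz : IsUnit (z : Q)) (b : integralClosure R Q)
    (c : ℕ → integralClosure R Q) (n : ℕ)
    (hb : b ^ n + ∑ k ∈ Finset.range n, c k * z ^ (n - k) * b ^ k = 0) : z ∣ b := by
  obtain ⟨v, hv⟩ := hz.exists_right_inv
  have hint : IsIntegral (integralClosure R Q) ((b : Q) * v) := by
    refine ⟨Polynomial.X ^ n + ∑ k ∈ Finset.range n,
      Polynomial.C (c k) * Polynomial.X ^ k, Polynomial.monic_X_pow_add ?_, ?_⟩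
    · refine (Polynomial.degree_sum_le _ _).trans_lt ?_
      refine (Finset.sup_lt_iff (WithBot.bot_lt_coe n)).2 fun k hk => ?_
      exact (Polynomial.degree_C_mul_X_pow_le _ _).trans_lt
        (WithBot.coe_lt_coe.2 (Finset.mem_range.1 hk))
    · have h1 : (b : Q) ^ n + ∑ k ∈ Finset.range n, (c k : Q) * (z : Q) ^ (n - k) *
          (b : Q) ^ k = 0 := by
        have := congrArg (integralClosure R Q).val hb
        simpa only [map_add, map_pow, map_sum, map_mul, map_zero] using! this
      have h2 := congrArg (v ^ n * ·) h1
      simp only [mul_zero, mul_add, Finset.mul_sum] at h2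
      rw [Polynomial.eval₂_add, Polynomial.eval₂_X_pow, Polynomial.eval₂_finsetSum, ← h2]
      congr 1
      · rw [mul_pow, mul_comm]
      · refine Finset.sum_congr rfl fun k hk => ?_
        rw [Polynomial.eval₂_mul, Polynomial.eval₂_C, Polynomial.eval₂_X_pow]
        have hn : n = (n - k) + k := by have := Finset.mem_range.1 hk; omega
        have h3 : v ^ n * (z : Q) ^ (n - k) = v ^ k := by
          calc v ^ n * (z : Q) ^ (n - k)
              = v ^ ((n - k) + k) * (z : Q) ^ (n - k) := by rw [← hn]
            _ = v ^ k * ((z : Q) * v) ^ (n - k) := by rw [pow_add, mul_pow]; ring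
            _ = v ^ k := by rw [hv, one_pow, mul_one]
        calc (c k : Q) * ((b : Q) * v) ^ k = (c k : Q) * (b : Q) ^ k * v ^ k := by
              rw [mul_pow, mul_assoc]
          _ = v ^ n * ((c k : Q) * (z : Q) ^ (n - k) * (b : Q) ^ k) := by
              rw [← h3]; ring
  have hint' : IsIntegral R ((b : Q) * v) := isIntegral_trans _ hint
  refine ⟨⟨(b : Q) * v, hint'⟩, Subtype.ext ?_⟩
  change (b : Q) = (z : Q) * ((b : Q) * v)
  rw [mul_left_comm, hv, mul_one]

section Normalization

variable {K : Type u} [Field K] {r : ℕ} {f : Fin r → PS K}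

theorem normMap_injective (f : Fin r → PS K) : Function.Injective (normMap f) := by
  intro a b hab
  have h1 : algebraMap (CurveRing f) (FractionRing (CurveRing f)) a =
    algebraMap (CurveRing f) (FractionRing (CurveRing f)) b := congrArg Subtype.val hab
  exact IsFractionRing.injective _ _ h1

theorem projMap_eq_zero {p : PS K} : projMap f p = 0 ↔ (∏ i, f i) ∣ p := by
  rw [← Ideal.mem_span_singleton]
  exact Ideal.Quotient.eq_zero_iff_mem

theorem parMap_eq_zero {p : PS K} : parMap f p = 0 ↔ (∏ i, f i) ∣ p := by
  rw [← projMap_eq_zero, parMap, AlgHom.comp_apply, map_eq_zero_iff _ (normMap_injective f)]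

theorem projMap_surjective (f : Fin r → PS K) : Function.Surjective (projMap f) :=
  Ideal.Quotient.mk_surjective

theorem isIntegral_parMap (f : Fin r → PS K) : (parMap f).toRingHom.IsIntegral :=
  RingHom.IsIntegral.trans (projMap f).toRingHom (normMap f).toRingHom
    (RingHom.isIntegral_of_surjective _ (projMap_surjective f))
    (algebraMap_isIntegral_iff.2 (inferInstance : Algebra.IsIntegral (CurveRing f) _))

/-- Coordinates of the plane in which the curve `f` is finite over the first axis. -/
structure IsAdapted (f : Fin r → PS K) (z w : PS K) : Prop where
  mem_z : z ∈ maximalIdeal (plane K)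
  mem_w : w ∈ maximalIdeal (plane K)
  gen : maximalIdeal (plane K) ≤ Ideal.span {z, w}
  reg : ∀ a b, z * a = (∏ i, f i) * b → (∏ i, f i) ∣ a
  pow : ∃ n, w ^ n ∈ Ideal.span {z, ∏ i, f i}

theorem exists_isAdapted (hf : ∀ i, f i ≠ 0) : ∃ z w, IsAdapted f z w := by
  have h0 : (∏ i, f i : PS K) ≠ 0 := Finset.prod_ne_zero_iff.2 fun i _ => hf i
  obtain ⟨z, w, h1, h2, h3, h4, h5⟩ := exists_adapted_coordinates (K := K) (g := ∏ i, f i) h0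
  exact ⟨z, w, h1, h2, h3, h4, h5⟩

namespace IsAdapted

variable {z w : PS K} (h : IsAdapted f z w)

include h

theorem isUnit_fraction : IsUnit (parMap f z : FractionRing (CurveRing f)) := by
  have hz : projMap f z ∈ nonZeroDivisors (CurveRing f) := by
    rw [mem_nonZeroDivisors_iff_right]
    intro x hx
    obtain ⟨a, rfl⟩ := projMap_surjective f x
    rw [← map_mul, projMap_eq_zero] at hx
    obtain ⟨b, hb⟩ := hx
    exact projMap_eq_zero.2 (h.reg a b (by rw [mul_comm, hb]))
  exact IsLocalization.map_units (FractionRing (CurveRing f)) ⟨_, hz⟩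

theorem regular {x : Normalization f} (hx : parMap f z * x = 0) : x = 0 := by
  have h1 : (parMap f z : FractionRing (CurveRing f)) * x = 0 := congrArg Subtype.val hx
  exact Subtype.ext ((h.isUnit_fraction.mul_right_eq_zero).1 h1)

theorem dvd_of_integral (b : Normalization f) (c : ℕ → Normalization f) (n : ℕ)
    (hb : b ^ n + ∑ k ∈ Finset.range n, c k * parMap f z ^ (n - k) * b ^ k = 0) :
    parMap f z ∣ b :=
  dvd_of_isIntegral_div h.isUnit_fraction b c n hb

end IsAdapted

end Normalization

/-! ### The summands of a deformation of the normalization -/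

namespace SecDef

variable {K : Type u} [Field K] {r : ℕ} {f : Fin r → PS K} {S : Type u} [CommRing S] [Algebra K S]
  {κ : S →ₐ[K] Normalization f} (ξ : SecDef f κ)

/-- The component `S_A → R̄_{A,i}` of `φ_A`. -/
noncomputable def φi (i : Fin r) : ξ.SA →ₐ[K] ξ.RbarA i :=
  (Pi.evalAlgHom K (fun j => (ξ.RbarA j : Type u)) i).comp ξ.φ

/-- The structure map `A → R̄_{A,i}`. -/
noncomputable def ιi (i : Fin r) : ξ.A →ₐ[K] ξ.RbarA i := (ξ.φi i).comp ξ.ι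

theorem φi_apply (i : Fin r) (s : ξ.SA) : ξ.φi i s = ξ.φ s i := rfl

theorem ιi_apply (i : Fin r) (a : ξ.A) : ξ.ιi i a = ξ.φ (ξ.ι a) i := rfl

theorem flat_ιi (i : Fin r) : (ξ.ιi i).toRingHom.Flat := ξ.flat_RbarA i

/-- The part of the closed fibre in the `i`-th summand. -/
noncomputable def mi (i : Fin r) : Ideal (ξ.RbarA i) := (maximalIdeal ξ.A).map (ξ.ιi i)

theorem mi_le (i : Fin r) : ξ.mi i ≤ maximalIdeal (ξ.RbarA i) := map_maximalIdeal_le _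

theorem mi_ne_top (i : Fin r) : ξ.mi i ≠ ⊤ := fun h => by
  have := ξ.mi_le i
  rw [h, top_le_iff] at this
  exact (maximalIdeal.isMaximal (ξ.RbarA i)).ne_top this

theorem mem_mi_of_mem (t : ∀ i, ξ.RbarA i) (ht : ξ.resRbar t = 0) (i : Fin r) : t i ∈ ξ.mi i := by
  have h1 : t ∈ (maximalIdeal ξ.A).map (ξ.φ.comp ξ.ι) := by
    rw [← ξ.closedFibre_RbarA.2]; exact ht
  have h2 := Ideal.mem_map_of_mem (Pi.evalAlgHom K (fun j => (ξ.RbarA j : Type u)) i) h1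
  rw [Ideal.map_mapₐ] at h2
  exact h2

theorem resRbar_eq_zero_of_mem {t : ∀ i, ξ.RbarA i}
    (ht : t ∈ (maximalIdeal ξ.A).map (ξ.φ.comp ξ.ι)) : ξ.resRbar t = 0 := by
  rw [← ξ.closedFibre_RbarA.2] at ht
  exact ht

theorem resRbar_single_of_mem {i : Fin r} {s : ξ.RbarA i} (hs : s ∈ ξ.mi i) :
    ξ.resRbar (Pi.single i s) = 0 := by
  refine ξ.resRbar_eq_zero_of_mem ?_
  induction hs using Submodule.span_induction with
  | mem x hx =>
    obtain ⟨a, ha, rfl⟩ := hx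
    have : Pi.single (M := fun j => ξ.RbarA j) i (ξ.ιi i a) = ξ.φ (ξ.ι a) * Pi.single i (1 : ξ.RbarA i) := by
      ext j
      by_cases hj : j = i
      · subst hj; simp [ιi_apply]
      · simp [hj]
    change Pi.single (M := fun j => ξ.RbarA j) i (ξ.ιi i a) ∈ _
    rw [this]
    exact Ideal.mul_mem_right _ _ (Ideal.mem_map_of_mem (ξ.φ.comp ξ.ι) ha)
  | zero => rw [Pi.single_zero]; exact zero_mem _
  | add x y _ _ hx hy => rw [Pi.single_add]; exact add_mem hx hy
  | smul a x _ hx =>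
    have : Pi.single i (a • x) = Pi.single i a * Pi.single (M := fun j => ξ.RbarA j) i x := by
      rw [smul_eq_mul, Pi.single_mul]
    rw [this]
    exact Ideal.mul_mem_left _ _ hx

theorem resRbar_single_eq_zero {i : Fin r} {s : ξ.RbarA i} :
    ξ.resRbar (Pi.single i s) = 0 ↔ s ∈ ξ.mi i := by
  refine ⟨fun h => ?_, ξ.resRbar_single_of_mem⟩
  have := ξ.mem_mi_of_mem _ h i
  rwa [Pi.single_eq_same] at this

/-- An ideal of a finite product is the product of its projections, by means of the idempotents. So
R̄ is the product of the closed fibres of the summands, and vanishing in R̄ can be tested on each of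
them. -/
theorem resRbar_eq_zero {t : ∀ i, ξ.RbarA i} : ξ.resRbar t = 0 ↔ ∀ i, t i ∈ ξ.mi i := by
  refine ⟨ξ.mem_mi_of_mem t, fun h => ?_⟩
  rw [← Finset.univ_sum_single t, map_sum]
  exact Finset.sum_eq_zero fun i _ => ξ.resRbar_single_of_mem (h i)

theorem resRbar_φ (s : ξ.SA) : ξ.resRbar (ξ.φ s) = κ (ξ.resS s) := AlgHom.congr_fun ξ.comm s

theorem resS_eq_zero {s : ξ.SA} : ξ.resS s = 0 ↔ s ∈ (maximalIdeal ξ.A).map ξ.ι := by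
  rw [← ξ.closedFibre_SA.2, RingHom.mem_ker]

theorem mul_single (i : Fin r) (t : ∀ i, ξ.RbarA i) (s : ξ.RbarA i) :
    t * Pi.single i s = Pi.single i (t i * s) := by
  ext j
  by_cases hj : j = i
  · subst hj; simp
  · simp [hj]

end SecDef

end CurveDef

/-! ### The closed fibres of the summands are discrete valuation rings. -/

namespace CurveDef

open IsLocalRing CLAlg

namespace SecDef

variable {K : Type u} [Field K] {r : ℕ} {f : Fin r → PS K}

/-- The closed fibre of a summand. -/
noncomputable def fibre {S : Type u} [CommRing S] [Algebra K S] {κ : S →ₐ[K] Normalization f}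
    (ξ : SecDef f κ) (i : Fin r) : CLAlg K := quot (ξ.RbarA i) (ξ.mi i) (ξ.mi_ne_top i)

/-- The projection to the closed fibre of a summand. -/
noncomputable def toFibre {S : Type u} [CommRing S] [Algebra K S] {κ : S →ₐ[K] Normalization f}
    (ξ : SecDef f κ) (i : Fin r) : ξ.RbarA i →ₐ[K] ξ.fibre i := Ideal.Quotient.mkₐ K (ξ.mi i)

section

variable {S : Type u} [CommRing S] [Algebra K S] {κ : S →ₐ[K] Normalization f} (ξ : SecDef f κ)

theorem toFibre_surjective (i : Fin r) : Function.Surjective (ξ.toFibre i) :=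
  Ideal.Quotient.mk_surjective

theorem toFibre_eq_zero {i : Fin r} {s : ξ.RbarA i} : ξ.toFibre i s = 0 ↔ s ∈ ξ.mi i :=
  Ideal.Quotient.eq_zero_iff_mem

theorem toFibre_φi_eq_zero {i : Fin r} {s : ξ.SA} (hs : ξ.resS s = 0) :
    ξ.toFibre i (ξ.φi i s) = 0 := by
  rw [toFibre_eq_zero]
  refine ξ.mem_mi_of_mem (ξ.φ s) ?_ i
  rw [resRbar_φ, hs, map_zero]

/-- The closed fibre of a summand is a quotient of R̄, so the map factors as a surjection, followed
by κ, followed by a surjection. -/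
theorem isIntegral_toFibre (hκ : κ.toRingHom.IsIntegral) (i : Fin r) :
    ((ξ.toFibre i).comp (ξ.φi i)).toRingHom.IsIntegral := by
  let pr : (∀ i, ξ.RbarA i) →+* ξ.fibre i :=
    (ξ.toFibre i).toRingHom.comp (Pi.evalRingHom (fun j => (ξ.RbarA j : Type u)) i)
  have hker : RingHom.ker ξ.resRbar.toRingHom ≤ RingHom.ker pr := fun t ht =>
    ξ.toFibre_eq_zero.2 (ξ.mem_mi_of_mem t ht i)
  let ρ : Normalization f →+* ξ.fibre i :=
    RingHom.liftOfSurjective ξ.resRbar.toRingHom ξ.closedFibre_RbarA.1 ⟨pr, hker⟩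
  have hρ : ∀ t, ρ (ξ.resRbar t) = pr t := fun t =>
    RingHom.liftOfRightInverse_comp_apply _ _ _ ⟨pr, hker⟩ t
  have hρs : Function.Surjective ρ := fun y => by
    obtain ⟨s, rfl⟩ := ξ.toFibre_surjective i y
    refine ⟨ξ.resRbar (Pi.single i s), ?_⟩
    rw [hρ]
    change ξ.toFibre i (Pi.single (M := fun j => ξ.RbarA j) i s i) = _
    rw [Pi.single_eq_same]
  have h1 := RingHom.IsIntegral.trans _ _ (RingHom.isIntegral_of_surjective ξ.resS.toRingHom
    ξ.closedFibre_SA.1) (RingHom.IsIntegral.trans _ _ hκ (RingHom.isIntegral_of_surjective ρ hρs))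
  convert h1 using 1
  refine RingHom.ext fun s => ?_
  change ξ.toFibre i (ξ.φi i s) = ρ (κ (ξ.resS s))
  rw [← resRbar_φ, hρ]
  rfl

end

variable (ξ : ParDef f) {z w : PS K} (h : IsAdapted f z w)

include h

/-- The closed fibre of every summand is a discrete valuation ring. -/
theorem exists_parameter {z' w' : ξ.SA} (hz : ξ.resS z' = z) (hw : ξ.resS w' = w) (i : Fin r) :
    ∃ t : ξ.RbarA i, t ∈ maximalIdeal (ξ.RbarA i) ∧
      maximalIdeal (ξ.RbarA i) ≤ ξ.mi i ⊔ Ideal.span {t} ∧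
      (∀ x, t * x ∈ ξ.mi i → x ∈ ξ.mi i) ∧
      ∃ n, t ^ n ∈ ξ.mi i ⊔ Ideal.span {ξ.φi i z'} := by
  have memS : ∀ {p : ξ.SA}, ξ.resS p ∈ maximalIdeal (plane K) → p ∈ maximalIdeal ξ.SA :=
    fun hp => mem_of_map_mem (B := plane K) ξ.resS hp
  have hz' : z' ∈ maximalIdeal ξ.SA := memS (by rw [hz]; exact h.mem_z)
  set zO : ξ.fibre i := ξ.toFibre i (ξ.φi i z') with hzO
  have hzm : zO ∈ maximalIdeal (ξ.fibre i) := map_mem _ (map_mem _ hz')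
  have hZ : ∀ s, ξ.resRbar (Pi.single i (ξ.φi i z' * s)) =
      parMap f z * ξ.resRbar (Pi.single i s) := fun s => by
    rw [← hz, ← resRbar_φ, ← map_mul, mul_single]; rfl
  have hreg : ∀ x, zO * x = 0 → x = 0 := fun x hx => by
    obtain ⟨x, rfl⟩ := ξ.toFibre_surjective i x
    rw [hzO, ← map_mul, toFibre_eq_zero, ← resRbar_single_eq_zero, hZ] at hx
    rw [toFibre_eq_zero, ← resRbar_single_eq_zero]
    exact h.regular hx
  -- A prime containing z contracts to an ideal containing lifts of z and w, since wⁿ ∈ (z, f) and f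
  -- dies in R̄. The contraction is therefore maximal, and by integrality so is the prime.
  have hpow : ∃ n, maximalIdeal (ξ.fibre i) ^ n ≤ Ideal.span {zO} := by
    refine Ideal.exists_pow_le_of_le_radical_of_fg ?_ (IsNoetherian.noetherian _)
    rw [Ideal.radical_eq_sInf]
    refine le_sInf fun q ⟨hq, hqp⟩ => ?_
    suffices q.IsMaximal from (eq_maximalIdeal this).ge
    refine Ideal.isMaximal_of_isIntegral_of_isMaximal_comap'
      ((ξ.toFibre i).comp (ξ.φi i)).toRingHom (ξ.isIntegral_toFibre (isIntegral_parMap f) i) q ?_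
    suffices Ideal.comap ((ξ.toFibre i).comp (ξ.φi i)).toRingHom q = maximalIdeal ξ.SA by
      rw [this]; exact maximalIdeal.isMaximal _
    have hzq : ξ.toFibre i (ξ.φi i z') ∈ q := hq (Ideal.subset_span rfl)
    have hcong : ∀ p p' : ξ.SA, ξ.resS p = ξ.resS p' → ξ.toFibre i (ξ.φi i p') ∈ q →
        ξ.toFibre i (ξ.φi i p) ∈ q := fun p p' hpp hp' => by
      have h0 : ξ.resS (p - p') = 0 := by rw [map_sub, hpp, sub_self]
      have := ξ.toFibre_φi_eq_zero (i := i) h0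
      rw [map_sub, map_sub, sub_eq_zero] at this
      rwa [this]
    have hwq : ξ.toFibre i (ξ.φi i w') ∈ q := by
      obtain ⟨n, hn⟩ := h.pow
      obtain ⟨a, b, hab⟩ := Ideal.mem_span_pair.1 hn
      obtain ⟨a, rfl⟩ := ξ.closedFibre_SA.1 a
      refine hqp.mem_of_pow_mem n ?_
      have h1 : ξ.resRbar (ξ.φ (w' ^ n - a * z')) = 0 := by
        rw [resRbar_φ, parMap_eq_zero, map_sub, map_pow, map_mul, hz, hw, ← hab, add_sub_cancel_left]
        exact Dvd.intro_left b rfl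
      have h2 := ξ.toFibre_eq_zero.2 (ξ.mem_mi_of_mem _ h1 i)
      change ξ.toFibre i (ξ.φi i (w' ^ n - a * z')) = 0 at h2
      rw [map_sub, map_sub, sub_eq_zero, map_mul, map_mul, map_pow, map_pow] at h2
      rw [h2]
      exact Ideal.mul_mem_left _ _ hzq
    apply le_antisymm
    · exact le_maximalIdeal (Ideal.comap_ne_top _ hqp.ne_top)
    · intro p hp
      obtain ⟨a, b, hab⟩ := Ideal.mem_span_pair.1 (h.gen (map_mem (B := plane K) ξ.resS hp))
      obtain ⟨a, rfl⟩ := ξ.closedFibre_SA.1 a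
      obtain ⟨b, rfl⟩ := ξ.closedFibre_SA.1 b
      refine hcong p (a * z' + b * w') ?_ ?_
      · rw [map_add, map_mul, map_mul, hz, hw]; exact hab.symm
      · rw [map_add, map_add, map_mul, map_mul, map_mul, map_mul]
        exact Ideal.add_mem _ (Ideal.mul_mem_left _ _ hzq) (Ideal.mul_mem_left _ _ hwq)
  have hic : ∀ (b : ξ.fibre i) (c : ℕ → ξ.fibre i) (n : ℕ), n ≠ 0 →
      b ^ n + ∑ k ∈ Finset.range n, c k * zO ^ (n - k) * b ^ k = 0 → zO ∣ b := by
    intro b c n hn hb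
    obtain ⟨b, rfl⟩ := ξ.toFibre_surjective i b
    choose c' hc' using fun k => ξ.toFibre_surjective i (c k)
    -- Extension by zero from the summand into R̄ carries the equation to R̄, where z divides as
    -- soon as the quotient is integral. It is additive and multiplicative but does not preserve 1,
    -- so powers are treated only together with a further factor.
    let j : ξ.RbarA i → Normalization f := fun s => ξ.resRbar (Pi.single i s)
    have hj : ∀ s s', j (s * s') = j s * j s' := fun s s' => by
      simp only [j]; rw [Pi.single_mul, map_mul]
    have hja : ∀ s s', j (s + s') = j s + j s' := fun s s' => by
      simp only [j]; rw [Pi.single_add, map_add]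
    have hjs : ∀ (T : Finset ℕ) (g : ℕ → ξ.RbarA i), j (∑ k ∈ T, g k) = ∑ k ∈ T, j (g k) :=
      fun T g => by
        induction T using Finset.induction_on with
        | empty => simp [j]
        | insert a T ha ih => rw [Finset.sum_insert ha, Finset.sum_insert ha, hja, ih]
    have hjp : ∀ s k, j (s * b ^ k) = j s * j b ^ k := fun s k => by
      induction k with
      | zero => simp
      | succ k ih => rw [pow_succ, ← mul_assoc, hj, ih, pow_succ, mul_assoc]
    have hjz : ∀ s k, j (ξ.φi i z' ^ k * s) = parMap f z ^ k * j s := fun s k => by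
      induction k with
      | zero => simp
      | succ k ih => rw [pow_succ', mul_assoc, pow_succ', mul_assoc, ← ih]; exact hZ _
    have h1 : b ^ n + ∑ k ∈ Finset.range n, c' k * ξ.φi i z' ^ (n - k) * b ^ k ∈ ξ.mi i := by
      rw [← toFibre_eq_zero, map_add, map_pow, map_sum]
      simpa only [map_mul, map_pow, hc'] using hb
    rw [← resRbar_single_eq_zero] at h1
    change j _ = 0 at h1
    -- Positivity of the degree lets the leading term be read as b · b^m, so that j (b^0) never has
    -- to be computed.
    obtain ⟨m, rfl⟩ := Nat.exists_eq_succ_of_ne_zero hn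
    rw [hja, hjs, pow_succ', hjp, ← pow_succ'] at h1
    obtain ⟨d, hd⟩ := h.dvd_of_integral (j b) (fun k => j (c' k)) (m + 1) (by
      rw [← h1]
      congr 1
      refine Finset.sum_congr rfl fun k _ => ?_
      rw [hjp, mul_comm (c' k), hjz, mul_comm (j (c' k))])
    obtain ⟨d, rfl⟩ := ξ.closedFibre_RbarA.1 d
    refine ⟨ξ.toFibre i (d i), ?_⟩
    rw [hzO, ← map_mul, ← sub_eq_zero, ← map_sub, toFibre_eq_zero]
    have h2 : ξ.resRbar (Pi.single i b - ξ.φ z' * d) = 0 := by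
      rw [map_sub, map_mul, resRbar_φ, hz, sub_eq_zero]
      exact hd
    have h3 := ξ.mem_mi_of_mem _ h2 i
    rwa [Pi.sub_apply, Pi.single_eq_same, Pi.mul_apply] at h3
  obtain ⟨t, ht, hgen, htr⟩ := exists_regular_generator hzm hreg hpow hic
  obtain ⟨n, hn⟩ := hpow
  obtain ⟨t, rfl⟩ := ξ.toFibre_surjective i t
  refine ⟨t, mem_of_map_mem _ ht, fun x hx => ?_, fun x hx => ?_, n, ?_⟩
  · have hx' := map_mem (ξ.toFibre i) hx
    rw [hgen, Ideal.mem_span_singleton] at hx'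
    obtain ⟨y, hy⟩ := hx'
    obtain ⟨y, rfl⟩ := ξ.toFibre_surjective i y
    rw [← map_mul, ← sub_eq_zero, ← map_sub, toFibre_eq_zero] at hy
    rw [← sub_add_cancel x (t * y)]
    exact Ideal.add_mem _ (Ideal.mem_sup_left hy)
      (Ideal.mem_sup_right (Ideal.mul_mem_right _ _ (Ideal.subset_span rfl)))
  · rw [← toFibre_eq_zero] at hx ⊢
    rw [map_mul] at hx
    exact htr _ hx
  · have hx' := hn (Ideal.pow_mem_pow ht n)
    rw [Ideal.mem_span_singleton] at hx'
    obtain ⟨y, hy⟩ := hx'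
    obtain ⟨y, rfl⟩ := ξ.toFibre_surjective i y
    rw [hzO, ← map_pow, ← map_mul, ← sub_eq_zero, ← map_sub, toFibre_eq_zero] at hy
    rw [← sub_add_cancel (t ^ n) (ξ.φi i z' * y)]
    exact Ideal.add_mem _ (Ideal.mem_sup_left hy)
      (Ideal.mem_sup_right (Ideal.mul_mem_right _ _ (Ideal.subset_span rfl)))

end SecDef

end CurveDef

namespace CurveDef

open IsLocalRing CLAlg

/-! ### Weierstrass division -/

/-- Cayley–Hamilton for multiplication by w. -/
theorem exists_monic_aeval_eq_zero {R N : Type*} [CommRing R] [Nontrivial R] [CommRing N] [Algebra R N]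
    {n : ℕ} (e : Fin n → N) (he : ∀ x, ∃ c : Fin n → R, x = ∑ i, c i • e i) (w : N) :
    ∃ F : Polynomial R, F.Monic ∧ F.natDegree = n ∧ Polynomial.aeval w F = 0 := by
  have hspan : Submodule.span R (Set.range e) = ⊤ := by
    rw [eq_top_iff]
    intro x _
    obtain ⟨c, rfl⟩ := he x
    exact Submodule.sum_mem _ fun i _ => Submodule.smul_mem _ _ (Submodule.subset_span ⟨i, rfl⟩)
  have hfin : Module.Finite R N := ⟨⟨Set.finite_range e |>.toFinset, by simpa using hspan⟩⟩
  obtain ⟨F, hF, hd, h⟩ := LinearMap.exists_monic_and_natDegree_eq_and_aeval_eq_zero R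
    (Algebra.lmul R N w)
  have hn : F.natDegree ≤ n := by
    rw [hd, ← hspan]
    refine (Submodule.spanFinrank_span_le_ncard_of_finite (Set.finite_range e)).trans ?_
    rw [← Set.image_univ]
    refine (Set.ncard_image_le Set.finite_univ).trans ?_
    simp
  have h1 := LinearMap.congr_fun h 1
  rw [Polynomial.aeval_algHom_apply] at h1
  -- The degree obtained is the minimal number of generators; a power of X raises it to exactly n.
  refine ⟨F * Polynomial.X ^ (n - F.natDegree), hF.mul (Polynomial.monic_X_pow _), ?_, ?_⟩
  · rw [hF.natDegree_mul (Polynomial.monic_X_pow _), Polynomial.natDegree_X_pow,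
      Nat.add_sub_cancel' hn]
  · rw [map_mul, show Polynomial.aeval w F = 0 by simpa using h1, zero_mul]

namespace CLAlg

variable {K : Type u} [Field K]

/-- The t-adic expansion to order k modulo J: at each stage the residue in K of the remainder is
split off. -/
theorem exists_sub_sum_mem {S : CLAlg K} {J : Ideal S} {t : S}
    (h : maximalIdeal S ≤ J ⊔ Ideal.span {t}) (x : S) (k : ℕ) :
    ∃ (c : Fin k → K) (y : S), x - ∑ j, algebraMap K S (c j) * t ^ (j : ℕ) - t ^ k * y ∈ J := by
  induction k with
  | zero => exact ⟨0, x, by simp⟩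
  | succ k ih =>
    obtain ⟨c, y, hy⟩ := ih
    obtain ⟨a, ha, b, hb, hab⟩ := Submodule.mem_sup.1 (h (S.sub_res_mem y))
    obtain ⟨b, rfl⟩ := Ideal.mem_span_singleton.1 hb
    refine ⟨Fin.snoc c (S.res y), b, ?_⟩
    have := J.add_mem hy (J.mul_mem_left (t ^ k) ha)
    rw [Fin.sum_univ_castSucc]
    simp only [Fin.snoc_castSucc, Fin.snoc_last, Fin.val_castSucc, Fin.val_last]
    convert this using 1
    linear_combination -t ^ k * hab

/-- Weierstrass division: S / (F(w)) is generated over the complete ring L by the powers of w below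
the degree of F, because this holds modulo the maximal ideal of L. -/
theorem exists_sum_pow_of_monic {L S : CLAlg K} (θ : L →ₐ[K] S) {w : S}
    (hw : w ∈ maximalIdeal S) (hgen : maximalIdeal S ≤ (maximalIdeal L).map θ ⊔ Ideal.span {w})
    {F : Polynomial L} (hF : F.Monic) (p : S) :
    ∃ c : Fin F.natDegree → L, p - ∑ j, θ (c j) * w ^ (j : ℕ) ∈
      Ideal.span {F.eval₂ (θ : L →+* S) w} := by
  set J := Ideal.span {F.eval₂ (θ : L →+* S) w} with hJ
  by_cases hJt : J = ⊤
  · exact ⟨0, by rw [hJt]; trivial⟩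
  let d := F.natDegree
  let F₀ : Polynomial K := F.map (L.res : L →+* K)
  have hF₀ : F₀.Monic := hF.map _
  have hcong : F.eval₂ (θ : L →+* S) w - Polynomial.aeval w F₀ ∈ (maximalIdeal L).map θ := by
    rw [Polynomial.aeval_def, Polynomial.eval₂_map, Polynomial.eval₂_eq_sum, Polynomial.eval₂_eq_sum,
      Polynomial.sum, Polynomial.sum, ← Finset.sum_sub_distrib]
    refine Ideal.sum_mem _ fun j _ => ?_
    rw [← sub_mul]
    refine Ideal.mul_mem_right _ _ ?_
    have := Ideal.mem_map_of_mem θ (L.sub_res_mem (F.coeff j))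
    rw [map_sub, AlgHom.commutes] at this
    exact this
  -- Modulo the maximal ideal of L, F becomes F₀ = X^k q over K with q(0) ≠ 0. Since w is not a
  -- unit, q(w) is one; so w^k, and then w^d, lies in the ideal.
  have hpow : w ^ d ∈ (maximalIdeal L).map θ ⊔ J := by
    obtain ⟨q, hq, hq0⟩ := Polynomial.exists_eq_pow_rootMultiplicity_mul_and_not_dvd F₀ hF₀.ne_zero 0
    rw [Polynomial.C_0, sub_zero] at hq hq0
    set k := F₀.rootMultiplicity 0
    have hk : k ≤ d := by
      have h1 := Polynomial.natDegree_le_of_dvd (Dvd.intro q hq.symm) hF₀.ne_zero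
      rw [Polynomial.natDegree_X_pow] at h1
      exact h1.trans_eq (hF.natDegree_map _)
    have hqu : IsUnit (Polynomial.aeval w q) := by
      by_contra hn
      have h1 : Polynomial.aeval w q ∈ maximalIdeal S := (mem_maximalIdeal _).2 hn
      rw [Polynomial.X_dvd_iff] at hq0
      have h2 : Polynomial.aeval w q - algebraMap K S (q.coeff 0) ∈ maximalIdeal S := by
        obtain ⟨b, hb⟩ : Polynomial.X ∣ q - Polynomial.C (q.coeff 0) := by
          rw [Polynomial.X_dvd_iff]; simp
        have := congrArg (Polynomial.aeval w) hb
        rw [map_sub, Polynomial.aeval_C, map_mul, Polynomial.aeval_X] at this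
        rw [this]
        exact Ideal.mul_mem_right _ _ hw
      have h3 := Ideal.sub_mem _ h1 h2
      rw [sub_sub_cancel] at h3
      exact (mem_maximalIdeal _).1 h3 ((IsUnit.mk0 _ hq0).map _)
    obtain ⟨v, hv⟩ := hqu.exists_right_inv
    have h1 : Polynomial.aeval w F₀ ∈ (maximalIdeal L).map θ ⊔ J := by
      have := Ideal.sub_mem _ (Ideal.mem_sup_right (Ideal.subset_span rfl : _ ∈ J))
        (Ideal.mem_sup_left (T := J) hcong)
      rwa [sub_sub_cancel] at this
    rw [hq, map_mul, map_pow, Polynomial.aeval_X] at h1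
    have h2 := Ideal.mul_mem_right (v * w ^ (d - k)) _ h1
    have h3 : w ^ k * Polynomial.aeval w q * (v * w ^ (d - k)) = w ^ d := by
      calc _ = w ^ (k + (d - k)) * (Polynomial.aeval w q * v) := by rw [pow_add]; ring
        _ = _ := by rw [hv, mul_one, Nat.add_sub_cancel' hk]
    rwa [h3] at h2
  let π : S →ₐ[K] quot S J hJt := Ideal.Quotient.mkₐ K J
  have hπs : Function.Surjective π := Ideal.Quotient.mk_surjective
  have hπ : ∀ {x}, π x = 0 ↔ x ∈ J := Ideal.Quotient.eq_zero_iff_mem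
  let _ : Algebra L (quot S J hJt) := (π.comp θ).toRingHom.toAlgebra
  have : IsHausdorff (maximalIdeal L) (quot S J hJt) := isHausdorff_of_hom (π.comp θ)
  have hsm : ∀ (a : L) (x : S), a • π x = π (θ a * x) := fun a x => by
    rw [map_mul]; rfl
  obtain ⟨c, hc⟩ := span_eq_top_of_isPrecomplete (maximalIdeal L)
    (fun j : Fin d => π (w ^ (j : ℕ))) (fun y => by
      obtain ⟨x, rfl⟩ := hπs y
      obtain ⟨c, y, hy⟩ := exists_sub_sum_mem hgen x d
      refine ⟨fun j => algebraMap K L (c j), ?_⟩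
      simp only [hsm, AlgHom.commutes]
      rw [← map_sum, ← map_sub, Ideal.smul_top_eq_map]
      have h1 : x - ∑ j, algebraMap K S (c j) * w ^ (j : ℕ) ∈ (maximalIdeal L).map θ ⊔ J := by
        have := Ideal.add_mem _ (Ideal.mem_sup_left (T := J) hy) (Ideal.mul_mem_right y _ hpow)
        rwa [sub_add_cancel] at this
      obtain ⟨a, ha, b, hb, hab⟩ := Submodule.mem_sup.1 h1
      rw [← hab, map_add, hπ.2 hb, add_zero]
      have := Ideal.mem_map_of_mem π ha
      rw [Ideal.map_mapₐ] at this
      exact this) (π p)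
  refine ⟨c, ?_⟩
  rw [← hπ, map_sub, hc, map_sum, sub_eq_zero]
  exact Finset.sum_congr rfl fun j _ => hsm _ _

end CLAlg

/-- Over a domain, a family spanning a module of full rank is independent as soon as its cardinality
does not exceed the rank. -/
theorem linearIndependent_of_mul_mem_span {R N : Type*} [CommRing R] [IsDomain R] [CommRing N]
    [Algebra R N] {ι : Type*} [Fintype ι] (b : ι → N) (hcard : Fintype.card ι ≤ Module.finrank R N)
    (s : N) (hs : ∀ x, s * x = 0 → x = 0)
    (h : ∀ x, s * x ∈ Submodule.span R (Set.range b)) : LinearIndependent R b := by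
  rw [linearIndependent_iff_card_le_finrank_span]
  refine hcard.trans ?_
  have : Module.Finite R (Submodule.span R (Set.range b)) :=
    Module.Finite.span_of_finite R (Set.finite_range b)
  refine LinearMap.finrank_le_finrank_of_injective
    (f := (LinearMap.mulLeft R s).codRestrict (Submodule.span R (Set.range b)) h) ?_
  rw [← LinearMap.ker_eq_bot, LinearMap.ker_eq_bot']
  intro x hx
  exact hs x (congrArg Subtype.val hx)

end CurveDef

/-! ### Finiteness of the normalization over a power series ring in one variable. -/

namespace CurveDef

open IsLocalRing CLAlg

section Finite

variable {K : Type u} [Field K] {r : ℕ}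

theorem single_mem_map {L : CLAlg K} {B : Fin r → CLAlg K} (G : L →ₐ[K] (∀ i, B i)) {J : Ideal L}
    {i : Fin r} {s : B i}
    (hs : s ∈ J.map ((Pi.evalAlgHom K (fun j => (B j : Type u)) i).comp G)) :
    Pi.single (M := fun j => (B j : Type u)) i s ∈ J.map G := by
  induction hs using Submodule.span_induction with
  | mem x hx =>
    obtain ⟨a, ha, rfl⟩ := hx
    have : Pi.single (M := fun j => (B j : Type u)) i (G a i) =
        G a * Pi.single (M := fun j => (B j : Type u)) i 1 := by
      ext j
      by_cases hj : j = i
      · subst hj; simp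
      · simp [hj]
    change Pi.single (M := fun j => (B j : Type u)) i (G a i) ∈ _
    rw [this]
    exact Ideal.mul_mem_right _ _ (Ideal.mem_map_of_mem G ha)
  | zero => rw [Pi.single_zero]; exact zero_mem _
  | add x y _ _ hx hy => rw [Pi.single_add]; exact add_mem hx hy
  | smul a x _ hx => rw [smul_eq_mul, Pi.single_mul]; exact Ideal.mul_mem_left _ _ hx

theorem mem_map_of_forall {L : CLAlg K} {B : Fin r → CLAlg K} (G : L →ₐ[K] (∀ i, B i))
    {J : Ideal L} {x : ∀ i, B i}
    (hx : ∀ i, x i ∈ J.map ((Pi.evalAlgHom K (fun j => (B j : Type u)) i).comp G)) :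
    x ∈ J.map G := by
  rw [← Finset.univ_sum_single x]
  exact Ideal.sum_mem _ fun i _ => single_mem_map G (hx i)

/-- Nakayama over the complete ring L; the product is separated because each factor is and all
components of G are local. -/
theorem generates_of_mod {L : CLAlg K} {B : Fin r → CLAlg K} (G : L →ₐ[K] (∀ i, B i)) {n : ℕ}
    (e : Fin n → ∀ i, B i)
    (h : ∀ x, ∃ c : Fin n → L, x - ∑ k, G (c k) * e k ∈ (maximalIdeal L).map G) (x : ∀ i, B i) :
    ∃ c : Fin n → L, x = ∑ k, G (c k) * e k := by
  let _ : Algebra L (∀ i, B i) := G.toRingHom.toAlgebra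
  have : IsHausdorff (maximalIdeal L) (∀ i, B i) := by
    refine ⟨fun x hx => funext fun i => eq_zero_of_forall_mem_pow fun n => ?_⟩
    have h1 := hx n
    rw [SModEq.zero, Ideal.smul_top_eq_map] at h1
    have h2 := Ideal.mem_map_of_mem (Pi.evalAlgHom K (fun j => (B j : Type u)) i) h1
    refine (?_ : Ideal.map _ (Ideal.map (algebraMap L (∀ i, B i)) _) ≤ _) h2
    rw [Ideal.map_le_iff_le_comap, Ideal.map_le_iff_le_comap]
    exact Ideal.le_comap_pow
      ((Pi.evalAlgHom K (fun j => (B j : Type u)) i).comp G) n |>.trans' (Ideal.pow_right_mono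
      (fun a ha => map_mem ((Pi.evalAlgHom K (fun j => (B j : Type u)) i).comp G) ha) n)
  refine span_eq_top_of_isPrecomplete (maximalIdeal L) e (fun x => ?_) x
  obtain ⟨c, hc⟩ := h x
  refine ⟨c, ?_⟩
  rw [Ideal.smul_top_eq_map]
  exact hc

/-- Generators are the powers of t i below a bound, each placed in its summand. The sum of the
exponents serves as a bound common to all summands. -/
theorem exists_generators {L : CLAlg K} {B : Fin r → CLAlg K} (G : L →ₐ[K] (∀ i, B i))
    (t : ∀ i, B i)
    (hgen : ∀ i, maximalIdeal (B i) ≤ (maximalIdeal L).map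
      ((Pi.evalAlgHom K (fun j => (B j : Type u)) i).comp G) ⊔ Ideal.span {t i})
    (hpow : ∀ i, ∃ n, t i ^ n ∈ (maximalIdeal L).map
      ((Pi.evalAlgHom K (fun j => (B j : Type u)) i).comp G)) :
    ∃ (n : ℕ) (e : Fin n → ∀ i, B i), ∀ x, ∃ c : Fin n → L, x = ∑ k, G (c k) * e k := by
  choose n hn using hpow
  let N := ∑ i, n i
  have hN : ∀ i, t i ^ N ∈ (maximalIdeal L).map
      ((Pi.evalAlgHom K (fun j => (B j : Type u)) i).comp G) := fun i =>
    Ideal.pow_mem_of_pow_mem _ (hn i) (Finset.single_le_sum (f := n) (fun _ _ => Nat.zero_le _)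
      (Finset.mem_univ i))
  let e : Fin r × Fin N → ∀ i, B i := fun k => Pi.single k.1 (t k.1 ^ (k.2 : ℕ))
  refine ⟨r * N, fun k => e (finProdFinEquiv.symm k), ?_⟩
  refine generates_of_mod G _ fun x => ?_
  choose c y hy using fun i => exists_sub_sum_mem (hgen i) (x i) N
  refine ⟨fun k => algebraMap K L (c (finProdFinEquiv.symm k).1 (finProdFinEquiv.symm k).2), ?_⟩
  refine mem_map_of_forall G fun i => ?_
  rw [← finProdFinEquiv.sum_comp, Fintype.sum_prod_type]
  simp only [Equiv.symm_apply_apply, AlgHom.commutes]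
  rw [Pi.sub_apply, Finset.sum_apply, Finset.sum_eq_single i]
  · simp only [e, Finset.sum_apply, Pi.mul_apply, Pi.single_eq_same]
    have := Ideal.add_mem _ (hy i) (Ideal.mul_mem_right (y i) _ (hN i))
    rw [sub_add_cancel] at this
    exact this
  · intro j _ hj
    simp [e, Ne.symm hj]
  · simp

/-- A finitely generated torsion free algebra over `K[[t]]`: a basis, and a criterion for powers of
an element to be independent. -/
theorem exists_basis_line {N : Type u} [CommRing N] [Algebra K N] (G : line K →ₐ[K] N) {m : ℕ}
    (e : Fin m → N) (he : ∀ x, ∃ c : Fin m → line K, x = ∑ k, G (c k) * e k)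
    (htf : ∀ x, G lvar * x = 0 → x = 0) :
    ∃ (n : ℕ) (b : Fin n → N), (∀ x, ∃ c : Fin n → line K, x = ∑ k, G (c k) * b k) ∧
      ∀ (b' : Fin n → N) (s : N), (∀ x, s * x = 0 → x = 0) →
        (∀ x, ∃ c : Fin n → line K, s * x = ∑ k, G (c k) * b' k) →
        ∀ c : Fin n → line K, ∑ k, G (c k) * b' k = 0 → c = 0 := by
  let _ : Algebra (line K) N := G.toRingHom.toAlgebra
  have hsm : ∀ (a : line K) (x : N), a • x = G a * x := fun _ _ => rfl
  have hfin : Module.Finite (line K) N := by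
    refine ⟨⟨(Set.finite_range e).toFinset, ?_⟩⟩
    rw [eq_top_iff]
    intro x _
    obtain ⟨c, rfl⟩ := he x
    exact Submodule.sum_mem _ fun i _ => Submodule.smul_mem _ _ (Submodule.subset_span (by simp))
  have htf' : Module.IsTorsionFree (line K) N := by
    rw [Module.isTorsionFree_iff_smul_eq_zero]
    intro a x hax
    by_contra hcon
    rw [not_or] at hcon
    obtain ⟨k, v, hv, rfl⟩ := exists_eq_pow_mul_unit hcon.1
    refine hcon.2 ?_
    rw [hsm, map_mul, mul_assoc] at hax
    have h1 : ∀ (k : ℕ) (y : N), G (lvar ^ k) * y = 0 → y = 0 := fun k => by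
      induction k with
      | zero => intro y hy; simpa using hy
      | succ k ih =>
        intro y hy
        rw [pow_succ, map_mul, mul_assoc] at hy
        exact htf _ (ih _ hy)
    exact (hv.map G).mul_right_eq_zero.1 (h1 k _ hax)
  have : Module.Free (line K) N := inferInstance
  let b := Module.finBasis (line K) N
  refine ⟨_, b, fun x => ⟨b.repr x, (b.sum_repr x).symm⟩, fun b' s hs h => ?_⟩
  -- Multiplication by the regular element s embeds N into the span of b', which therefore has full
  -- rank n; n elements spanning rank n are independent.
  have hind := linearIndependent_of_mul_mem_span (R := line K) b'
    (Fintype.card_fin _).le s hs fun x => by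
    obtain ⟨c, hc⟩ := h x
    rw [hc]
    exact Submodule.sum_mem _ fun i _ => Submodule.smul_mem _ _ (Submodule.subset_span ⟨i, rfl⟩)
  intro c hc
  exact funext (Fintype.linearIndependent_iff.1 hind c hc)

/-- A finitely generated extension of `R` inside `R̄` has a common denominator. -/
theorem exists_denominator {f : Fin r → PS K} {L : Type u} [CommRing L] (G : L → PS K) {m : ℕ}
    (e : Fin m → Normalization f)
    (he : ∀ x, ∃ c : Fin m → L, x = ∑ k, parMap f (G (c k)) * e k) :
    ∃ s, (∀ x, parMap f s * x = 0 → x = 0) ∧ ∀ x, ∃ p, parMap f s * x = parMap f p := by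
  obtain ⟨s, hs⟩ := IsLocalization.exist_integer_multiples_of_finite
    (nonZeroDivisors (CurveRing f)) (S := FractionRing (CurveRing f)) (fun k => (e k).1)
  obtain ⟨s', hs'⟩ := projMap_surjective f s.1
  have hval : ∀ p, (parMap f p).1 = algebraMap (CurveRing f) (FractionRing (CurveRing f))
    (projMap f p) := fun p => rfl
  refine ⟨s', fun x hx => ?_, fun x => ?_⟩
  · have h1 : (parMap f s').1 * x.1 = 0 := congrArg Subtype.val hx
    rw [hval, hs'] at h1
    exact Subtype.ext ((IsLocalization.map_units _ s).mul_right_eq_zero.1 h1)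
  · have h1 : ∀ k, ∃ p, parMap f s' * e k = parMap f p := fun k => by
      obtain ⟨p, hp⟩ := hs k
      obtain ⟨p, rfl⟩ := projMap_surjective f p
      refine ⟨p, Subtype.ext ?_⟩
      change (parMap f s').1 * (e k).1 = _
      rw [hval, hval, hp, hs', Algebra.smul_def]
    choose p hp using h1
    obtain ⟨c, rfl⟩ := he x
    refine ⟨∑ k, G (c k) * p k, ?_⟩
    rw [Finset.mul_sum, map_sum]
    refine Finset.sum_congr rfl fun k _ => ?_
    rw [mul_left_comm, hp, map_mul]

end Finite

end CurveDef

/-! ### The equation of the deformed curve. -/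

namespace CurveDef

open IsLocalRing CLAlg

namespace CLAlg

variable {K : Type u} [Field K] {σ : Type} [Finite σ]

variable (σ) in
/-- The reduction of coefficients `A[[σ]] → K[[σ]]`. -/
noncomputable def reduction (A : CLAlg K) : pow σ A →ₐ[K] pow σ (base K) :=
  MvPowerSeries.mapAlgHom A.res

variable {A : CLAlg K}

theorem res_map {B : CLAlg K} (g : A →ₐ[K] B) (a : A) : B.res (g a) = A.res a := by
  have h := map_mem g (A.sub_res_mem a)
  rw [← res_eq_zero, map_sub, map_sub, AlgHom.commutes, AlgHom.commutes, sub_eq_zero] at h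
  exact h

theorem reduction_constHom (a : A) :
    reduction σ A (constHom σ A a) = algebraMap K _ (A.res a) :=
  (MvPowerSeries.map_C _ _).trans rfl

theorem reduction_var (i : σ) : reduction σ A (A.var i) = (base K).var i := MvPowerSeries.map_X _ _

theorem reduction_eq_zero {p : pow σ A} :
    reduction σ A p = 0 ↔ p ∈ (maximalIdeal A).map (constHom σ A) := by
  refine ⟨fun hp => mem_map_maximalIdeal_pow fun d => ?_, fun hp => ?_⟩
  · rw [← res_eq_zero]
    exact (MvPowerSeries.coeff_map (A.res : A →+* K) d p).symm.trans
      (congrArg (MvPowerSeries.coeff d) hp)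
  · refine MvPowerSeries.ext fun d => ?_
    exact (MvPowerSeries.coeff_map (A.res : A →+* K) d p).trans
      (res_eq_zero.2 (coeff_mem_of_mem_map hp d))

theorem isClosedFibre_reduction : IsClosedFibre (constHom σ A) (reduction σ A) := by
  refine ⟨fun p => ⟨(MvPowerSeries.mapAlgHom (Algebra.ofId K A) :
    pow σ (base K) →ₐ[K] pow σ A) p, ?_⟩, Ideal.ext fun p => reduction_eq_zero⟩
  have : (reduction σ A).comp (MvPowerSeries.mapAlgHom (Algebra.ofId K A) :
      pow σ (base K) →ₐ[K] pow σ A) = AlgHom.id K (pow σ (base K)) := hom_ext_base fun i => by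
    rw [AlgHom.comp_apply]
    exact (congrArg (reduction σ A) (MvPowerSeries.map_X _ _)).trans (reduction_var i)
  exact AlgHom.congr_fun this p

end CLAlg

namespace SecDef

variable {K : Type u} [Field K] {r : ℕ} {f : Fin r → PS K}

section

variable {S : Type u} [CommRing S] [Algebra K S] {κ : S →ₐ[K] Normalization f} (ξ : SecDef f κ)

theorem flat_φ_ι : (ξ.φ.comp ξ.ι).toRingHom.Flat := by
  let _ : ∀ i, Algebra ξ.A (ξ.RbarA i) := fun i => (ξ.ιi i).toRingHom.toAlgebra
  have : ∀ i, Module.Flat ξ.A (ξ.RbarA i) := ξ.flat_ιi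
  have h : Module.Flat ξ.A (∀ i, ξ.RbarA i) :=
    Module.Flat.of_linearEquiv (DFinsupp.linearEquivFunOnFintype (R := ξ.A)
      (M := fun i => ξ.RbarA i)).symm
  have h2 : (algebraMap ξ.A (∀ i, ξ.RbarA i)).Flat := (RingHom.flat_algebraMap_iff).2 h
  exact h2

theorem resS_ι (a : ξ.A) : ξ.resS (ξ.ι a) = algebraMap K S (ξ.A.res a) := by
  rw [← AlgHom.commutes ξ.resS, ← AlgHom.commutes ξ.ι, ← sub_eq_zero, ← map_sub, ← map_sub,
    resS_eq_zero]
  exact Ideal.mem_map_of_mem _ (ξ.A.sub_res_mem a)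

end

variable (ξ : ParDef f)

/-- Over the ring `A[[z]]`, the deformed branches span a free module with a basis consisting of
the first powers of `w`. -/
theorem exists_relation {z w : PS K} (h : IsAdapted f z w) {z' w' : ξ.SA} (hz : ξ.resS z' = z)
    (hw : ξ.resS w' = w) : ∃ (L : CLAlg K) (γ : ξ.A →ₐ[K] L) (θ : L →ₐ[K] ξ.SA) (n : ℕ) (v : ξ.SA),
      γ.toRingHom.Flat ∧ (∀ a, θ (γ a) = ξ.ι a) ∧ ξ.φ v = 0 ∧
      (∀ p, ∃ c : Fin n → L, p - ∑ k, θ (c k) * w' ^ (k : ℕ) ∈ Ideal.span {v}) ∧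
      ∀ c : Fin n → L, ξ.resRbar (ξ.φ (∑ k, θ (c k) * w' ^ (k : ℕ))) = 0 →
        ∀ k, c k ∈ (maximalIdeal ξ.A).map γ := by
  have hz' : z' ∈ maximalIdeal ξ.SA := mem_of_map_mem (B := plane K) ξ.resS (by
    rw [hz]; exact h.mem_z)
  have hw' : w' ∈ maximalIdeal ξ.SA := mem_of_map_mem (B := plane K) ξ.resS (by
    rw [hw]; exact h.mem_w)
  -- L is A[[z]], mapped to P_A by a lift z' of z; on closed fibres this becomes K[[z]] → K[[x, y]].
  let L := pow Unit ξ.A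
  let θ : L →ₐ[K] ξ.SA := ev ξ.ι (fun _ => z') fun _ => hz'
  have hθι : ∀ a, θ (constHom Unit ξ.A a) = ξ.ι a := fun a => ev_constHom _ _ _ a
  have hθz : θ (ξ.A.var ()) = z' := ev_var _ _ _ ()
  let θ₀ : line K →ₐ[K] plane K := ev (A := base K) (Algebra.ofId K (plane K)) (fun _ => z)
    fun _ => h.mem_z
  have hθ₀ : θ₀ lvar = z := ev_ofId_var _ _ ()
  have hred : ∀ c, ξ.resS (θ c) = θ₀ (reduction Unit ξ.A c) := fun c => by
    have : (ξ.resS : ξ.SA →ₐ[K] plane K).comp θ = θ₀.comp (reduction Unit ξ.A) := by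
      refine hom_ext_pow (σ := Unit) (A := ξ.A) (C := plane K) (fun a => ?_) fun i => ?_
      · rw [AlgHom.comp_apply, AlgHom.comp_apply, reduction_constHom, hθι]
        exact (ξ.resS_ι a).trans (AlgHom.commutes θ₀ _).symm
      · rw [AlgHom.comp_apply, AlgHom.comp_apply]
        exact (congrArg ξ.resS hθz).trans (hz.trans (hθ₀.symm.trans (congrArg θ₀ (reduction_var ()).symm)))
    exact AlgHom.congr_fun this c
  let G : L →ₐ[K] (∀ i, ξ.RbarA i) := ξ.φ.comp θ
  let G₀ : line K →ₐ[K] Normalization f := (parMap f).comp θ₀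
  have hG : ∀ c, ξ.resRbar (G c) = G₀ (reduction Unit ξ.A c) := fun c => by
    change ξ.resRbar (ξ.φ (θ c)) = parMap f (θ₀ (reduction Unit ξ.A c))
    rw [resRbar_φ, hred]
  have hmι : (maximalIdeal ξ.A).map ξ.ι ≤ (maximalIdeal L).map θ := by
    rw [Ideal.map_le_iff_le_comap]
    intro a ha
    rw [Ideal.mem_comap, ← hθι]
    exact Ideal.mem_map_of_mem _ (map_mem _ ha)
  have hmL : (maximalIdeal ξ.A).map (ξ.φ.comp ξ.ι) ≤ (maximalIdeal L).map G := by
    have := Ideal.map_mono (f := ξ.φ) hmι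
    rwa [Ideal.map_mapₐ, Ideal.map_mapₐ] at this
  have hzL : z' ∈ (maximalIdeal L).map θ := by
    rw [← hθz]; exact Ideal.mem_map_of_mem _ (var_mem ξ.A ())
  choose t _ htgen _ htpow using ξ.exists_parameter h hz hw
  have hmi : ∀ i, ξ.mi i ⊔ Ideal.span {ξ.φi i z'} ≤
      (maximalIdeal L).map ((Pi.evalAlgHom K (fun j => (ξ.RbarA j : Type u)) i).comp G) := by
    intro i
    refine sup_le ?_ ?_
    · have := Ideal.map_mono (f := Pi.evalAlgHom K (fun j => (ξ.RbarA j : Type u)) i) hmL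
      rwa [Ideal.map_mapₐ, Ideal.map_mapₐ] at this
    · rw [Ideal.span_singleton_le_iff_mem]
      have := Ideal.mem_map_of_mem (ξ.φi i) hzL
      rwa [Ideal.map_mapₐ] at this
  obtain ⟨m, e, he⟩ := exists_generators G t (fun i => (htgen i).trans (sup_le_sup_right
    (le_sup_left.trans (hmi i)) _)) (fun i => (htpow i).imp fun n hn => hmi i hn)
  -- n is the rank of R̄ over K[[z]], which is torsion free because z is regular on R̄. Lifts of the
  -- basis b will generate R̄_A over L with the same number of elements.
  obtain ⟨n, b, hb, hind⟩ := exists_basis_line G₀ (fun k => ξ.resRbar (e k)) (fun x => by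
    obtain ⟨x, rfl⟩ := ξ.closedFibre_RbarA.1 x
    obtain ⟨c, rfl⟩ := he x
    refine ⟨fun k => reduction Unit ξ.A (c k), ?_⟩
    simp only [map_sum, map_mul, hG]) (fun x hx => h.regular (by
      rw [← hx, ← hθ₀]; rfl))
  choose b' hb' using fun k => ξ.closedFibre_RbarA.1 (b k)
  have hgen := generates_of_mod G b' fun x => by
    obtain ⟨c, hc⟩ := hb (ξ.resRbar x)
    choose c' hc' using fun k => isClosedFibre_reduction.1 (c k)
    refine ⟨c', hmL ?_⟩
    rw [← ξ.closedFibre_RbarA.2, RingHom.mem_ker, map_sub, hc, map_sum, sub_eq_zero]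
    refine Finset.sum_congr rfl fun k _ => ?_
    rw [map_mul, hG, hc', hb']
  let _ : Algebra L (∀ i, ξ.RbarA i) := G.toRingHom.toAlgebra
  -- The equation v = F(w') is the characteristic relation of w' on R̄_A; its degree has to equal
  -- the rank n for the count of independent powers below.
  obtain ⟨F, hF, hn, hFw⟩ := exists_monic_aeval_eq_zero (R := L) b' hgen (ξ.φ w')
  have hgenS : maximalIdeal ξ.SA ≤ (maximalIdeal L).map θ ⊔ Ideal.span {w'} := by
    intro p hp
    obtain ⟨a, c, hac⟩ := Ideal.mem_span_pair.1 (h.gen (map_mem (B := plane K) ξ.resS hp))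
    obtain ⟨a, rfl⟩ := ξ.closedFibre_SA.1 a
    obtain ⟨c, rfl⟩ := ξ.closedFibre_SA.1 c
    have h1 : p - (a * z' + c * w') ∈ (maximalIdeal L).map θ := by
      refine hmι (ξ.resS_eq_zero.1 ?_)
      rw [map_sub, map_add, map_mul, map_mul, hz, hw, sub_eq_zero]
      exact hac.symm
    rw [← sub_add_cancel p (a * z' + c * w')]
    exact Ideal.add_mem _ (Ideal.mem_sup_left h1) (Ideal.add_mem _
      (Ideal.mem_sup_left (Ideal.mul_mem_left _ _ hzL))
      (Ideal.mem_sup_right (Ideal.mul_mem_left _ _ (Ideal.subset_span rfl))))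
  have hφv : ξ.φ (F.eval₂ (θ : L →+* ξ.SA) w') = 0 := by
    rw [← hFw, Polynomial.aeval_def]
    exact Polynomial.hom_eval₂ F (θ : L →+* ξ.SA) (ξ.φ : ξ.SA →+* (∀ i, ξ.RbarA i)) w'
  have hspan : ∀ p, ∃ c : Fin n → L, p - ∑ k, θ (c k) * w' ^ (k : ℕ) ∈
      Ideal.span {F.eval₂ (θ : L →+* ξ.SA) w'} := by
    subst hn
    exact exists_sum_pow_of_monic θ hw' hgenS hF
  have hsum : ∀ c : Fin n → L, ξ.resRbar (ξ.φ (∑ k, θ (c k) * w' ^ (k : ℕ))) =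
      ∑ k, G₀ (reduction Unit ξ.A (c k)) * parMap f w ^ (k : ℕ) := fun c => by
    rw [map_sum, map_sum]
    refine Finset.sum_congr rfl fun k _ => ?_
    rw [map_mul, map_mul, map_pow, map_pow, ξ.resRbar_φ w', hw]
    exact congrArg (· * _) (hG (c k))
  refine ⟨L, constHom Unit ξ.A, θ, n, _, flat_constHom _, hθι, hφv, hspan, fun c hc k => reduction_eq_zero.1 ?_⟩
  rw [hsum] at hc
  -- By division the n powers of w span R over K[[z]], and s R̄ ⊆ R; so they are independent, and a
  -- relation on the closed fibre forces all coefficients to reduce to zero.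
  obtain ⟨s, hs, hs'⟩ := exists_denominator (f := f) θ₀ b hb
  refine congrFun (hind (fun k => parMap f w ^ (k : ℕ)) (parMap f s) hs (fun x => ?_)
    (fun k => reduction Unit ξ.A (c k)) hc) k
  obtain ⟨p, hp⟩ := hs' x
  obtain ⟨p, rfl⟩ := ξ.closedFibre_SA.1 p
  obtain ⟨c, hc⟩ := hspan p
  obtain ⟨y, hy⟩ := Ideal.mem_span_singleton.1 hc
  refine ⟨fun k => reduction Unit ξ.A (c k), ?_⟩
  rw [← hsum, hp, ← resRbar_φ, ← sub_eq_zero, ← map_sub, ← map_sub, hy, map_mul, hφv, zero_mul,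
    map_zero]

/-- The equation of the deformed curve. -/
theorem ker_φ (hf : ∀ i, f i ≠ 0) :
    (RingHom.ker ξ.φ).IsPrincipal ∧
    ((Ideal.Quotient.mkₐ K (RingHom.ker ξ.φ)).comp ξ.ι).toRingHom.Flat ∧
    ∀ x, (∏ i, f i) ∣ ξ.resS x → x ∈ (maximalIdeal ξ.A).map ξ.ι ⊔ RingHom.ker ξ.φ := by
  obtain ⟨z, w, h⟩ := exists_isAdapted hf
  obtain ⟨z', hz⟩ := ξ.closedFibre_SA.1 z
  obtain ⟨w', hw⟩ := ξ.closedFibre_SA.1 w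
  obtain ⟨L, γ, θ, n, v, hγ, hθι, hv, hspan, hind⟩ := ξ.exists_relation h hz hw
  let _ : Algebra ξ.A L := γ.toRingHom.toAlgebra
  have hLflat : Module.Flat ξ.A L := hγ
  let _ : Algebra ξ.A ξ.SA := ξ.ι.toRingHom.toAlgebra
  let _ : Algebra ξ.A (∀ i, ξ.RbarA i) := (ξ.φ.comp ξ.ι).toRingHom.toAlgebra
  have hMflat : Module.Flat ξ.A (∀ i, ξ.RbarA i) := ξ.flat_φ_ι
  have hsm : ∀ (a : ξ.A) (p : L), θ (a • p) = a • θ p := fun a p => by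
    have : a • p = γ a * p := rfl
    rw [this, map_mul, hθι]; rfl
  let q : (Fin n → L) →ₗ[ξ.A] ξ.SA :=
    { toFun := fun c => ∑ k, θ (c k) * w' ^ (k : ℕ)
      map_add' := fun c d => by simp only [Pi.add_apply, map_add, add_mul, Finset.sum_add_distrib]
      map_smul' := fun a c => by
        simp only [Pi.smul_apply, hsm, smul_mul_assoc, Finset.smul_sum, RingHom.id_apply] }
  let φ' : ξ.SA →ₐ[ξ.A] (∀ i, ξ.RbarA i) := { toRingHom := ξ.φ.toRingHom, commutes' := fun a => rfl }
  have hmem : ∀ c : Fin n → L, (∀ k, c k ∈ (maximalIdeal ξ.A).map (γ)) →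
      c ∈ (maximalIdeal ξ.A • ⊤ : Submodule ξ.A (Fin n → L)) := fun c hc => by
    rw [← Finset.univ_sum_single c]
    refine Submodule.sum_mem _ fun k _ => ?_
    have h1 : c k ∈ (maximalIdeal ξ.A • ⊤ : Submodule ξ.A L) := by
      rw [Ideal.smul_top_eq_map]
      exact hc k
    have h2 := Submodule.mem_map_of_mem (f := LinearMap.single ξ.A (fun _ : Fin n => (L : Type u)) k) h1
    rw [Submodule.map_smul''] at h2
    exact Submodule.smul_mono le_rfl le_top h2
  have hHaus : IsHausdorff (maximalIdeal ξ.A) (Fin n → L) := by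
    have h0 : IsHausdorff (maximalIdeal ξ.A) L := isHausdorff_of_hom (γ)
    refine ⟨fun c hc => funext fun k => h0.haus _ fun m => ?_⟩
    have h1 := hc m
    rw [SModEq.zero] at h1 ⊢
    have h2 := Submodule.mem_map_of_mem (f := LinearMap.proj (R := ξ.A)
      (φ := fun _ : Fin n => (L : Type u)) k) h1
    rw [Submodule.map_smul''] at h2
    exact Submodule.smul_mono le_rfl le_top h2
  have hflat : Module.Flat ξ.A (Fin n → L) :=
    Module.Flat.of_linearEquiv (DFinsupp.linearEquivFunOnFintype (R := ξ.A)
      (M := fun _ : Fin n => (L : Type u))).symm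
  -- Lⁿ → R̄_A is injective modulo the maximal ideal of A, and the target is A-flat.
  have hinj : Function.Injective (φ'.toLinearMap ∘ₗ q) := by
    refine injective_of_flat _ fun c hc => hmem c (hind c ?_)
    rw [Ideal.smul_top_eq_map] at hc
    exact ξ.resRbar_eq_zero_of_mem hc
  -- The remainder of an element of the kernel is killed by the injective map Lⁿ → R̄_A, so it
  -- vanishes and v divides the element.
  have hker : RingHom.ker ξ.φ = Ideal.span {v} := by
    refine le_antisymm (fun x hx => ?_) ((Ideal.span_singleton_le_iff_mem _).2 hv)
    obtain ⟨c, hc⟩ := hspan x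
    have h1 : ξ.φ (q c) = 0 := by
      obtain ⟨y, hy⟩ := Ideal.mem_span_singleton.1 hc
      have h2 := congrArg ξ.φ hy
      rw [map_sub, map_mul, hv, zero_mul, sub_eq_zero] at h2
      exact h2.symm.trans hx
    have h0 : c = 0 := hinj (h1.trans (map_zero _).symm)
    subst h0
    simpa using hc
  refine ⟨⟨v, hker⟩, ?_, fun x hx => ?_⟩
  · let _ : Algebra ξ.A (ξ.SA ⧸ RingHom.ker ξ.φ) :=
      ((Ideal.Quotient.mkₐ K (RingHom.ker ξ.φ)).comp ξ.ι).toRingHom.toAlgebra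
    let π : ξ.SA →ₐ[ξ.A] ξ.SA ⧸ RingHom.ker ξ.φ :=
      { toRingHom := Ideal.Quotient.mk _, commutes' := fun a => rfl }
    have hbij : Function.Bijective (π.toLinearMap ∘ₗ q) := by
      constructor
      · rw [← LinearMap.ker_eq_bot, LinearMap.ker_eq_bot']
        intro c hc
        exact hinj ((Ideal.Quotient.eq_zero_iff_mem.1 hc : ξ.φ (q c) = 0).trans (map_zero _).symm)
      · intro y
        obtain ⟨p, rfl⟩ := Ideal.Quotient.mk_surjective y
        obtain ⟨c, hc⟩ := hspan p
        rw [← hker, ← Ideal.Quotient.eq_zero_iff_mem, map_sub, sub_eq_zero] at hc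
        exact ⟨c, hc.symm⟩
    exact (Module.Flat.of_linearEquiv (LinearEquiv.ofBijective _ hbij).symm :
      Module.Flat ξ.A (ξ.SA ⧸ RingHom.ker ξ.φ))
  -- If x vanishes on the curve, its remainder vanishes in R̄, so the coefficients of the remainder
  -- lie in the maximal ideal of A; division accounts for the rest.
  · obtain ⟨c, hc⟩ := hspan x
    rw [← hker] at hc
    have h1 : ξ.resRbar (ξ.φ (q c)) = 0 := by
      have h2 : ξ.φ (x - q c) = 0 := hc
      rw [map_sub, sub_eq_zero] at h2
      rw [← h2, resRbar_φ]
      exact parMap_eq_zero.2 hx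
    rw [← add_sub_cancel (q c) x]
    refine Ideal.add_mem _ (Ideal.mem_sup_left ?_) (Ideal.mem_sup_right hc)
    change ∑ k, θ (c k) * w' ^ (k : ℕ) ∈ _
    refine Ideal.sum_mem _ fun k _ => Ideal.mul_mem_right _ _ ?_
    have := Ideal.mem_map_of_mem θ (hind c h1 k)
    rw [Ideal.map_mapₐ, show θ.comp (γ) = ξ.ι from AlgHom.ext hθι] at this
    exact this

end SecDef

end CurveDef

/-! ### R_A is the image of P_A in R̄_A: the forgetful functor to deformations of the
parametrization. -/

namespace CurveDef

open IsLocalRing CLAlg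

theorem exists_factor {K : Type*} [CommRing K] {P R C : Type*} [CommRing P] [CommRing R]
    [CommRing C] [Algebra K P] [Algebra K R] [Algebra K C] (q : P →ₐ[K] R)
    (hq : Function.Surjective q) (g : P →ₐ[K] C) (h : ∀ x, q x = 0 → g x = 0) :
    ∃ k : R →ₐ[K] C, ∀ x, k (q x) = g x := by
  let e := Ideal.quotientKerAlgEquivOfSurjective hq
  refine ⟨(Ideal.Quotient.liftₐ (RingHom.ker q) g h).comp e.symm.toAlgHom, fun x => ?_⟩
  have : e.symm (q x) = Ideal.Quotient.mk _ x := by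
    rw [AlgEquiv.symm_apply_eq]; rfl
  change Ideal.Quotient.liftₐ (RingHom.ker q) g h (e.symm (q x)) = g x
  rw [this]; rfl

section

variable {K : Type u} [Field K] {r : ℕ} {f : Fin r → PS K}

/-- The closed fibre R → R̄ is injective and R̄_A is flat over A. -/
theorem SecDef.φ_injective (η : NormDef f) : Function.Injective η.φ := by
  refine injective_of_mod η.ι η.φ η.flat_φ_ι fun b hb => ?_
  have h1 := η.resRbar_eq_zero_of_mem hb
  rw [SecDef.resRbar_φ, map_eq_zero_iff _ (normMap_injective f)] at h1
  exact η.resS_eq_zero.1 h1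

namespace EmbDef

variable (ζ : EmbDef f)

/-- Nakayama, from surjectivity of P → R. -/
theorem q_surjective : Function.Surjective ζ.q := by
  refine surjective_of_mod ζ.q fun b => ?_
  obtain ⟨p, hp⟩ := projMap_surjective f (ζ.toNorm.resS b)
  obtain ⟨a, rfl⟩ := ζ.closedFibre_PA.1 p
  refine ⟨a, ?_⟩
  have h1 : ζ.toNorm.resS (b - ζ.q a) = 0 := by
    rw [map_sub, ← hp, sub_eq_zero]
    exact (AlgHom.congr_fun ζ.comm_q a).symm
  rw [SecDef.resS_eq_zero, ← ζ.q_ιP, ← Ideal.map_mapₐ] at h1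
  exact Ideal.map_mono (CLAlg.map_maximalIdeal_le ζ.ιP) h1

theorem q_eq_zero {s : ζ.PA} : ζ.q s = 0 ↔ ζ.toPar.φ s = 0 :=
  (map_eq_zero_iff _ ζ.toNorm.φ_injective).symm

variable (f) in
theorem forgetPar_faithful : (forgetPar f).Faithful where
  map_injective {ζ ζ'} g h hgh := by
    have hP : g.onP = h.onP := congrArg SecDef.Hom.onS hgh
    have hb : g.toNorm.base = h.toNorm.base := congrArg (fun k : SecDef.Hom ζ.toPar ζ'.toPar => k.base) hgh
    have hR : g.toNorm.onRbar = h.toNorm.onRbar := congrArg (fun k : SecDef.Hom ζ.toPar ζ'.toPar => k.onRbar) hgh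
    refine EmbDef.Hom.ext (SecDef.Hom.ext hb (AlgHom.ext fun s => ?_) hR) hP
    obtain ⟨s, rfl⟩ := ζ.q_surjective s
    rw [g.comm_q, h.comm_q, hP]

variable (f) in
-- P_A → R_A is surjective with the same kernel as P_A → R̄_A, so a morphism of parametrizations
-- descends to R_A; the remaining identities are checked after pulling back to P_A.
theorem forgetPar_full : (forgetPar f).Full where
  map_surjective {ζ ζ'} g := by
    obtain ⟨k, hk⟩ := exists_factor ζ.q ζ.q_surjective (ζ'.q.comp g.onS) fun x hx => by
      refine ζ'.q_eq_zero.2 (funext fun i => ?_)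
      have h1 := ζ.q_eq_zero.1 hx
      refine (g.comm_φ x i).symm.trans ?_
      refine (congrArg (g.onRbar i) (congrFun h1 i)).trans (map_zero _)
    let n : SecDef.Hom ζ.toNorm ζ'.toNorm :=
      { base := g.base
        onS := k
        onRbar := g.onRbar
        comm_ι := fun a => by
          rw [← ζ.q_ιP, ← ζ'.q_ιP, AlgHom.comp_apply, hk]
          exact congrArg ζ'.q (g.comm_ι a)
        comm_φ := fun s i => by
          obtain ⟨s, rfl⟩ := ζ.q_surjective s
          rw [hk]
          exact g.comm_φ s i
        comm_resS := fun s => by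
          obtain ⟨s, rfl⟩ := ζ.q_surjective s
          rw [hk]
          exact (AlgHom.congr_fun ζ'.comm_q (g.onS s)).trans ((congrArg (projMap f)
            (g.comm_resS s)).trans (AlgHom.congr_fun ζ.comm_q s).symm)
        comm_resRbar := g.comm_resRbar
        comm_σ := fun s => by
          obtain ⟨s, rfl⟩ := ζ.q_surjective s
          rw [hk]
          exact (AlgHom.congr_fun ζ'.σ_q (g.onS s)).trans ((g.comm_σ s).trans
            (congrArg g.base (AlgHom.congr_fun ζ.σ_q s).symm))
        comm_σbar := g.comm_σbar }
    exact ⟨EmbDef.Hom.mk n g.onS g.comm_ι hk g.comm_resS g.comm_σ, rfl⟩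

/-- Every deformation of the parametrization is one of the sequence `P → R → R̄`. -/
theorem exists_forgetPar_eq (hr : 0 < r) (hf : ∀ i, f i ≠ 0) (ξ : ParDef f) :
    ∃ ζ : EmbDef f, (forgetPar f).obj ζ = ξ := by
  obtain ⟨-, hflat, hres⟩ := ξ.ker_φ hf
  have hne : RingHom.ker ξ.φ ≠ ⊤ := fun h => by
    have h1 : ξ.φ 1 = 0 := by
      rw [← RingHom.mem_ker, h]; trivial
    rw [map_one] at h1
    exact one_ne_zero (congrFun h1 ⟨0, hr⟩)
  let RA := quot ξ.SA (RingHom.ker ξ.φ) hne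
  let q : ξ.SA →ₐ[K] RA := Ideal.Quotient.mkₐ K (RingHom.ker ξ.φ)
  have hq : Function.Surjective q := Ideal.Quotient.mk_surjective
  have hq0 : ∀ {x}, q x = 0 ↔ ξ.φ x = 0 := Ideal.Quotient.eq_zero_iff_mem
  let φ : RA →ₐ[K] (∀ i, ξ.RbarA i) := Ideal.Quotient.liftₐ (RingHom.ker ξ.φ) ξ.φ fun x hx => hx
  let resR : RA →ₐ[K] CurveRing f := Ideal.Quotient.liftₐ (RingHom.ker ξ.φ)
    ((projMap f).comp ξ.resS) fun x hx => by
      refine normMap_injective f ?_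
      rw [map_zero]
      exact (ξ.resRbar_φ x).symm.trans ((congrArg ξ.resRbar hx).trans (map_zero _))
  -- σ factors through some σ̄ᵢ ∘ φ_A, so it kills ker φ_A; a branch to use exists because r > 0.
  let σ : RA →ₐ[K] ξ.A := Ideal.Quotient.liftₐ (RingHom.ker ξ.φ) ξ.σ fun x hx => by
    refine (AlgHom.congr_fun (ξ.σbar_φ ⟨0, hr⟩) x).symm.trans ?_
    exact (congrArg (ξ.σbar ⟨0, hr⟩) (congrFun hx ⟨0, hr⟩)).trans (map_zero _)
  let η : NormDef f :=
    { A := ξ.A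
      SA := RA
      RbarA := ξ.RbarA
      ι := q.comp ξ.ι
      φ := φ
      resS := resR
      resRbar := ξ.resRbar
      flat_SA := hflat
      flat_RbarA := ξ.flat_RbarA
      closedFibre_SA := by
        refine ⟨fun y => ?_, le_antisymm (fun x hx => ?_) ?_⟩
        · obtain ⟨p, rfl⟩ := projMap_surjective f y
          obtain ⟨p, rfl⟩ := ξ.closedFibre_SA.1 p
          exact ⟨q p, rfl⟩
        · obtain ⟨x, rfl⟩ := hq x
          have h1 := hres x (projMap_eq_zero.1 hx)
          have h2 := Ideal.mem_map_of_mem q h1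
          rw [Ideal.map_sup, Ideal.map_mapₐ] at h2
          refine (sup_le le_rfl ?_ : _ ≤ Ideal.map (q.comp ξ.ι) (maximalIdeal ξ.A)) h2
          rw [Ideal.map_le_iff_le_comap]
          intro y hy
          rw [Ideal.mem_comap]
          exact (hq0.2 hy).symm ▸ zero_mem _
        · rw [Ideal.map_le_iff_le_comap]
          intro a ha
          change projMap f (ξ.resS (ξ.ι a)) = 0
          rw [ξ.resS_eq_zero.2 (Ideal.mem_map_of_mem _ ha), map_zero]
      closedFibre_RbarA := ξ.closedFibre_RbarA
      comm := AlgHom.ext fun s => by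
        obtain ⟨s, rfl⟩ := hq s
        exact ξ.resRbar_φ s
      branch := ξ.branch
      σ := σ
      σ_ι := ξ.σ_ι
      σbar := ξ.σbar
      σbar_φ := fun i => AlgHom.ext fun s => by
        obtain ⟨s, rfl⟩ := hq s
        exact AlgHom.congr_fun (ξ.σbar_φ i) s }
  exact ⟨{ toNorm := η, PA := ξ.SA, ιP := ξ.ι, q := q, resP := ξ.resS, q_ιP := rfl
           flat_PA := ξ.flat_SA, closedFibre_PA := ξ.closedFibre_SA, comm_q := rfl
           σP := ξ.σ, σ_q := rfl }, rfl⟩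

theorem exists_quotient_equiv :
    ∃ e : (((forgetPar f).obj ζ).SA ⧸ RingHom.ker ((forgetPar f).obj ζ).φ) ≃ₐ[K] ζ.toNorm.SA,
      ∀ s : ((forgetPar f).obj ζ).SA, e (Ideal.Quotient.mk _ s) = ζ.q s ∧
        ζ.toNorm.φ (e (Ideal.Quotient.mk _ s)) = ((forgetPar f).obj ζ).φ s := by
  have hker : RingHom.ker ζ.q = RingHom.ker ((forgetPar f).obj ζ).φ :=
    Ideal.ext fun s => ζ.q_eq_zero
  rw [← hker]
  exact ⟨Ideal.quotientKerAlgEquivOfSurjective ζ.q_surjective, fun s => ⟨rfl, rfl⟩⟩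

end EmbDef

end

/-! ### Functors over a base category and their fibre functors. -/

section Fibred

universe v₁ v₂ v₃ u₁ u₂ u₃

variable {𝒮 : Type u₁} [Category.{v₁} 𝒮] {𝒳 : Type u₂} [Category.{v₂} 𝒳]
  {𝒴 : Type u₃} [Category.{v₃} 𝒴]

theorem isHomLift_comp_iff (F : 𝒳 ⥤ 𝒴) (q : 𝒴 ⥤ 𝒮) {A B : 𝒮} (ψ : A ⟶ B) {x y : 𝒳} (g : x ⟶ y) :
    (F ⋙ q).IsHomLift ψ g ↔ q.IsHomLift ψ (F.map g) := by
  constructor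
  · intro h
    exact IsHomLift.of_fac q ψ (F.map g) (IsHomLift.domain_eq (F ⋙ q) ψ g)
      (IsHomLift.codomain_eq (F ⋙ q) ψ g) (IsHomLift.fac (F ⋙ q) ψ g)
  · intro h
    exact IsHomLift.of_fac (F ⋙ q) ψ g (IsHomLift.domain_eq q ψ (F.map g))
      (IsHomLift.codomain_eq q ψ (F.map g)) (IsHomLift.fac q ψ (F.map g))

theorem fibreFunctor_isEquivalence {p : 𝒳 ⥤ 𝒮} {q : 𝒴 ⥤ 𝒮} (F : 𝒳 ⥤ 𝒴) (hF : F ⋙ q = p)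
    [F.Full] [F.Faithful] (hs : ∀ y, ∃ x, F.obj x = y) (A : 𝒮) :
    (fibreFunctor F hF A).IsEquivalence := by
  subst hF
  exact
    { faithful :=
        { map_injective := fun {x y} g h hgh => Subtype.ext (F.map_injective
            (congrArg Subtype.val hgh)) }
      full :=
        { map_surjective := fun {x y} g => by
            obtain ⟨h, hh⟩ := F.map_surjective g.1
            refine ⟨⟨h, (isHomLift_comp_iff F q _ h).2 ?_⟩, Subtype.ext hh⟩
            rw [hh]
            exact g.2 }
      essSurj :=
        { mem_essImage := fun y => by
            obtain ⟨x, hx⟩ := hs y.1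
            refine ⟨⟨x, (congrArg q.obj hx).trans y.2⟩, ⟨eqToIso (Subtype.ext hx)⟩⟩ } }

end Fibred

end CurveDef

/-! ### Extension from the curve to the plane: the forgetful functor to deformations of the
normalization. -/

namespace CurveDef

open IsLocalRing CLAlg

section

variable {K : Type u} [Field K] {r : ℕ} {f : Fin r → PS K}

/-- Modulo the ideal of the variables, the identity and the residue map agree on the variables,
hence everywhere. -/
theorem maximalIdeal_plane_le :
    maximalIdeal (plane K) ≤ Ideal.span (Set.range ((base K).var : Fin 2 → plane K)) := by
  intro p hp
  have hJ : Ideal.span (Set.range ((base K).var : Fin 2 → plane K)) ≠ ⊤ := fun h => by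
    have h1 : Ideal.span (Set.range ((base K).var : Fin 2 → plane K)) ≤ maximalIdeal (plane K) := by
      rw [Ideal.span_le]
      rintro _ ⟨i, rfl⟩
      exact var_mem _ _
    rw [h, top_le_iff] at h1
    exact (maximalIdeal.isMaximal (plane K)).ne_top h1
  have h1 := mk_eq_of_hom (AlgHom.id K (plane K)) ((Algebra.ofId K (plane K)).comp (plane K).res) _
    hJ (fun i => ?_) p
  · rw [AlgHom.comp_apply, (res_eq_zero (A := plane K)).2 hp, map_zero, sub_zero] at h1
    exact h1
  · rw [AlgHom.comp_apply, (res_eq_zero (A := plane K)).2 (var_mem _ i), map_zero, sub_zero]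
    exact Ideal.subset_span ⟨i, rfl⟩

/-- A deformation of the plane is a power series ring in any lifts of the coordinates. -/
theorem isCoord_plane {A S : CLAlg K} {ι : A →ₐ[K] S} (hflat : ι.toRingHom.Flat)
    {π : S →ₐ[K] PS K} (hπ : IsClosedFibre ι π) {x : Fin 2 → S}
    (hx : ∀ i, π (x i) = (base K).var i) : IsCoord ι x := by
  have hmem : ∀ i, x i ∈ maximalIdeal S := fun i => mem_of_map_mem (B := plane K) π (by
    rw [hx]; exact var_mem _ _)
  refine isCoord_of ι x hflat hmem (fun p hp => ?_) fun p hp => ?_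
  · obtain ⟨c, hc⟩ := Ideal.mem_span_range_iff_exists_fun.1
      (maximalIdeal_plane_le (map_mem (B := plane K) π hp))
    choose c' hc' using fun i => hπ.1 (c i)
    have h1 : p - ∑ i, c' i * x i ∈ (maximalIdeal A).map ι := by
      rw [← hπ.2, RingHom.mem_ker, map_sub, map_sum, sub_eq_zero]
      refine hc.symm.trans (Finset.sum_congr rfl fun i _ => ?_)
      rw [map_mul, hc', hx]
    rw [← sub_add_cancel p (∑ i, c' i * x i)]
    exact Ideal.add_mem _ (Ideal.mem_sup_left h1) (Ideal.mem_sup_right (Ideal.sum_mem _ fun i _ =>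
      Ideal.mul_mem_left _ _ (Ideal.subset_span ⟨i, rfl⟩)))
  · rw [← hπ.2, RingHom.mem_ker] at hp
    have := hom_ext_base (σ := Fin 2) (C := plane K) (h := AlgHom.id K (plane K))
      (g := AlgHom.comp π (ev (A := base K) (Algebra.ofId K S) x hmem))
      fun i => (congrArg π (ev_ofId_var x hmem i)).trans (hx i)
    exact (AlgHom.congr_fun this p).symm.trans hp

theorem span_prod_ne_top (hr : 0 < r) (hf : ∀ i, Irreducible (f i)) :
    Ideal.span {∏ i, f i} ≠ (⊤ : Ideal (plane K)) := by
  refine span_singleton_ne_top (C := plane K) ((mem_maximalIdeal _).2 fun h => ?_)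
  exact (hf ⟨0, hr⟩).not_isUnit (isUnit_of_dvd_unit (Finset.dvd_prod_of_mem f (Finset.mem_univ _)) h)

namespace EmbDef

/-- The plane of a deformation maps onto the fibre product of the curve with the plane. -/
theorem exists_lift (ζ : EmbDef f) {b : ζ.toNorm.SA} {p : PS K}
    (h : ζ.toNorm.resS b = projMap f p) : ∃ y, ζ.q y = b ∧ ζ.resP y = p := by
  obtain ⟨y, rfl⟩ := ζ.q_surjective b
  -- u corrects the image in P but may move the image in R_A. That change lies in the extension of
  -- the maximal ideal of A, so it is undone by some u' which vanishes in P.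
  obtain ⟨u, hu⟩ := ζ.closedFibre_PA.1 (p - ζ.resP y)
  have hq : ∀ s, ζ.toNorm.resS (ζ.q s) = projMap f (ζ.resP s) := AlgHom.congr_fun ζ.comm_q
  have h1 : ζ.q u ∈ ((maximalIdeal ζ.toNorm.A).map ζ.ιP).map ζ.q := by
    rw [Ideal.map_mapₐ, ζ.q_ιP, ← SecDef.resS_eq_zero, hq, hu, map_sub, ← hq, h, sub_self]
  obtain ⟨u', hu', huq⟩ := (Ideal.mem_map_iff_of_surjective ζ.q ζ.q_surjective).1 h1
  rw [← ζ.closedFibre_PA.2, RingHom.mem_ker] at hu'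
  refine ⟨y + (u - u'), ?_, ?_⟩
  · rw [map_add, map_sub, huq, sub_self, add_zero]
  · rw [map_add, map_sub, hu, hu', sub_zero, add_sub_cancel]

variable (f) in
/-- Morphisms of the deformed curves extend to the deformed planes. -/
theorem forgetNorm_full : (forgetNorm f).Full where
  map_surjective {ζ ζ'} (g : SecDef.Hom ζ.toNorm ζ'.toNorm) := by
    have hq : ∀ (ζ : EmbDef f) s, ζ.toNorm.resS (ζ.q s) = projMap f (ζ.resP s) :=
      fun ζ => AlgHom.congr_fun ζ.comm_q
    choose x hx using fun i => ζ.closedFibre_PA.1 ((base K).var i : plane K)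
    have hc := isCoord_plane ζ.flat_PA ζ.closedFibre_PA hx
    -- The image of a coordinate is prescribed both in R_A and in P; the two agree in R, so they
    -- have a common lift.
    choose x' hx'q hx' using fun i => ζ'.exists_lift (b := g.onS (ζ.q (x i)))
      (p := ((base K).var i : plane K)) (by rw [g.comm_resS, hq, hx])
    obtain ⟨k, hkι, hkx⟩ := hc.exists_hom (ζ'.ιP.comp g.base) x' fun i =>
      mem_of_map_mem (B := plane K) ζ'.resP (by rw [hx']; exact var_mem _ _)
    have hqι : ∀ (ζ : EmbDef f) a, ζ.q (ζ.ιP a) = ζ.toNorm.ι a := fun ζ => AlgHom.congr_fun ζ.q_ιP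
    have hkq : ∀ s, g.onS (ζ.q s) = ζ'.q (k s) := AlgHom.congr_fun (hc.hom_ext
      (g₁ := g.onS.comp ζ.q) (g₂ := ζ'.q.comp k) (fun a => by
        rw [AlgHom.comp_apply, AlgHom.comp_apply, hkι, hqι, g.comm_ι, AlgHom.comp_apply, hqι])
      fun i => by rw [AlgHom.comp_apply, AlgHom.comp_apply, hkx, hx'q])
    have hres : ∀ (ζ : EmbDef f) a, ζ.resP (ζ.ιP a) = algebraMap K _ (ζ.toNorm.A.res a) :=
      fun ζ => ζ.toPar.resS_ι
    refine ⟨EmbDef.Hom.mk g k hkι hkq (AlgHom.congr_fun (hc.hom_ext (C := plane K)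
      (g₁ := ζ'.resP.comp k) (g₂ := ζ.resP) (fun a => ?_) fun i => ?_)) (fun s => ?_), rfl⟩
    · rw [AlgHom.comp_apply, hkι, AlgHom.comp_apply, hres, hres, CLAlg.res_map]
    · rw [AlgHom.comp_apply, hkx, hx', hx]
    · rw [← ζ.σ_q, ← ζ'.σ_q, AlgHom.comp_apply, AlgHom.comp_apply, ← hkq, g.comm_σ]

/-- Take P_A = A[[x, y]] and send x, y to arbitrary lifts to R_A of their classes in R; the section
is pulled back from R_A. -/
theorem exists_forgetNorm_eq (hr : 0 < r) (hf : ∀ i, Irreducible (f i)) (η : NormDef f) :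
    ∃ ζ : EmbDef f, (forgetNorm f).obj ζ = η := by
  -- R is viewed as a complete local algebra, so that morphisms to it are local and determined by
  -- the variables.
  let R₀ : CLAlg K := quot (plane K) (Ideal.span {∏ i, f i}) (span_prod_ne_top hr hf)
  let pr : plane K →ₐ[K] R₀ := projMap f
  choose c hc using fun i => η.closedFibre_SA.1 (projMap f ((base K).var i : plane K))
  let resS : η.SA →ₐ[K] R₀ := η.resS
  have hc' : ∀ i, resS (c i) = pr ((base K).var i) := hc
  have hmem : ∀ i, c i ∈ maximalIdeal η.SA := fun i => mem_of_map_mem resS (by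
    rw [hc']
    exact map_mem pr (var_mem _ i))
  have hι : (ev η.ι c hmem).comp (constHom (Fin 2) η.A) = η.ι :=
    AlgHom.ext fun a => ev_constHom _ _ _ a
  refine ⟨{
    toNorm := η
    PA := pow (Fin 2) η.A
    ιP := constHom (Fin 2) η.A
    q := ev η.ι c hmem
    resP := reduction (Fin 2) η.A
    q_ιP := hι
    flat_PA := flat_constHom _
    closedFibre_PA := isClosedFibre_reduction
    comm_q := ?_
    σP := η.σ.comp (ev η.ι c hmem)
    σ_q := rfl }, rfl⟩
  refine hom_ext_pow (C := R₀) (g := resS.comp (ev η.ι c hmem))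
    (h := pr.comp (reduction (Fin 2) η.A)) (fun a => ?_) fun i => ?_
  · rw [AlgHom.comp_apply, AlgHom.comp_apply, reduction_constHom, ev_constHom]
    exact (η.resS_ι a).trans (AlgHom.commutes pr _).symm
  · rw [AlgHom.comp_apply, AlgHom.comp_apply, reduction_var, ev_var]
    exact hc' i

variable (f) in
-- Any lifting of η will do: by fullness the given morphism g extends to it, whatever the map of
-- bases.
theorem isSmoothOver_forgetNorm (hr : 0 < r) (hf : ∀ i, Irreducible (f i)) :
    IsSmoothOver (SecDef.baseFunctor (normMap f)) (forgetNorm f) := by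
  intro η ζ g _
  obtain ⟨ζ', rfl⟩ := exists_forgetNorm_eq hr hf η
  have := forgetNorm_full f
  obtain ⟨h, hh⟩ := (forgetNorm f).map_surjective g
  refine ⟨ζ', h, Iso.refl _, IsHomLift.id rfl, ?_⟩
  rw [hh, Iso.refl_hom, Category.id_comp]

end EmbDef

end

end CurveDef

/-! ### Summands as power series rings in one parameter, and uniqueness of base change. -/

namespace CurveDef

open IsLocalRing CLAlg

namespace SecDef

variable {K : Type u} [Field K] {r : ℕ} {f : Fin r → PS K}

section

variable {S : Type u} [CommRing S] [Algebra K S] {κ : S →ₐ[K] Normalization f} (ξ : SecDef f κ)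

/-- The element `t` is a local parameter of the closed fibre of the `i`-th summand. -/
structure IsParameter (i : Fin r) (t : ξ.RbarA i) : Prop where
  mem : t ∈ maximalIdeal (ξ.RbarA i)
  gen : maximalIdeal (ξ.RbarA i) ≤ ξ.mi i ⊔ Ideal.span {t}
  ind : ∀ p : line K, ev (A := base K) (Algebra.ofId K (ξ.RbarA i)) (fun _ => t) (fun _ => mem) p ∈
    ξ.mi i → p = 0

variable {ξ}

theorem IsParameter.isCoord {i : Fin r} {t : ξ.RbarA i} (h : ξ.IsParameter i t) :
    IsCoord (ξ.ιi i) (fun _ : Unit => t) :=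
  isCoord_of _ _ (ξ.flat_ιi i) (fun _ => h.mem) (by rw [Set.range_const]; exact h.gen) h.ind

theorem onRbar_mem_mi {η : SecDef f κ} (g : SecDef.Hom ξ η) {i : Fin r} {s : ξ.RbarA i}
    (hs : s ∈ ξ.mi i) : g.onRbar i s ∈ η.mi i := by
  refine (Ideal.map_le_iff_le_comap.2 fun a ha => ?_ : ξ.mi i ≤ (η.mi i).comap (g.onRbar i)) hs
  rw [Ideal.mem_comap, Ideal.mem_comap, ιi_apply, g.comm_φ, g.comm_ι]
  exact Ideal.mem_map_of_mem (η.ιi i) (map_mem _ ha)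

theorem onRbar_single {η : SecDef f κ} (g : SecDef.Hom ξ η) {i : Fin r} (s : ξ.RbarA i) :
    η.resRbar (Pi.single i (g.onRbar i s)) = ξ.resRbar (Pi.single i s) := by
  rw [← g.comm_resRbar]
  congr 1
  ext j
  by_cases hj : j = i
  · subst hj; simp
  · simp [hj]

theorem mem_mi_of_onRbar_mem {η : SecDef f κ} (g : SecDef.Hom ξ η) {i : Fin r} {s : ξ.RbarA i}
    (hs : g.onRbar i s ∈ η.mi i) : s ∈ ξ.mi i := by
  rw [← resRbar_single_eq_zero, onRbar_single] at hs
  exact ξ.resRbar_single_eq_zero.1 hs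

/-- Morphisms are surjective modulo the maximal ideal of the base. -/
theorem exists_sub_onRbar_mem {η : SecDef f κ} (g : SecDef.Hom ξ η) (t : ∀ i, η.RbarA i) :
    ∃ s : ∀ i, ξ.RbarA i, η.resRbar t = ξ.resRbar s ∧ ∀ i, t i - g.onRbar i (s i) ∈ η.mi i := by
  obtain ⟨s, hs⟩ := ξ.closedFibre_RbarA.1 (η.resRbar t)
  refine ⟨s, hs.symm, η.resRbar_eq_zero.1 (?_ : η.resRbar (t - fun i => g.onRbar i (s i)) = 0)⟩
  rw [map_sub, g.comm_resRbar, hs, sub_self]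

/-- Morphisms induce the identity on R̄, hence isomorphisms on the closed fibres of the summands,
and being a parameter depends only on the closed fibre. -/
theorem IsParameter.map {η : SecDef f κ} (g : SecDef.Hom ξ η) {i : Fin r} {t : ξ.RbarA i}
    (h : ξ.IsParameter i t) : η.IsParameter i (g.onRbar i t) := by
  refine ⟨map_mem _ h.mem, fun y hy => ?_, fun p hp => h.ind p (mem_mi_of_onRbar_mem g ?_)⟩
  · obtain ⟨s, -, hs⟩ := exists_sub_onRbar_mem g (Pi.single i y)
    have hi := hs i
    rw [Pi.single_eq_same] at hi
    have h1 : g.onRbar i (s i) ∈ maximalIdeal (η.RbarA i) := by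
      have := Ideal.sub_mem _ hy (η.mi_le i hi)
      rwa [sub_sub_cancel] at this
    have h2 := Ideal.mem_map_of_mem (g.onRbar i) (h.gen (mem_of_map_mem _ h1))
    rw [Ideal.map_sup, Ideal.map_span, Set.image_singleton] at h2
    rw [← sub_add_cancel y (g.onRbar i (s i))]
    have h3 : (ξ.mi i).map (g.onRbar i) ≤ η.mi i :=
      Ideal.map_le_iff_le_comap.2 fun _ => onRbar_mem_mi g
    have h4 : (ξ.mi i).map (g.onRbar i) ⊔ Ideal.span {g.onRbar i t} ≤
      η.mi i ⊔ Ideal.span {g.onRbar i t} := sup_le_sup_right h3 _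
    exact Ideal.add_mem _ (Ideal.mem_sup_left hi) (h4 h2)
  · have : (g.onRbar i).comp (ev (A := base K) (Algebra.ofId K (ξ.RbarA i)) (fun _ : Unit => t)
        (fun _ => h.mem)) = ev (A := base K) (Algebra.ofId K (η.RbarA i))
        (fun _ : Unit => g.onRbar i t) (fun _ => map_mem _ h.mem) := hom_ext_base fun j => by
      rw [AlgHom.comp_apply, ev_ofId_var, ev_ofId_var]
    exact (AlgHom.congr_fun this p).symm ▸ hp

end

/-- A nonzero series is a power of the variable times a unit, and t is regular on the nonzero closed
fibre. -/
theorem exists_isParameter (ξ : ParDef f) (hf : ∀ i, f i ≠ 0) (i : Fin r) :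
    ∃ t, ξ.IsParameter i t := by
  obtain ⟨z, w, h⟩ := exists_isAdapted hf
  obtain ⟨z', hz⟩ := ξ.closedFibre_SA.1 z
  obtain ⟨w', hw⟩ := ξ.closedFibre_SA.1 w
  obtain ⟨t, ht, hgen, hreg, -⟩ := ξ.exists_parameter h hz hw i
  refine ⟨t, ht, hgen, fun p hp => ?_⟩
  by_contra hp0
  obtain ⟨n, v, hv, rfl⟩ := exists_eq_pow_mul_unit hp0
  rw [map_mul, map_pow, ev_ofId_var] at hp
  have h1 : ∀ (n : ℕ) x, t ^ n * x ∈ ξ.mi i → x ∈ ξ.mi i := fun n => by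
    induction n with
    | zero => intro x hx; simpa using hx
    | succ n ih =>
      intro x hx
      rw [pow_succ, mul_assoc] at hx
      exact hreg _ (ih _ hx)
  exact ξ.mi_ne_top i (Ideal.eq_top_of_isUnit_mem _ (h1 n _ hp) (hv.map _))

theorem exists_plane_coordinates (ξ : ParDef f) :
    ∃ x : Fin 2 → ξ.SA, ∀ i, ξ.resS (x i) = ((base K).var i : plane K) := by
  choose x hx using fun i => ξ.closedFibre_SA.1 ((base K).var i : plane K)
  exact ⟨x, hx⟩

/-- Morphisms of deformations are cocartesian. -/
theorem exists_hom_of_comp (hf : ∀ i, f i ≠ 0) {ξ η η' : ParDef f} (g : SecDef.Hom ξ η)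
    (h : SecDef.Hom ξ η') (χ : η.A →ₐ[K] η'.A) (hχ : χ.comp g.base = h.base) :
    ∃ k : SecDef.Hom η η', k.base = χ ∧ CategoryStruct.comp (obj := ParDef f) g k = h := by
  obtain ⟨x, hx⟩ := ξ.exists_plane_coordinates
  choose t ht using ξ.exists_isParameter hf
  have hres : ∀ (ξ : ParDef f) a, ξ.resS (ξ.ι a) = algebraMap K (PS K) (ξ.A.res a) :=
    fun ξ => ξ.resS_ι
  have hχ' : ∀ a, χ (g.base a) = h.base a := AlgHom.congr_fun hχ
  have hcx := isCoord_plane ξ.flat_SA ξ.closedFibre_SA hx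
  have hct : ∀ i, IsCoord (ξ.ιi i) (fun _ : Unit => t i) := fun i => (ht i).isCoord
  have hgx := isCoord_plane η.flat_SA η.closedFibre_SA (x := fun i => g.onS (x i)) fun i => by
    rw [g.comm_resS, hx]
  have hgt : ∀ i, IsCoord (η.ιi i) (fun _ : Unit => g.onRbar i (t i)) := fun i =>
    ((ht i).map g).isCoord
  -- The images under g of coordinates of ξ are coordinates of η, so the values of k on them are
  -- forced by h and define k.
  obtain ⟨kS, hkι, hkx⟩ := hgx.exists_hom (η'.ι.comp χ) (fun i => h.onS (x i)) fun i =>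
    map_mem _ (hcx.mem i)
  choose kR hkιR hkt using fun i => (hgt i).exists_hom ((η'.ιi i).comp χ)
    (fun _ => h.onRbar i (t i)) fun _ => map_mem _ (ht i).mem
  simp only [AlgHom.comp_apply] at hkι hkιR
  have hιR : ∀ {ξ η : ParDef f} (g : SecDef.Hom ξ η) i a,
      g.onRbar i (ξ.ιi i a) = η.ιi i (g.base a) := fun g i a => by
    rw [ιi_apply, g.comm_φ, g.comm_ι, ιi_apply]
  have hgS : ∀ s, kS (g.onS s) = h.onS s := AlgHom.congr_fun (hcx.hom_ext
    (g₁ := kS.comp g.onS) (g₂ := h.onS) (fun a => by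
      rw [AlgHom.comp_apply, g.comm_ι, hkι, h.comm_ι, hχ']) hkx)
  have hgR : ∀ i s, kR i (g.onRbar i s) = h.onRbar i s := fun i => AlgHom.congr_fun
    ((hct i).hom_ext (g₁ := (kR i).comp (g.onRbar i)) (g₂ := h.onRbar i) (fun a => by
      rw [AlgHom.comp_apply, hιR, hkιR, hιR, hχ']) fun _ => hkt i ())
  have hmi : ∀ i s, s ∈ η.mi i → kR i s ∈ η'.mi i := fun i s hs => by
    refine (Ideal.map_le_iff_le_comap.2 fun a ha => ?_ : η.mi i ≤ (η'.mi i).comap (kR i)) hs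
    rw [Ideal.mem_comap, Ideal.mem_comap, hkιR]
    exact Ideal.mem_map_of_mem (η'.ιi i) (map_mem _ ha)
  have hφ : ∀ s i, kR i (η.φ s i) = η'.φ (kS s) i := fun s i => AlgHom.congr_fun (hgx.hom_ext
    (g₁ := (kR i).comp (η.φi i)) (g₂ := (η'.φi i).comp kS) (fun a => by
      rw [AlgHom.comp_apply, AlgHom.comp_apply, hkι]; exact hkιR i a) (fun j => by
      rw [AlgHom.comp_apply, AlgHom.comp_apply, hkx, φi_apply, ← g.comm_φ, hgR]
      exact h.comm_φ (x j) i)) s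
  refine ⟨⟨χ, kS, kR, hkι, hφ, ?_, ?_, ?_, ?_⟩, rfl, ?_⟩
  · refine AlgHom.congr_fun (hgx.hom_ext (C := plane K) (g₁ := η'.resS.comp kS) (g₂ := η.resS)
      (fun a => ?_) fun i => ?_)
    · rw [AlgHom.comp_apply, hkι, hres, hres, CLAlg.res_map]
    · rw [AlgHom.comp_apply, hkx, h.comm_resS, g.comm_resS]
  · intro s
    -- g is surjective up to elements vanishing on the closed fibre, so compatibility with R̄ is
    -- inherited from g and h.
    obtain ⟨τ, hτ, hs⟩ := exists_sub_onRbar_mem g s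
    rw [hτ, ← h.comm_resRbar, ← sub_eq_zero, ← map_sub, resRbar_eq_zero]
    intro i
    have := hmi i _ (hs i)
    rwa [map_sub, hgR] at this
  · refine AlgHom.congr_fun (hgx.hom_ext (g₁ := η'.σ.comp kS) (g₂ := χ.comp η.σ)
      (fun a => ?_) fun i => ?_)
    · rw [AlgHom.comp_apply, hkι, AlgHom.comp_apply]
      exact (AlgHom.congr_fun η'.σ_ι _).trans (congrArg χ (AlgHom.congr_fun η.σ_ι a)).symm
    · rw [AlgHom.comp_apply, hkx, h.comm_σ, AlgHom.comp_apply, g.comm_σ, hχ']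
  · intro i
    have hσι : ∀ (ξ : ParDef f) a, ξ.σbar i (ξ.ιi i a) = a := fun ξ a =>
      (AlgHom.congr_fun (ξ.σbar_φ i) (ξ.ι a)).trans (AlgHom.congr_fun ξ.σ_ι a)
    refine AlgHom.congr_fun ((hgt i).hom_ext (g₁ := (η'.σbar i).comp (kR i))
      (g₂ := χ.comp (η.σbar i)) (fun a => ?_) fun _ => ?_)
    · rw [AlgHom.comp_apply, hkιR, AlgHom.comp_apply, hσι, hσι]
    · rw [AlgHom.comp_apply, hkt i (), h.comm_σbar, AlgHom.comp_apply, g.comm_σbar, hχ']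
  · exact SecDef.Hom.ext hχ (AlgHom.ext hgS) (funext fun i => AlgHom.ext (hgR i))

/-- The coordinates of η may be chosen in the image of g, and morphisms are determined by the base
and the coordinates. -/
theorem hom_ext_of_comp (hf : ∀ i, f i ≠ 0) {ξ η η' : ParDef f} (g : SecDef.Hom ξ η)
    {k l : SecDef.Hom η η'} (hb : k.base = l.base)
    (h : CategoryStruct.comp (obj := ParDef f) g k = CategoryStruct.comp (obj := ParDef f) g l) :
    k = l := by
  obtain ⟨x, hx⟩ := ξ.exists_plane_coordinates
  choose t ht using ξ.exists_isParameter hf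
  have hgx := isCoord_plane η.flat_SA η.closedFibre_SA (x := fun i => g.onS (x i)) fun i => by
    rw [g.comm_resS, hx]
  refine SecDef.Hom.ext hb (hgx.hom_ext (fun a => ?_) fun i => ?_) (funext fun i =>
    ((ht i).map g).isCoord.hom_ext (fun a => ?_) fun _ => ?_)
  · rw [k.comm_ι, l.comm_ι, hb]
  · exact AlgHom.congr_fun (congrArg (fun m : SecDef.Hom ξ η' => m.onS) h) (x i)
  · rw [ιi_apply, k.comm_φ, l.comm_φ, k.comm_ι, l.comm_ι, hb]
  · exact AlgHom.congr_fun (congrFun (congrArg (fun m : SecDef.Hom ξ η' => m.onRbar) h) i) (t i)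

end SecDef

end CurveDef

/-! ### Existence of base change. -/

namespace CurveDef

open IsLocalRing CLAlg

namespace SecDef

variable {K : Type u} [Field K] {r : ℕ} {f : Fin r → PS K}

/-- Base change of deformations of the parametrization. -/
theorem exists_baseChange (hf : ∀ i, f i ≠ 0) (ξ : ParDef f) {B : CLAlg K} (ψ : ξ.A ⟶ B) :
    ∃ (η : ParDef f) (g : ξ ⟶ η), (baseFunctor (parMap f)).IsHomLift ψ g := by
  let ψ : ξ.A →ₐ[K] B := ψ
  obtain ⟨x, hx⟩ := ξ.exists_plane_coordinates
  choose t ht using ξ.exists_isParameter hf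
  have hcx := isCoord_plane ξ.flat_SA ξ.closedFibre_SA hx
  have hct : ∀ i, IsCoord (ξ.ιi i) (fun _ : Unit => t i) := fun i => (ht i).isCoord
  have hσι : ∀ i a, ξ.σbar i (ξ.ιi i a) = a := fun i a =>
    (AlgHom.congr_fun (ξ.σbar_φ i) (ξ.ι a)).trans (AlgHom.congr_fun ξ.σ_ι a)
  let c := constHom Unit B
  -- In coordinates, base change replaces A[[x, y]] by B[[x, y]] and A[[t]] by B[[t]], with ψ
  -- applied to coefficients; φ and the sections are transported by their values on coordinates.
  obtain ⟨gS, hgι, hgx⟩ := hcx.exists_hom ((constHom (Fin 2) B).comp ψ) B.var B.var_mem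
  choose gR hgιR hgt using fun i => (hct i).exists_hom (c.comp ψ) (fun _ => B.var ())
    fun _ => var_mem B ()
  let φ : ∀ i, pow (Fin 2) B →ₐ[K] pow Unit B := fun i =>
    ev c (fun j => gR i (ξ.φi i (x j))) fun j => map_mem _ (map_mem _ (hcx.mem j))
  have hφc : ∀ i b, φ i (constHom (Fin 2) B b) = c b := fun i b => ev_constHom _ _ _ b
  have hφv : ∀ i j, φ i (B.var j) = gR i (ξ.φi i (x j)) := fun i j => ev_var _ _ _ j
  have hφg : ∀ i s, φ i (gS s) = gR i (ξ.φi i s) := fun i => AlgHom.congr_fun (hcx.hom_ext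
    (g₁ := (φ i).comp gS) (g₂ := (gR i).comp (ξ.φi i)) (fun a => by
      rw [AlgHom.comp_apply, hgι, AlgHom.comp_apply, hφc, AlgHom.comp_apply]
      exact (hgιR i a).symm) fun j => by
      rw [AlgHom.comp_apply, hgx, hφv, AlgHom.comp_apply])
  let s : ∀ i, line K →ₐ[K] ξ.RbarA i := fun i =>
    ev (A := base K) (Algebra.ofId K (ξ.RbarA i)) (fun _ => t i) fun _ => (ht i).mem
  have hs : ∀ i, s i lvar = t i := fun i => ev_ofId_var _ _ ()
  have hfι : ∀ i a, ξ.toFibre i (ξ.ιi i a) = algebraMap K _ (ξ.A.res a) := fun i a => by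
    rw [← AlgHom.commutes (ξ.toFibre i), ← AlgHom.commutes (ξ.ιi i), ← sub_eq_zero, ← map_sub,
      ← map_sub, toFibre_eq_zero]
    exact Ideal.mem_map_of_mem _ (ξ.A.sub_res_mem a)
  -- The closed fibre K[[t]] of B[[t]] is mapped to R̄_{A,i} by t ↦ t i. This makes ρ a map of
  -- K-algebras inverse to gR on closed fibres, through which the new summands are identified with
  -- those of R̄.
  let ρ : ∀ i, pow Unit B →ₐ[K] ξ.RbarA i := fun i => (s i).comp (reduction Unit B)
  have hρv : ∀ i, ρ i (B.var ()) = t i := fun i => by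
    rw [AlgHom.comp_apply, reduction_var, hs]
  have hρc : ∀ i b, ρ i (c b) = algebraMap K _ (B.res b) := fun i b => by
    rw [AlgHom.comp_apply, reduction_constHom, AlgHom.commutes]
  have hρ : ∀ i y, ξ.toFibre i (ρ i (gR i y)) = ξ.toFibre i y := fun i => AlgHom.congr_fun
    ((hct i).hom_ext (g₁ := ((ξ.toFibre i).comp (ρ i)).comp (gR i)) (g₂ := ξ.toFibre i)
      (fun a => by
        refine (congrArg (fun y => ξ.toFibre i (ρ i y)) (hgιR i a)).trans ?_
        refine (congrArg (ξ.toFibre i) (hρc i (ψ a))).trans ?_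
        rw [AlgHom.commutes, hfι, CLAlg.res_map]) fun _ =>
        (congrArg (fun y => ξ.toFibre i (ρ i y)) (hgt i ())).trans
          (congrArg (ξ.toFibre i) (hρv i)))
  have hρ0 : ∀ i u, ρ i u ∈ ξ.mi i ↔ u ∈ (maximalIdeal B).map c := fun i u => by
    rw [← reduction_eq_zero]
    refine ⟨fun h => (ht i).ind _ h, fun h => ?_⟩
    rw [AlgHom.comp_apply, h, map_zero]
    exact zero_mem _
  let resRbar : (∀ _ : Fin r, pow Unit B) →ₐ[K] Normalization f :=
    ξ.resRbar.comp (AlgHom.pi fun i =>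
      (ρ i).comp (Pi.evalAlgHom K (fun _ : Fin r => (pow Unit B : Type u)) i))
  have hresR : ∀ u, resRbar u = ξ.resRbar fun i => ρ i (u i) := fun u => rfl
  have hresg : ∀ y : ∀ i, ξ.RbarA i, resRbar (fun i => gR i (y i)) = ξ.resRbar y := fun y => by
    rw [hresR, ← sub_eq_zero, ← map_sub, resRbar_eq_zero]
    intro i
    rw [← toFibre_eq_zero, Pi.sub_apply, map_sub, hρ, sub_self]
  let σ : pow (Fin 2) B →ₐ[K] B := ev (AlgHom.id K B) (fun j => ψ (ξ.σ (x j))) fun j =>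
    map_mem _ (map_mem _ (hcx.mem j))
  have hσc : ∀ b, σ (constHom (Fin 2) B b) = b := fun b => ev_constHom _ _ _ b
  have hσv : ∀ j, σ (B.var j) = ψ (ξ.σ (x j)) := fun j => ev_var _ _ _ j
  let σbar : ∀ _ : Fin r, pow Unit B →ₐ[K] B := fun i =>
    ev (AlgHom.id K B) (fun _ => ψ (ξ.σbar i (t i))) fun _ => map_mem _ (map_mem _ (ht i).mem)
  have hσbc : ∀ i b, σbar i (c b) = b := fun i b => ev_constHom _ _ _ b
  have hσbg : ∀ i y, σbar i (gR i y) = ψ (ξ.σbar i y) := fun i =>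
    AlgHom.congr_fun ((hct i).hom_ext (g₁ := (σbar i).comp (gR i)) (g₂ := ψ.comp (ξ.σbar i))
      (fun a => by rw [AlgHom.comp_apply, hgιR, AlgHom.comp_apply, AlgHom.comp_apply, hσbc, hσι])
      fun _ => (congrArg (σbar i) (hgt i ())).trans (ev_var _ _ _ ()))
  let η : ParDef f :=
    { A := B
      SA := pow (Fin 2) B
      RbarA := fun _ => pow Unit B
      ι := constHom (Fin 2) B
      φ := AlgHom.pi φ
      resS := reduction (Fin 2) B
      resRbar := resRbar
      flat_SA := flat_constHom _
      flat_RbarA := fun i => by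
        have : ((Pi.evalAlgHom K (fun _ : Fin r => (pow Unit B : Type u)) i).comp
          (AlgHom.pi φ)).comp (constHom (Fin 2) B) = c := AlgHom.ext fun b => hφc i b
        rw [this]
        exact flat_constHom _
      closedFibre_SA := isClosedFibre_reduction
      closedFibre_RbarA := by
        have hG : ∀ i, (Pi.evalAlgHom K (fun _ : Fin r => (pow Unit B : Type u)) i).comp
          ((AlgHom.pi φ).comp (constHom (Fin 2) B)) = c := fun i => AlgHom.ext fun b => hφc i b
        refine ⟨fun y => ?_, Ideal.ext fun u => ?_⟩
        · obtain ⟨y, rfl⟩ := ξ.closedFibre_RbarA.1 y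
          exact ⟨_, hresg y⟩
        · rw [RingHom.mem_ker, hresR, resRbar_eq_zero]
          simp only [hρ0]
          refine ⟨fun h => mem_map_of_forall (B := fun _ : Fin r => pow Unit B) _ fun i => ?_,
            fun h i => ?_⟩
          · rw [hG]
            exact h i
          · have := Ideal.mem_map_of_mem
              (Pi.evalAlgHom K (fun _ : Fin r => (pow Unit B : Type u)) i) h
            rw [Ideal.map_mapₐ, hG] at this
            exact this
      comm := AlgHom.ext fun p => by
        let s₀ : plane K →ₐ[K] ξ.SA := ev (A := base K) (Algebra.ofId K ξ.SA) x hcx.mem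
        have hs₀ : ∀ j, s₀ ((base K).var j) = x j := fun j => ev_ofId_var _ _ j
        have hres₀ : ∀ p, ξ.resS (s₀ p) = p := AlgHom.congr_fun (hom_ext_base (C := plane K)
          (g := AlgHom.comp ξ.resS s₀) (h := AlgHom.id K (plane K)) fun j =>
            (congrArg ξ.resS (hs₀ j)).trans (hx j))
        change resRbar (fun i => φ i p) = parMap f (reduction (Fin 2) B p)
        rw [← hres₀ (reduction (Fin 2) B p), ← resRbar_φ, hresR, ← sub_eq_zero, ← map_sub,
          resRbar_eq_zero]
        intro i
        rw [← toFibre_eq_zero, Pi.sub_apply, map_sub, sub_eq_zero]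
        refine AlgHom.congr_fun (hom_ext_pow (g := ((ξ.toFibre i).comp (ρ i)).comp (φ i))
          (h := (ξ.toFibre i).comp (((ξ.φi i).comp s₀).comp (reduction (Fin 2) B)))
          (fun b => ?_) fun j => ?_) p
        · simp only [AlgHom.comp_apply]
          rw [hφc, reduction_constHom]
          simp only [AlgHom.commutes]
          exact (congrArg (ξ.toFibre i) (hρc i b)).trans (AlgHom.commutes _ _)
        · simp only [AlgHom.comp_apply]
          rw [hφv, reduction_var, hs₀]
          exact hρ i _
      branch := fun i => by
        have : resRbar (Pi.single i 1) = ξ.resRbar (Pi.single i 1) := by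
          rw [hresR]
          congr 1
          ext j
          by_cases hj : j = i
          · subst hj; simp
          · simp [hj]
        rw [this]
        exact ξ.branch i
      σ := σ
      σ_ι := AlgHom.ext hσc
      σbar := σbar
      σbar_φ := fun i => hom_ext_pow
        (fun b => (congrArg (σbar i) (hφc i b)).trans ((hσbc i b).trans (hσc b).symm)) fun j =>
        (congrArg (σbar i) (hφv i j)).trans ((hσbg i _).trans
          ((congrArg ψ (AlgHom.congr_fun (ξ.σbar_φ i) (x j))).trans (hσv j).symm)) }
  let g : SecDef.Hom ξ η :=
    { base := ψ
      onS := gS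
      onRbar := gR
      comm_ι := hgι
      comm_φ := fun s i => (hφg i s).symm
      comm_resS := AlgHom.congr_fun (hcx.hom_ext (C := plane K)
        (g₁ := (reduction (Fin 2) B).comp gS) (g₂ := ξ.resS) (fun a => by
          rw [AlgHom.comp_apply, hgι, AlgHom.comp_apply, reduction_constHom, CLAlg.res_map]
          exact (ξ.resS_ι a).symm) fun j => by
          rw [AlgHom.comp_apply, hgx, reduction_var, hx])
      comm_resRbar := hresg
      comm_σ := AlgHom.congr_fun (hcx.hom_ext (g₁ := σ.comp gS) (g₂ := ψ.comp ξ.σ)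
        (fun a => by
          rw [AlgHom.comp_apply, hgι, AlgHom.comp_apply, hσc]
          exact (congrArg ψ (AlgHom.congr_fun ξ.σ_ι a)).symm)
        fun j => (congrArg σ (hgx j)).trans (hσv j))
      comm_σbar := hσbg }
  exact ⟨η, g, IsHomLift.map (baseFunctor (parMap f)) (a := ξ) (b := η) g⟩

end SecDef

end CurveDef

/-! ### Induced objects and functors of isomorphism classes. -/

namespace CurveDef

section Fibred

universe v₁ v₂ v₃ u₁ u₂ u₃

variable {𝒮 : Type u₁} [Category.{v₁} 𝒮] {𝒳 : Type u₂} [Category.{v₂} 𝒳]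
  {𝒴 : Type u₃} [Category.{v₃} 𝒴]

/-- Induced objects exist and are unique up to isomorphism. -/
structure HasBaseChange (p : 𝒳 ⥤ 𝒮) : Prop where
  exists_lift : ∀ {A B : 𝒮} (ψ : A ⟶ B) {ξ : 𝒳}, p.obj ξ = A →
    ∃ (η : 𝒳) (g : ξ ⟶ η), p.IsHomLift ψ g
  exists_iso : ∀ {A B : 𝒮} (ψ : A ⟶ B) {ξ η η' : 𝒳} (g : ξ ⟶ η) (h : ξ ⟶ η'), p.IsHomLift ψ g →
    p.IsHomLift ψ h → ∃ k : η ≅ η', p.IsHomLift (𝟙 B) k.hom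

theorem isoClass_eq_of_iso {p : 𝒳 ⥤ 𝒮} {A : 𝒮} {ξ η : p.Fiber A} (k : ξ.1 ≅ η.1)
    (hk : p.IsHomLift (𝟙 A) k.hom) :
    Quotient.mk (isIsomorphicSetoid (p.Fiber A)) ξ = Quotient.mk _ η :=
  Quotient.sound ⟨⟨⟨k.hom, hk⟩, ⟨k.inv, inferInstance⟩, Subtype.ext k.hom_inv_id,
    Subtype.ext k.inv_hom_id⟩⟩

theorem HasBaseChange.hasInduced {p : 𝒳 ⥤ 𝒮} (hp : HasBaseChange p) : HasInduced p := by
  intro A B ψ x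
  obtain ⟨ξ, rfl⟩ := Quotient.exists_rep x
  obtain ⟨η, g, hg⟩ := hp.exists_lift ψ ξ.2
  refine ⟨Quotient.mk _ ⟨η, IsHomLift.codomain_eq p ψ g⟩, ⟨ξ, _, g, hg, rfl, rfl⟩, ?_⟩
  rintro _ ⟨ξ', η', g', hg', he, rfl⟩
  obtain ⟨e⟩ := Quotient.exact he
  have he' := e.inv.2
  obtain ⟨k, hk⟩ := hp.exists_iso ψ (e.inv.1 ≫ g') g inferInstance hg
  exact isoClass_eq_of_iso k hk

theorem HasBaseChange.of_full_faithful (F : 𝒳 ⥤ 𝒴) {q : 𝒴 ⥤ 𝒮} [F.Full] [F.Faithful]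
    (hs : ∀ y, ∃ x, F.obj x = y) (hq : HasBaseChange q) : HasBaseChange (F ⋙ q) where
  exists_lift {A B} ψ ξ hξ := by
    obtain ⟨η, g, hg⟩ := hq.exists_lift ψ (ξ := F.obj ξ) hξ
    obtain ⟨η, rfl⟩ := hs η
    obtain ⟨g, rfl⟩ := F.map_surjective g
    exact ⟨η, g, (isHomLift_comp_iff F q ψ g).2 hg⟩
  exists_iso {A B} ψ ξ η η' g h hg hh := by
    obtain ⟨k, hk⟩ := hq.exists_iso ψ (F.map g) (F.map h) ((isHomLift_comp_iff F q ψ g).1 hg)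
      ((isHomLift_comp_iff F q ψ h).1 hh)
    refine ⟨F.preimageIso k, (isHomLift_comp_iff F q _ _).2 ?_⟩
    rwa [Functor.preimageIso_hom, F.map_preimage]

/-- Base change is performed on preimages under F; by fullness, the morphisms to be compared also
come from the source. -/
theorem HasBaseChange.of_full (F : 𝒳 ⥤ 𝒴) {q : 𝒴 ⥤ 𝒮} [F.Full]
    (hs : ∀ y, ∃ x, F.obj x = y) (hp : HasBaseChange (F ⋙ q)) : HasBaseChange q where
  exists_lift {A B} ψ ξ hξ := by
    obtain ⟨ξ, rfl⟩ := hs ξ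
    obtain ⟨η, g, hg⟩ := hp.exists_lift ψ (ξ := ξ) hξ
    exact ⟨F.obj η, F.map g, (isHomLift_comp_iff F q ψ g).1 hg⟩
  exists_iso {A B} ψ ξ η η' g h hg hh := by
    obtain ⟨ξ, rfl⟩ := hs ξ
    obtain ⟨η, rfl⟩ := hs η
    obtain ⟨η', rfl⟩ := hs η'
    obtain ⟨g, rfl⟩ := F.map_surjective g
    obtain ⟨h, rfl⟩ := F.map_surjective h
    obtain ⟨k, hk⟩ := hp.exists_iso ψ g h ((isHomLift_comp_iff F q ψ g).2 hg)
      ((isHomLift_comp_iff F q ψ h).2 hh)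
    exact ⟨F.mapIso k, (isHomLift_comp_iff F q _ _).1 hk⟩

/-- The map on isomorphism classes induced by a functor. -/
def mapIsoClasses (F : 𝒳 ⥤ 𝒴) (q : 𝒴 ⥤ 𝒮) (A : 𝒮) : IsoClasses (F ⋙ q) A → IsoClasses q A :=
  Quotient.map (fibreFunctor F rfl A).obj fun _ _ ⟨e⟩ => ⟨(fibreFunctor F rfl A).mapIso e⟩

theorem IsInducedClass.map (F : 𝒳 ⥤ 𝒴) {q : 𝒴 ⥤ 𝒮} {A B : 𝒮} {ψ : A ⟶ B}
    {x : IsoClasses (F ⋙ q) A} {y : IsoClasses (F ⋙ q) B} (h : IsInducedClass (F ⋙ q) ψ x y) :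
    IsInducedClass q ψ (mapIsoClasses F q A x) (mapIsoClasses F q B y) := by
  obtain ⟨ξ, η, g, hg, rfl, rfl⟩ := h
  exact ⟨(fibreFunctor F rfl A).obj ξ, (fibreFunctor F rfl B).obj η, F.map g,
    (isHomLift_comp_iff F q ψ g).1 hg, rfl, rfl⟩

theorem mapIsoClasses_bijective (F : 𝒳 ⥤ 𝒴) (q : 𝒴 ⥤ 𝒮) [F.Full] (hs : ∀ y, ∃ x, F.obj x = y)
    (hp : HasBaseChange (F ⋙ q)) (A : 𝒮) : Function.Bijective (mapIsoClasses F q A) := by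
  constructor
  · intro x x' h
    obtain ⟨ζ, rfl⟩ := Quotient.exists_rep x
    obtain ⟨ζ', rfl⟩ := Quotient.exists_rep x'
    obtain ⟨e⟩ := Quotient.exact h
    obtain ⟨g, hg⟩ := F.map_surjective (X := ζ.1) (Y := ζ'.1) e.hom.1
    have hlift : (F ⋙ q).IsHomLift (𝟙 A) g := (isHomLift_comp_iff F q _ g).2 (by
      rw [hg]; exact e.hom.2)
    -- The lift g of an isomorphism need not visibly be one. But g and the identity of ζ both start
    -- at ζ and lie over the identity, so their targets are isomorphic by uniqueness of induced
    -- objects.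
    obtain ⟨k, hk⟩ := hp.exists_iso (𝟙 A) (𝟙 ζ.1) g (IsHomLift.id ζ.2) hlift
    exact isoClass_eq_of_iso k hk
  · intro y
    obtain ⟨η, rfl⟩ := Quotient.exists_rep y
    obtain ⟨ζ, hζ⟩ := hs η.1
    exact ⟨Quotient.mk _ ⟨ζ, (congrArg q.obj hζ).trans η.2⟩,
      congrArg (Quotient.mk _) (Subtype.ext hζ)⟩

/-- A full functor over `𝒮` which is surjective on objects induces an isomorphism of the functors
of isomorphism classes. -/
noncomputable def isoClassFunctorIso {𝒴 : Type u₂} [Category.{v₃} 𝒴] (F : 𝒳 ⥤ 𝒴) (q : 𝒴 ⥤ 𝒮)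
    [F.Full] (hs : ∀ y, ∃ x, F.obj x = y) (hp : HasBaseChange (F ⋙ q)) (hX : HasInduced (F ⋙ q))
    (hY : HasInduced q) : isoClassFunctor (F ⋙ q) hX ≅ isoClassFunctor q hY :=
  NatIso.ofComponents
    (fun A => (Equiv.ofBijective _ (mapIsoClasses_bijective F q hs hp A)).toIso)
    fun {A B} ψ => by
      ext x
      exact (hY ψ (mapIsoClasses F q A x)).choose_spec.2 _
        (IsInducedClass.map F (hX ψ x).choose_spec.1)

end Fibred

variable {K : Type u} [Field K] {r : ℕ} {f : Fin r → PS K}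

/-- Uniqueness is the usual argument for cocartesian arrows: each of two lifts of ψ factors through
the other, and the composites are identities because morphisms out of a lift are determined by their
base and their composite with it. -/
theorem SecDef.hasBaseChange (hf : ∀ i, f i ≠ 0) :
    HasBaseChange (SecDef.baseFunctor (parMap f)) where
  exists_lift {A B} ψ ξ hξ := by
    subst hξ
    exact ξ.exists_baseChange hf ψ
  exists_iso {A B} ψ ξ η η' g h hg hh := by
    let p := SecDef.baseFunctor (parMap f)
    have hη : p.obj η = B := IsHomLift.codomain_eq p ψ g
    have hη' : p.obj η' = B := IsHomLift.codomain_eq p ψ h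
    have hgf : p.map g = _ := IsHomLift.fac' p ψ g
    have hhf : p.map h = _ := IsHomLift.fac' p ψ h
    -- η and η' lie over B only up to an equality of objects, so the map of bases to be factored is
    -- an `eqToHom` rather than an identity.
    have h1 : p.map g ≫ eqToHom (hη.trans hη'.symm) = p.map h := by
      rw [hgf, hhf, Category.assoc, Category.assoc, eqToHom_trans]
    have h2 : p.map h ≫ eqToHom (hη'.trans hη.symm) = p.map g := by
      rw [hgf, hhf, Category.assoc, Category.assoc, eqToHom_trans]
    obtain ⟨k, hk, hgk⟩ := exists_hom_of_comp hf g h (eqToHom (hη.trans hη'.symm)) h1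
    obtain ⟨l, hl, hgl⟩ := exists_hom_of_comp hf h g (eqToHom (hη'.trans hη.symm)) h2
    let k' : η ⟶ η' := k
    let l' : η' ⟶ η := l
    have hgk : g ≫ k' = h := hgk
    have hgl : h ≫ l' = g := hgl
    have hk' : p.map k' = eqToHom (hη.trans hη'.symm) := hk
    have hl' : p.map l' = eqToHom (hη'.trans hη.symm) := hl
    refine ⟨⟨k', l', ?_, ?_⟩, IsHomLift.of_fac' p _ k' hη hη' ?_⟩
    · refine hom_ext_of_comp hf g (k := k' ≫ l') (l := 𝟙 η) ?_ ?_
      · change p.map (k' ≫ l') = p.map (𝟙 η)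
        rw [p.map_comp, hk', hl', eqToHom_trans, eqToHom_refl, p.map_id]
      · change g ≫ (k' ≫ l') = g ≫ 𝟙 η
        rw [← Category.assoc, hgk, hgl, Category.comp_id]
    · refine hom_ext_of_comp hf h (k := l' ≫ k') (l := 𝟙 η') ?_ ?_
      · change p.map (l' ≫ k') = p.map (𝟙 η')
        rw [p.map_comp, hk', hl', eqToHom_trans, eqToHom_refl, p.map_id]
      · change h ≫ (l' ≫ k') = h ≫ 𝟙 η'
        rw [← Category.assoc, hgl, hgk, Category.comp_id]
    · rw [Category.id_comp, eqToHom_trans]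
      exact hk'

end CurveDef

open CurveDef in
theorem proposition1p3 {K : Type u} [Field K] [IsAlgClosed K] {r : ℕ} (hr : 0 < r)
    (f : Fin r → PS K) (hf : ∀ i, Irreducible (f i)) (hred : IsReduced (CurveRing f)) :
    -- over each `A`, the forgetful functor to deformations of `P → R̄` is an equivalence, and every
    -- object lifts on the nose (uniquely up to a unique isomorphism, as the functor is full and
    -- faithful); this is the isomorphism of categories, up to the choice of the quotient ring `R_A`
    (∀ A : CLAlg K,
      (fibreFunctor (EmbDef.forgetPar f) (EmbDef.forgetPar_base f) A).IsEquivalence) ∧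
    (∀ ξ : ParDef f, ∃ ζ : EmbDef f, (EmbDef.forgetPar f).obj ζ = ξ) ∧
    -- the forgetful functor to deformations of `R → R̄` is smooth
    IsSmoothOver (SecDef.baseFunctor (normMap f)) (EmbDef.forgetNorm f) ∧
    -- both induce isomorphisms of the functors of isomorphism classes
    (∃ (hE : HasInduced (EmbDef.baseFunctor f))
      (hP : HasInduced (SecDef.baseFunctor (parMap f)))
      (hN : HasInduced (SecDef.baseFunctor (normMap f)))
      (α : isoClassFunctor _ hE ≅ isoClassFunctor _ hP)
      (β : isoClassFunctor _ hE ≅ isoClassFunctor _ hN),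
      (∀ ζ : EmbDef f,
        α.hom.app ((EmbDef.baseFunctor f).obj ζ) (isoClass (EmbDef.baseFunctor f) ζ) =
          isoClass (SecDef.baseFunctor (parMap f)) ((EmbDef.forgetPar f).obj ζ)) ∧
      (∀ ζ : EmbDef f,
        β.hom.app ((EmbDef.baseFunctor f).obj ζ) (isoClass (EmbDef.baseFunctor f) ζ) =
          isoClass (SecDef.baseFunctor (normMap f)) ((EmbDef.forgetNorm f).obj ζ)) ∧
      Nonempty (isoClassFunctor _ hP ≅ isoClassFunctor _ hN)) ∧
    -- the kernel of `φ_A` is principal, and every lifting is given by `R_A = P_A / ker φ_A`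
    (∀ ξ : ParDef f, (RingHom.ker ξ.φ).IsPrincipal) ∧
    (∀ ζ : EmbDef f,
      ∃ e : (((EmbDef.forgetPar f).obj ζ).SA ⧸ RingHom.ker ((EmbDef.forgetPar f).obj ζ).φ) ≃ₐ[K]
          ζ.toNorm.SA,
        ∀ s : ((EmbDef.forgetPar f).obj ζ).SA, e (Ideal.Quotient.mk _ s) = ζ.q s ∧
          ζ.toNorm.φ (e (Ideal.Quotient.mk _ s)) = ((EmbDef.forgetPar f).obj ζ).φ s) := by
  have hf0 : ∀ i, f i ≠ 0 := fun i => (hf i).ne_zero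
  have hP := SecDef.hasBaseChange hf0
  have := EmbDef.forgetPar_full f
  have := EmbDef.forgetPar_faithful f
  have := EmbDef.forgetNorm_full f
  have hsP := EmbDef.exists_forgetPar_eq hr hf0
  have hsN := EmbDef.exists_forgetNorm_eq hr hf
  have hE : HasBaseChange (EmbDef.baseFunctor f) := hP.of_full_faithful (EmbDef.forgetPar f) hsP
  have hN : HasBaseChange (SecDef.baseFunctor (normMap f)) :=
    HasBaseChange.of_full (EmbDef.forgetNorm f) hsN hE
  let α :=
    isoClassFunctorIso (EmbDef.forgetPar f) (SecDef.baseFunctor (parMap f)) hsP hE hE.hasInduced hP.hasInduced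
  let β :=
    isoClassFunctorIso (EmbDef.forgetNorm f) (SecDef.baseFunctor (normMap f)) hsN hE hE.hasInduced hN.hasInduced
  exact ⟨fibreFunctor_isEquivalence _ _ hsP, hsP, EmbDef.isSmoothOver_forgetNorm f hr hf,
    ⟨hE.hasInduced, hP.hasInduced, hN.hasInduced, α, β, fun _ => rfl, fun _ => rfl,
      ⟨α.symm ≪≫ β⟩⟩, fun ξ => (ξ.ker_φ hf0).1, fun ζ => ζ.exists_quotient_equiv⟩
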